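/- Let $\mathfrak g$ be the $N=2$ superconformal algebra in the Neveu–Schwarz moding, with generators $L_n,T_n$ ($n\in\mathbb Z$), $G^\pm_r$ ($r\in\mathbb Z+\tfrac12$), central $C$, and relations $[L_m,L_n]=(m-n)L_{m+n}+\tfrac{C}{12}(m^3-m)\delta_{m+n,0}$, $[L_m,G^\pm_r]=(\tfrac m2-r)G^\pm_{m+r}$, $[L_m,T_n]=-nT_{m+n}$, $[T_m,T_n]=\tfrac C3 m\,\delta_{m+n,0}$, $[T_m,G^\pm_r]=\pm G^\pm_{m+r}$, $\{G^+_r,G^-_s\}=2L_{r+s}+(r-s)T_{r+s}+\tfrac C3(r^2-\tfrac14)\delta_{r+s,0}$, $\{G^\pm_r,G^\pm_s\}=0$. Adjoin complex powers $L_{-1}^a$ ($a\in\mathbb C$, $L_{-1}^aL_{-1}^b=L_{-1}^{a+b}$, $L_{-1}^1=L_{-1}$), commuted with the other generators by the expansions $L_{-1}^aY=\sum_{i\ge0}\binom ai(\mathrm{ad}\,L_{-1})^i(Y)\,L_{-1}^{a-i}$ (for lowering operators $Y$) and $XL_{-1}^a=\sum_{i\ge0}\binom ai L_{-1}^{a-i}\,(-\mathrm{ad}\,L_{-1})^i(X)$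 (for operators $X$ of non-negative mode number). For a weight $\omega=(h,q,c)\in\mathbb C^3$ let $|h,q,c\rangle$ be a vector with $L_0=h$, $T_0=q$, $C=c$, annihilated by $L_n,T_n$ ($n\ge1$) and $G^\pm_r$ ($r\ge\frac12$). Let $X$ run over the ordered monomials $L_{-i_I}\cdots L_{-i_1}T_{-k_K}\cdots T_{-k_1}G^+_{-j_J}\cdots G^+_{-j_1}G^-_{-l_M}\cdots G^-_{-l_1}$ with $i_I\ge\dots\ge i_1\ge2$, $k_K\ge\dots\ge k_1\ge1$, $j_J>\dots>j_1\ge\frac12$, $l_M>\dots>l_1\ge\frac12$, and let $|X|$ be the sum of all the mode indices. An operator at grade vector $\xi=(a,p,0)$, $a\in\mathbb C$, $p\in\mathbb Z$, is a formal, possibly infinite, series $\Theta=\sum_X\lambda_X X L_{-1}^{a-|X|}$. It is a *singular vector operator* with weight $\omega$ at grade $\xi$ if $\Psi=\Theta|h,q,c\rangle$ satisfies $L_0\Psi=(h+a)\Psi$, $T_0\Psi=(q+p)\Psi$, and if every $L_n,T_n$ ($n\ge1$) and $G^\pm_r$ ($r\ge\frac12$) maps every cut-off $\Psi^M=\sum_{|X|\le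 M}\lambda_XXL_{-1}^{a-|X|}|h,q,c\rangle$ into $\mathcal O(a-M)$, the span of the vectors $XL_{-1}^{a-M-k}|h,q,c\rangle$ with $k\in\{0,\tfrac12,1,\dots\}$; here $M\in\frac12\mathbb Z_{\ge0}$ with $M\equiv\frac p2$ mod $\mathbb Z$. Its powers of $L_{-1}$ being formal, the product $\Theta_2\Theta_1$ of two such series is their formal Cauchy product, reordered into such a series by the expansions above. Write $\theta(\alpha,\beta)$ for the neutral ($p=0$) singular vector operator, with given $\omega$ and $\xi$, whose leading part is $\alpha\,G^+_{-1/2}G^-_{-1/2}L_{-1}^{a-1}+\beta\,G^-_{-1/2}G^+_{-1/2}L_{-1}^{a-1}$, that is, $2\beta L_{-1}^a+(\alpha-\beta)G^+_{-1/2}G^-_{-1/2}L_{-1}^{a-1}$ in the basis of ordered monomials. Write $\Theta^\pm$ for a singular vector operator of charge $p=\pm1$, with weight $\omega^\pm$ at grade $\xi^\pm=(a^\pm,\pm1,0)$, normalised so that the coefficient of $G^\pm_{-1/2}L_{-1}^{a^\pm-1/2}$ is $1$. Two pairs are related, $(\omega,\xi)\sim(\omega',\xi')$, if $\omega+\xi=\omega'$.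 **Theorem.** Assume $c\neq3$. 1. If $\theta_i(\alpha_i,\beta_i)$ ($i=1,2$) are neutral singular vector operators with weight $\omega_i$ at grade $\xi_i$ and $(\omega_1,\xi_1)\sim(\omega_2,\xi_2)$, then, with weight $\omega_1$ at grade $\xi_1+\xi_2$, the operator $\theta(\alpha_1\alpha_2,\beta_1\beta_2)$ exists and is unique, and $\theta_2(\alpha_2,\beta_2)\,\theta_1(\alpha_1,\beta_1)=2\,\theta(\alpha_1\alpha_2,\beta_1\beta_2)$. 2. If $(\omega^+,\xi^+)\sim(\omega^-,\xi^-)$, then, with weight $\omega^+$ at grade $\xi^++\xi^-$, the operator $\theta(0,1)$ exists and is unique, and $\Theta^-\Theta^+=\theta(0,1)$. 3. If $(\omega^-,\xi^-)\sim(\omega^+,\xi^+)$, then, with weight $\omega^-$ at grade $\xi^-+\xi^+$, the operator $\theta(1,0)$ exists and is unique, and $\Theta^+\Theta^-=\theta(1,0)$. -/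

import Mathlib

noncomputable section

namespace N2

/-! ### The superconformal algebra and its universal enveloping algebra -/

/-- Generators of the `N = 2` superconformal algebra in the Neveu-Schwarz moding.
The half-integer modes are indexed by integers: `Gp n` is `G⁺_{n+1/2}` and `Gm n` is `G⁻_{n+1/2}`.
In particular `Gp (-1)` is `G⁺_{-1/2}` and `Gm (-1)` is `G⁻_{-1/2}`. -/
inductive Gen : Type
  | L (n : ℤ) : Gen
  | T (n : ℤ) : Gen
  | Gp (n : ℤ) : Gen
  | Gm (n : ℤ) : Gen
  | C : Gen

/-- The free associative algebra on the generators. -/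
abbrev Free : Type := FreeAlgebra ℂ Gen

/-- A generator, as an element of the free algebra. -/
def fr (g : Gen) : Free := FreeAlgebra.ι ℂ g

/-- The commutator. -/
def comm {A : Type*} [Ring A] (x y : A) : A := x * y - y * x

/-- The anticommutator. -/
def anti {A : Type*} [Ring A] (x y : A) : A := x * y + y * x

/-- The (anti-)commutation relations. With `r = m + 1/2` and `s = n + 1/2` one has
`r + s = m + n + 1`, `r - s = m - n` and `r² - 1/4 = m (m + 1)`. -/
inductive Rel : Free → Free → Prop
  | LL (m n : ℤ) : Rel (comm (fr (.L m)) (fr (.L n)))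
      (((m : ℂ) - n) • fr (.L (m + n))
        + (if m + n = 0 then ((m : ℂ) ^ 3 - m) / 12 else 0) • fr .C)
  | LGp (m n : ℤ) : Rel (comm (fr (.L m)) (fr (.Gp n)))
      (((m : ℂ) / 2 - (n + 1 / 2)) • fr (.Gp (m + n)))
  | LGm (m n : ℤ) : Rel (comm (fr (.L m)) (fr (.Gm n)))
      (((m : ℂ) / 2 - (n + 1 / 2)) • fr (.Gm (m + n)))
  | LT (m n : ℤ) : Rel (comm (fr (.L m)) (fr (.T n))) ((-(n : ℂ)) • fr (.T (m + n)))
  | TT (m n : ℤ) : Rel (comm (fr (.T m)) (fr (.T n)))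
      ((if m + n = 0 then (m : ℂ) / 3 else 0) • fr .C)
  | TGp (m n : ℤ) : Rel (comm (fr (.T m)) (fr (.Gp n))) (fr (.Gp (m + n)))
  | TGm (m n : ℤ) : Rel (comm (fr (.T m)) (fr (.Gm n))) (-fr (.Gm (m + n)))
  | GpGm (m n : ℤ) : Rel (anti (fr (.Gp m)) (fr (.Gm n)))
      ((2 : ℂ) • fr (.L (m + n + 1)) + ((m : ℂ) - n) • fr (.T (m + n + 1))
        + (if m + n + 1 = 0 then (m : ℂ) * (m + 1) / 3 else 0) • fr .C)
  | GpGp (m n : ℤ) : Rel (anti (fr (.Gp m)) (fr (.Gp n))) 0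
  | GmGm (m n : ℤ) : Rel (anti (fr (.Gm m)) (fr (.Gm n))) 0
  | C (g : Gen) : Rel (comm (fr g) (fr .C)) 0

/-- The universal enveloping algebra of the superconformal algebra. -/
def U : Type := RingQuot Rel

instance : Ring U := inferInstanceAs (Ring (RingQuot Rel))

instance : Algebra ℂ U := inferInstanceAs (Algebra ℂ (RingQuot Rel))

/-- The quotient map onto the enveloping algebra. -/
def toU : Free →ₐ[ℂ] U := RingQuot.mkAlgHom ℂ Rel

/-- A generator, as an element of the enveloping algebra. -/
def gen (g : Gen) : U := toU (fr g)

/-- The generators of the subalgebra of raising operators: `L_n`, `T_n` for `n ≥ 1` and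
`G^±_r` for `r ≥ 1/2`. -/
def raising : Set U :=
  {x | ∃ n : ℕ, x = gen (.L (n + 1)) ∨ x = gen (.T (n + 1)) ∨ x = gen (.Gp n) ∨ x = gen (.Gm n)}

/-! ### Ordered monomials without `L_{-1}` -/

/-- Index of an ordered monomial in the lowering operators other than `L_{-1}`.
An entry `n` of `I`, `J`, `Kp`, `Km` stands for a factor `L_{-(n+2)}`, `T_{-(n+1)}`,
`G⁺_{-(n+1/2)}`, `G⁻_{-(n+1/2)}` respectively. -/
@[ext] structure Idx : Type where
  I : Multiset ℕ
  J : Multiset ℕ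
  Kp : Finset ℕ
  Km : Finset ℕ

/-- The ordered monomial
`L_{-i_a} ⋯ L_{-i_1} T_{-k_b} ⋯ T_{-k_1} G⁺_{-j_c} ⋯ G⁺_{-j_1} G⁻_{-l_d} ⋯ G⁻_{-l_1}`,
each group of modes being sorted as `i_a ≥ ⋯ ≥ i_1`. -/
def mono (X : Idx) : U :=
  ((X.I.sort (· ≥ ·)).map fun n : ℕ => gen (.L (-((n : ℤ) + 2)))).prod
    * ((X.J.sort (· ≥ ·)).map fun n : ℕ => gen (.T (-((n : ℤ) + 1)))).prod
    * ((X.Kp.sort (· ≥ ·)).map fun n : ℕ => gen (.Gp (-((n : ℤ) + 1)))).prod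
    * ((X.Km.sort (· ≥ ·)).map fun n : ℕ => gen (.Gm (-((n : ℤ) + 1)))).prod

/-- Twice the grade of a monomial (the grade is a half-integer). -/
def twoGrade (X : Idx) : ℕ :=
  (X.I.map fun n => 2 * (n + 2)).sum + (X.J.map fun n => 2 * (n + 1)).sum
    + (∑ n ∈ X.Kp, (2 * n + 1)) + ∑ n ∈ X.Km, (2 * n + 1)

/-- The monomial `1`. -/
def idxOne : Idx := ⟨0, 0, ∅, ∅⟩

/-- The monomial `G⁺_{-1/2}`. -/
def idxP : Idx := ⟨0, 0, {0}, ∅⟩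

/-- The monomial `G⁻_{-1/2}`. -/
def idxM : Idx := ⟨0, 0, ∅, {0}⟩

/-- The monomial `G⁺_{-1/2} G⁻_{-1/2}`. -/
def idxPM : Idx := ⟨0, 0, {0}, {0}⟩

theorem multiset_le_of_sum_le (s : Multiset ℕ) (f : ℕ → ℕ) (hf : ∀ n, n + 1 ≤ f n) (m : ℕ)
    (h : (s.map f).sum ≤ m) : s ≤ m • Multiset.range m := by
  rw [Multiset.le_iff_count]
  intro a
  by_cases ha : a ∈ s
  · have h1 : f a ≤ (s.map f).sum := Multiset.single_le_sum (by simp) _ (Multiset.mem_map_of_mem f ha)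
    have h2 : Multiset.card s ≤ (s.map f).sum := by
      have := Multiset.card_nsmul_le_sum (s := s.map f) (a := 1)
        (by intro x hx; obtain ⟨n, -, rfl⟩ := Multiset.mem_map.1 hx; have := hf n; omega)
      simpa using this
    have h3 := Multiset.count_le_card a s
    have h4 : a < m := by have := hf a; omega
    rw [Multiset.count_nsmul, Multiset.count_eq_one_of_mem (Multiset.nodup_range m)
      (Multiset.mem_range.2 h4)]
    simp only [mul_one]
    omega
  · rw [Multiset.count_eq_zero_of_notMem ha]; exact Nat.zero_le _

/-- There are only finitely many monomials up to a given grade. -/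
theorem finite_twoGrade_le (m : ℕ) : {X : Idx | twoGrade X ≤ m}.Finite := by
  have hs : ({X : Idx | twoGrade X ≤ m}) ⊆
      (fun p : (Multiset ℕ × Multiset ℕ) × (Finset ℕ × Finset ℕ) =>
        (⟨p.1.1, p.1.2, p.2.1, p.2.2⟩ : Idx)) ''
      ((Set.Iic (m • Multiset.range m) ×ˢ Set.Iic (m • Multiset.range m)) ×ˢ
        (Set.Iic (Finset.range m) ×ˢ Set.Iic (Finset.range m))) := by
    rintro ⟨I, J, Kp, Km⟩ hX
    simp only [Set.mem_ofPred_eq, twoGrade] at hX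
    have hK : ∀ K : Finset ℕ, (∑ n ∈ K, (2 * n + 1)) ≤ m → K ≤ Finset.range m := by
      intro K hK n hn
      have := Finset.single_le_sum (f := fun n => 2 * n + 1) (fun _ _ => Nat.zero_le _) hn
      simp only [Finset.mem_range]
      omega
    refine ⟨((I, J), (Kp, Km)), ⟨⟨?_, ?_⟩, ?_, ?_⟩, rfl⟩
    · exact multiset_le_of_sum_le I (fun n => 2 * (n + 2)) (fun n => by omega) m (by omega)
    · exact multiset_le_of_sum_le J (fun n => 2 * (n + 1)) (fun n => by omega) m (by omega)
    · exact hK Kp (by omega)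
    · exact hK Km (by omega)
  exact (((Set.finite_Iic _).prod (Set.finite_Iic _)).prod
    ((Set.finite_Iic _).prod (Set.finite_Iic _))).image _ |>.subset hs

/-- The finite set of monomials `X` of grade at most `m / 2`. -/
def idxLE (m : ℕ) : Finset Idx := (finite_twoGrade_le m).toFinset

/-! ### Weights, the extended Verma module, and formal series -/

/-- A weight vector `ω = (h, q, c)`. -/
@[ext] structure Weight : Type where
  h : ℂ
  q : ℂ
  c : ℂ

/-- A grade vector `ξ = (a, p, 0)`. -/
@[ext] structure Grade : Type where
  a : ℂ
  p : ℤ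

/-- The weight `ω + ξ`. -/
def Weight.shift (ω : Weight) (ξ : Grade) : Weight := ⟨ω.h + ξ.a, ω.q + ξ.p, ω.c⟩

/-- The sum of two grade vectors. -/
def Grade.add (ξ ξ' : Grade) : Grade := ⟨ξ.a + ξ'.a, ξ.p + ξ'.p⟩

/-- The relation `(ω₁, ξ₁) ∼ (ω₂, ξ₂)`, that is `ω₁ + ξ₁ = ω₂`. -/
def Related (ω₁ : Weight) (ξ₁ : Grade) (ω₂ : Weight) : Prop := ω₁.shift ξ₁ = ω₂

/-- The falling product `a (a - 1) ⋯ (a - n + 1)`. -/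
def fall (a : ℂ) (n : ℕ) : ℂ := ∏ j ∈ Finset.range n, (a - j)

/-- The generalised binomial coefficient. -/
def binom (a : ℂ) (n : ℕ) : ℂ := fall a n / (n.factorial : ℂ)

/-- The symbol `L_{-1}^a |h,q,c⟩` in the free module on such symbols. -/
def sym (a : ℂ) : ℂ →₀ U := Finsupp.single a 1

/-- The defining relations of the extended Verma module: the action of `L_{-1}`, of the central
element, and of the operators of non-negative mode number on `L_{-1}^a |h,q,c⟩`. The latter come
from `X L_{-1}^a = ∑_i binom(a,i) (…)_i L_{-1}^{a-i} X_{-i}`, where `X_{-i}` is `X` with its mode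
number lowered by `i`, together with the highest weight conditions. -/
def vermaRels (ω : Weight) : Set (ℂ →₀ U) :=
  {x | ∃ a : ℂ,
    x = gen (.L (-1)) • sym a - sym (a + 1) ∨
    x = gen .C • sym a - ω.c • sym a ∨
    ∃ m : ℕ,
      x = gen (.L m) • sym a - ((m + 1) * fall a m * ω.h + fall a (m + 1)) • sym (a - m) ∨
      x = gen (.T m) • sym a - (fall a m * ω.q) • sym (a - m) ∨
      x = gen (.Gp m) • sym a - fall a (m + 1) • (gen (.Gp (-1)) • sym (a - (m + 1))) ∨
      x = gen (.Gm m) • sym a - fall a (m + 1) • (gen (.Gm (-1)) • sym (a - (m + 1)))}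

/-- The finite part of the extended Verma module: finite linear combinations of vectors
`X L_{-1}^a |h,q,c⟩` with `a ∈ ℂ`. -/
abbrev Verma (ω : Weight) : Type := (ℂ →₀ U) ⧸ Submodule.span U (vermaRels ω)

/-- The vector `L_{-1}^a |h,q,c⟩`. -/
def vec (ω : Weight) (a : ℂ) : Verma ω := Submodule.Quotient.mk (sym a)

/-- The finite part of the space of operators: finite linear combinations of operators
`X L_{-1}^a` with `X` in the enveloping algebra and `a ∈ ℂ`, where `L_{-1} L_{-1}^a = L_{-1}^{a+1}`. -/
abbrev Ops : Type :=
  (ℂ →₀ U) ⧸ Submodule.span U {x | ∃ a : ℂ, x = gen (.L (-1)) • sym a - sym (a + 1)}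

/-- The operator `L_{-1}^a`. -/
def pow (a : ℂ) : Ops := Submodule.Quotient.mk (sym a)

/-- A formal operator series at grade `a`,
`Θ = ∑_X λ_X X L_{-1}^{a - |X|}` (possibly infinite), is given by its coefficients `λ_X`. -/
abbrev Series : Type := Idx → ℂ

section

variable {V : Type*} [AddCommGroup V] [Module U V] [Module ℂ V]

/-- The part of grade at most `m / 2` of the series with coefficients `Θ` at grade `a`, namely
`∑_{|X| ≤ m/2} λ_X X L_{-1}^{a-|X|}`. Here `e s` is `L_{-1}^s` or `L_{-1}^s |h,q,c⟩`. -/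
def cutoff (e : ℂ → V) (a : ℂ) (Θ : Series) (m : ℕ) : V :=
  ∑ X ∈ idxLE m, Θ X • (mono X • e (a - (twoGrade X : ℂ) / 2))

/-- The elements of order `O(b)`: combinations of the basis elements `X L_{-1}^{b-k}`
with `k ∈ {0, 1/2, 1, …}`. -/
def order (e : ℂ → V) (b : ℂ) : Submodule ℂ V :=
  Submodule.span ℂ {v | ∃ (X : Idx) (k : ℕ), v = mono X • e (b - (k : ℂ) / 2)}

end

/-! ### Singular vector operators and their products -/

/-- `Θ` is a singular vector operator with weight `ω` at grade `ξ = (a, p, 0)`: the series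
`Ψ = Θ |h,q,c⟩` has `L₀`-weight `h + a` and charge `q + p`, and every raising operator maps each
cut off vector `Ψ^M` into `O(a - M)`. The cut off `M = m / 2` runs over the grades `|X|` of
monomials `X` of charge `p`: integers if `p` is even, half-integers if `p` is odd. -/
structure IsSingularOp (ω : Weight) (ξ : Grade) (Θ : Series) : Prop where
  weight : ∀ m : ℕ, gen (.L 0) • cutoff (vec ω) ξ.a Θ m
    = (ω.h + ξ.a) • cutoff (vec ω) ξ.a Θ m
  charge : ∀ m : ℕ, gen (.T 0) • cutoff (vec ω) ξ.a Θ m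
    = (ω.q + ξ.p) • cutoff (vec ω) ξ.a Θ m
  raise : ∀ m : ℕ, (m : ℤ) ≡ ξ.p [ZMOD 2] → ∀ x ∈ raising,
    x • cutoff (vec ω) ξ.a Θ m ∈ order (vec ω) (ξ.a - (m : ℂ) / 2)

/-- The leading part of a neutral series at grade `a` is
`α G⁺_{-1/2} G⁻_{-1/2} L_{-1}^{a-1} + β G⁻_{-1/2} G⁺_{-1/2} L_{-1}^{a-1}`. In the basis of ordered
monomials this reads `2 β L_{-1}^a + (α - β) G⁺_{-1/2} G⁻_{-1/2} L_{-1}^{a-1}`. -/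
def HasLeading (Θ : Series) (α β : ℂ) : Prop := Θ idxOne = 2 * β ∧ Θ idxPM = α - β

/-- `Θ` is `θ(α, β)`: the neutral singular vector operator with weight `ω` at grade `ξ` and leading
coefficients `α`, `β`. -/
def IsTheta (ω : Weight) (ξ : Grade) (α β : ℂ) (Θ : Series) : Prop :=
  ξ.p = 0 ∧ IsSingularOp ω ξ Θ ∧ HasLeading Θ α β

/-- `Θ` is the singular vector operator `Θ⁺` of charge `+1`, with leading term
`G⁺_{-1/2} L_{-1}^{a-1/2}`. -/
def IsThetaPlus (ω : Weight) (ξ : Grade) (Θ : Series) : Prop :=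
  ξ.p = 1 ∧ IsSingularOp ω ξ Θ ∧ Θ idxP = 1

/-- `Θ` is the singular vector operator `Θ⁻` of charge `-1`, with leading term
`G⁻_{-1/2} L_{-1}^{a-1/2}`. -/
def IsThetaMinus (ω : Weight) (ξ : Grade) (Θ : Series) : Prop :=
  ξ.p = -1 ∧ IsSingularOp ω ξ Θ ∧ Θ idxM = 1

/-- The first `N + 1` terms of
`X L_{-1}^s Y L_{-1}^t = ∑_i binom(s,i) X [L_{-1},[L_{-1},…[L_{-1},Y]…]] L_{-1}^{s+t-i}`. -/
def mulTrunc (x : U) (s : ℂ) (y : U) (t : ℂ) (N : ℕ) : Ops :=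
  ∑ i ∈ Finset.range (N + 1),
    binom s i • ((x * (comm (gen (.L (-1))))^[i] y) • pow (s + t - i))

/-- The product of the series `Θ₂` at grade `a₂` and `Θ₁` at grade `a₁`, truncated in all
summations. -/
def prodTrunc (a₂ : ℂ) (Θ₂ : Series) (a₁ : ℂ) (Θ₁ : Series) (N : ℕ) : Ops :=
  ∑ X ∈ idxLE N, ∑ Y ∈ idxLE N, (Θ₂ X * Θ₁ Y) •
    mulTrunc (mono X) (a₂ - (twoGrade X : ℂ) / 2) (mono Y) (a₁ - (twoGrade Y : ℂ) / 2) N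

/-- The series `Θ` at grade `a₂ + a₁` is the formal Cauchy product `Θ₂ Θ₁`: the truncated products
agree with the cut offs of `Θ` up to terms whose order tends to `-∞`. -/
def IsCauchyProduct (ξ₂ : Grade) (Θ₂ : Series) (ξ₁ : Grade) (Θ₁ : Series) (Θ : Series) : Prop :=
  ∀ K : ℕ, ∃ N₀ : ℕ, ∀ N ≥ N₀,
    prodTrunc ξ₂.a Θ₂ ξ₁.a Θ₁ N - cutoff pow (ξ₂.a + ξ₁.a) Θ N
      ∈ order pow (ξ₂.a + ξ₁.a - K)

/-- The conversion between the two descriptions of the leading part in `HasLeading`. -/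
theorem leading_part (a α β : ℂ) :
    α • ((gen (.Gp (-1)) * gen (.Gm (-1))) • pow (a - 1))
      + β • ((gen (.Gm (-1)) * gen (.Gp (-1))) • pow (a - 1))
    = (2 * β) • (mono idxOne • pow a) + (α - β) • (mono idxPM • pow (a - 1)) := by
  have h1 : mono idxOne = 1 := by simp [mono, idxOne]
  have h2 : mono idxPM = gen (.Gp (-1)) * gen (.Gm (-1)) := by simp [mono, idxPM]
  have h3 : gen (.L (-1)) • pow (a - 1) = pow a := by
    have : gen (.L (-1)) • sym (a - 1) - sym (a - 1 + 1) ∈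
        Submodule.span U {x | ∃ a : ℂ, x = gen (.L (-1)) • sym a - sym (a + 1)} :=
      Submodule.subset_span ⟨a - 1, rfl⟩
    have h := (Submodule.Quotient.eq _).2 this
    rw [sub_add_cancel] at h
    simpa [pow] using h
  have h4 : gen (.Gm (-1)) * gen (.Gp (-1)) =
      (2 : ℂ) • gen (.L (-1)) - gen (.Gp (-1)) * gen (.Gm (-1)) := by
    have h : toU _ = toU _ := RingQuot.mkAlgHom_rel ℂ (Rel.GpGm (-1) (-1))
    simp only [anti, map_add, map_mul, map_smul] at h
    norm_num at h
    rw [eq_sub_iff_add_eq, add_comm]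
    exact h
  rw [h1, h2, h4, sub_smul, smul_assoc, h3, one_smul, smul_sub, sub_smul, smul_smul, mul_comm β 2]
  abel

end N2

end

noncomputable section

namespace N2

/-! ### Brackets of generators -/

/-! All statements are reduced to coefficients in the extended Verma module, so a basis comes first:
the vectors `mono X • vec ω b` (`vb`). Words in the generators, applied to a symbol `L_{-1}^b
|h,q,c⟩`, form a rewriting system: unsorted neighbours are exchanged, squares of odd letters vanish,
and a last letter that is central, equal to `L_{-1}` or of non-negative mode acts on the symbol. It
terminates (`below_wf`) and is confluent (`red_confluent`): overlaps are resolved by the super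
Jacobi identity and by the compatibility of the highest weight rules with the brackets
(`tailDefect_eq_zero`). The irreducible words are the ordered monomials.

A product of singular operators is singular because `Θ₁ |h,q,c⟩` behaves like a highest weight
vector of weight `ω₂ = ω₁ + ξ₁`. Let `w_N(b)` be the truncated expansion of `L_{-1}^b Θ₁ |h,q,c⟩`
(`powSeries`). For natural `b`, ordinary commutation shows that `w_N` satisfies the defining
relations of the module of weight `ω₂`, up to vectors whose exponents tend to `-∞` with `N`. All
coefficients are polynomial in `b`, so this persists for complex `b` (`PolyFam.mem_E`,
`IsSingularOp.vermaRels_mem`). Sending `L_{-1}^b |ω₂⟩` to `w_N(b)` then carries the singularity of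
`Θ₂` over to the product (`null_raise_prodVec`, `IsSingularOp.prod`). Convergence rests on one
estimate: an ordered monomial, and each of its iterated commutators with `L_{-1}`, raises the real
part of the exponent by at most `1` (`adL_pow_mono_smul_E`). It also gives existence and uniqueness
of the Cauchy product (`isCauchyProduct_iff`).

For the leading part, monomials with a letter other than `G^±_{-1/2}` can be discarded, and only
leading parts contribute (`prodVec_lead`). Formally, `e = G⁺G⁻/(2L_{-1})` and `f = G⁻G⁺/(2L_{-1})`,
with all modes `-1/2`, are orthogonal idempotents with sum `1`, and `θ(α, β)` starts with `2
L_{-1}^a (α e + β f)`. So the coefficients multiply, with an extra factor `2`; the charged cases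
give `2 L_{-1} f` and `2 L_{-1} e`.

Uniqueness says that a neutral singular operator without leading part vanishes
(`IsSingularOp.eq_zero`). Give `L_{-1}` and one unit of the exponent level `2`, the other `L_n` and
the odd letters level `1`, and `T_n` level `0`. In the part of the operator of highest total level,
`L_{n+1}` replaces a letter `L_{-n-2}` by a multiple of `L_{-1}`, and `G^±_{n+1/2}` does so with
`G^∓_{-n-3/2}`, modulo lower level. Singularity makes the result vanish at that level, so these
letters are absent. The bracket of `T_{p+1}` and `T_{-p-1}` is only central; it is replaced by
`corrT`, which is `L_{-1} T_{p+1} - ½ ∑ G⁺_r G⁻_s` with `r + s = p`. This trades `T_{-p-1}` for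
`(c/3 - 1)(p + 1) L_{-1}`, which is where `c ≠ 3` is used. -/

/-- A generator is odd. -/
def Gen.odd : Gen → Bool
  | .Gp _ => true
  | .Gm _ => true
  | _ => false

/-- The sign in the exchange of two generators. -/
def sgn (x y : Gen) : ℂ := if x.odd && y.odd then -1 else 1

section

variable {M N : Type*} [AddCommGroup M] [Module ℂ M] [AddCommGroup N] [Module ℂ N]

/-- The super bracket of two generators, with each generator `g` replaced by `φ g`. -/
def brk (φ : Gen → M) : Gen → Gen → M
  | .L m, .L n => ((m : ℂ) - n) • φ (.L (m + n))
      + (if m + n = 0 then ((m : ℂ) ^ 3 - m) / 12 else 0) • φ .C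
  | .L m, .T n => (-(n : ℂ)) • φ (.T (m + n))
  | .T m, .L n => (m : ℂ) • φ (.T (m + n))
  | .L m, .Gp n => ((m : ℂ) / 2 - (n + 1 / 2)) • φ (.Gp (m + n))
  | .Gp m, .L n => ((m : ℂ) + 1 / 2 - n / 2) • φ (.Gp (m + n))
  | .L m, .Gm n => ((m : ℂ) / 2 - (n + 1 / 2)) • φ (.Gm (m + n))
  | .Gm m, .L n => ((m : ℂ) + 1 / 2 - n / 2) • φ (.Gm (m + n))
  | .T m, .T n => (if m + n = 0 then (m : ℂ) / 3 else 0) • φ .C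
  | .T m, .Gp n => φ (.Gp (m + n))
  | .Gp m, .T n => -φ (.Gp (m + n))
  | .T m, .Gm n => -φ (.Gm (m + n))
  | .Gm m, .T n => φ (.Gm (m + n))
  | .Gp m, .Gm n => (2 : ℂ) • φ (.L (m + n + 1)) + ((m : ℂ) - n) • φ (.T (m + n + 1))
      + (if m + n + 1 = 0 then (m : ℂ) * (m + 1) / 3 else 0) • φ .C
  | .Gm m, .Gp n => (2 : ℂ) • φ (.L (m + n + 1)) + ((n : ℂ) - m) • φ (.T (m + n + 1))
      + (if m + n + 1 = 0 then (m : ℂ) * (m + 1) / 3 else 0) • φ .C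
  | .Gp _, .Gp _ => 0
  | .Gm _, .Gm _ => 0
  | .C, _ => 0
  | _, .C => 0

/-- The generator `g` occurs in the super bracket of `x` and `y`. -/
def Occ : Gen → Gen → Gen → Prop
  | .L m, .L n, g => (g = .L (m + n) ∧ m ≠ n) ∨ (g = .C ∧ m + n = 0)
  | .L m, .T n, g => g = .T (m + n) ∧ n ≠ 0
  | .T m, .L n, g => g = .T (m + n) ∧ m ≠ 0
  | .L m, .Gp n, g => g = .Gp (m + n) ∧ m ≠ 2 * n + 1
  | .Gp m, .L n, g => g = .Gp (m + n) ∧ n ≠ 2 * m + 1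
  | .L m, .Gm n, g => g = .Gm (m + n) ∧ m ≠ 2 * n + 1
  | .Gm m, .L n, g => g = .Gm (m + n) ∧ n ≠ 2 * m + 1
  | .T m, .T n, g => g = .C ∧ m + n = 0 ∧ m ≠ 0
  | .T m, .Gp n, g => g = .Gp (m + n)
  | .Gp m, .T n, g => g = .Gp (m + n)
  | .T m, .Gm n, g => g = .Gm (m + n)
  | .Gm m, .T n, g => g = .Gm (m + n)
  | .Gp m, .Gm n, g => g = .L (m + n + 1) ∨ (g = .T (m + n + 1) ∧ m ≠ n) ∨
      (g = .C ∧ m + n + 1 = 0 ∧ m ≠ 0 ∧ n ≠ 0)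
  | .Gm m, .Gp n, g => g = .L (m + n + 1) ∨ (g = .T (m + n + 1) ∧ m ≠ n) ∨
      (g = .C ∧ m + n + 1 = 0 ∧ m ≠ 0 ∧ n ≠ 0)
  | _, _, _ => False

theorem map_brk (f : M →ₗ[ℂ] N) (φ : Gen → M) (x y : Gen) :
    f (brk φ x y) = brk (fun g => f (φ g)) x y := by
  cases x <;> cases y <;> simp only [brk, map_add, map_smul, map_neg, map_zero]

theorem brk_sub (φ ψ : Gen → M) (x y : Gen) :
    brk (fun g => φ g - ψ g) x y = brk φ x y - brk ψ x y := by
  cases x <;> cases y <;> simp only [brk] <;> module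

theorem brk_smul (c : ℂ) (φ : Gen → M) (x y : Gen) :
    brk (fun g => c • φ g) x y = c • brk φ x y := by
  cases x <;> cases y <;> simp only [brk] <;> module

/-- Every generator with a non-zero coefficient satisfies `Occ`, so bounds on brackets can be
checked one generator at a time, without looking at the coefficients. All filtration arguments use
brackets in this form. -/
theorem brk_mem (S : Submodule ℂ M) (φ : Gen → M) (x y : Gen) (h : ∀ g, Occ x y g → φ g ∈ S) :
    brk φ x y ∈ S := by
  have key : ∀ (c : ℂ) (g : Gen), (c ≠ 0 → Occ x y g) → c • φ g ∈ S := by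
    intro c g hg
    by_cases hc : c = 0
    · simp [hc]
    · exact S.smul_mem _ (h _ (hg hc))
  cases x with
  | L m => 
    cases y with
    | L n =>
      refine S.add_mem (key _ _ fun hc => Or.inl ⟨rfl, ?_⟩) (key _ _ fun hc => Or.inr ⟨rfl, ?_⟩)
      · rintro rfl; simp at hc
      · by_contra hn; simp [hn] at hc
    | T n => exact key _ _ fun hc => ⟨rfl, by rintro rfl; simp at hc⟩
    | Gp n => 
      refine key _ _ fun hc => ⟨rfl, ?_⟩
      rintro rfl; apply hc; push_cast; ring
    | Gm n => 
      refine key _ _ fun hc => ⟨rfl, ?_⟩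
      rintro rfl; apply hc; push_cast; ring
    | C => exact S.zero_mem
  | T m => 
    cases y with
    | L n => exact key _ _ fun hc => ⟨rfl, by rintro rfl; simp at hc⟩
    | T n => 
      refine key _ _ fun hc => ⟨rfl, ?_, ?_⟩
      · by_contra hn; simp [hn] at hc
      · rintro rfl; simp at hc
    | Gp n => exact h _ rfl
    | Gm n => exact S.neg_mem (h _ rfl)
    | C => exact S.zero_mem
  | Gp m => 
    cases y with
    | L n => 
      refine key _ _ fun hc => ⟨rfl, ?_⟩
      rintro rfl; apply hc; push_cast; ring
    | T n => exact S.neg_mem (h _ rfl)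
    | Gp n => exact S.zero_mem
    | Gm n =>
      refine S.add_mem (S.add_mem (key _ _ fun hc => Or.inl rfl) (key _ _ fun hc => Or.inr (Or.inl ⟨rfl, ?_⟩))) (key _ _ fun hc => Or.inr (Or.inr ⟨rfl, ?_, ?_, ?_⟩))
      · rintro rfl; simp at hc
      · by_contra hn; simp [hn] at hc
      · rintro rfl; simp at hc
      · rintro rfl
        by_cases hm : m + 0 + 1 = 0
        · have : m = -1 := by omega
          subst this; simp at hc
        · simp at hc; omega
    | C => exact S.zero_mem
  | Gm m => 
    cases y with
    | L n => 
      refine key _ _ fun hc => ⟨rfl, ?_⟩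
      rintro rfl; apply hc; push_cast; ring
    | T n => exact (h _ rfl)
    | Gm n => exact S.zero_mem
    | Gp n =>
      refine S.add_mem (S.add_mem (key _ _ fun hc => Or.inl rfl) (key _ _ fun hc => Or.inr (Or.inl ⟨rfl, ?_⟩))) (key _ _ fun hc => Or.inr (Or.inr ⟨rfl, ?_, ?_, ?_⟩))
      · rintro rfl; simp at hc
      · by_contra hn; simp [hn] at hc
      · rintro rfl; simp at hc
      · rintro rfl
        by_cases hm : m + 0 + 1 = 0
        · have : m = -1 := by omega
          subst this; simp at hc
        · simp at hc; omega
    | C => exact S.zero_mem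
  | C => cases y <;> exact S.zero_mem

theorem brk_congr {φ ψ : Gen → M} {x y : Gen} (h : ∀ g, Occ x y g → φ g = ψ g) :
    brk φ x y = brk ψ x y := by
  rw [← sub_eq_zero, ← brk_sub, ← Submodule.mem_bot ℂ]
  exact brk_mem _ _ _ _ fun g hg => by simp [h g hg]

theorem sgn_comm (x y : Gen) : sgn x y = sgn y x := by
  simp [sgn, Bool.and_comm]

theorem sgn_mul_self (x y : Gen) : sgn x y * sgn x y = 1 := by
  unfold sgn; split_ifs <;> norm_num

theorem brk_symm (φ : Gen → M) (x y : Gen) : brk φ y x = (-sgn x y) • brk φ x y := by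
  cases x <;> cases y <;> simp only [brk, sgn, Gen.odd, Bool.and_true, Bool.and_false, if_true, smul_zero, neg_neg, one_smul, Bool.false_eq_true, if_false]
  case L.L m n =>
    rw [add_comm n m]
    split_ifs with h
    · obtain rfl : n = -m := by omega
      push_cast; module
    · module
  case T.T m n =>
    rw [add_comm n m]
    split_ifs with h
    · obtain rfl : n = -m := by omega
      push_cast; module
    · module
  case Gp.Gm m n =>
    rw [add_comm n m]
    split_ifs with h
    · obtain rfl : n = -m-1 := by omega
      push_cast; module
    · module
  case Gm.Gp m n =>
    rw [add_comm n m]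
    split_ifs with h
    · obtain rfl : n = -m-1 := by omega
      push_cast; module
    · module
  all_goals
    rename_i m n
    rw [add_comm n m]; module

/-- The super Jacobi identity. -/
theorem jacobi (φ : Gen → M) (x y z : Gen) :
    brk (fun g => brk φ g z) x y - brk (fun g => brk φ x g) y z
      + sgn x y • brk (fun g => brk φ y g) x z = 0 := by
  cases x <;> cases y <;> cases z <;> simp only [brk, sgn, Gen.odd, Bool.and_true, Bool.and_false, if_true, smul_zero, neg_neg, one_smul, Bool.false_eq_true, if_false, add_zero, sub_zero, neg_zero]
  all_goals
    rename_i m n k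
    simp only [show m + (n + k) = m + n + k by ring, show n + (m + k) = m + n + k by ring,
      show m + n + 1 + k = m + n + k + 1 by ring, show m + (n + k + 1) = m + n + k + 1 by ring,
      show n + (m + k + 1) = m + n + k + 1 by ring]
    first
    | (push_cast; module)
    | (split_ifs with h
       -- A central term survives only if the modes add up to zero. With the half-integer shift in
       -- the labels this leaves two possible values of `k`, and a polynomial identity for each.
       · have hk : (k = -m - n ∨ k = -m - n - 1) := by omega
         rcases hk with rfl | rfl <;> first | (exfalso; omega) | (push_cast; module)
       · push_cast; module)

/-- Parity is additive under the bracket, and the exchange sign is multiplicative in each argument.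
-/
theorem sgn_occ {x y g : Gen} (h : Occ x y g) (z : Gen) : sgn g z = sgn x z * sgn y z := by
  cases x <;> cases y <;> simp only [Occ] at h
  case Gp.Gm => rcases h with rfl | ⟨rfl, -⟩ | ⟨rfl, -⟩ <;> cases z <;> simp [sgn, Gen.odd]
  case Gm.Gp => rcases h with rfl | ⟨rfl, -⟩ | ⟨rfl, -⟩ <;> cases z <;> simp [sgn, Gen.odd]
  case L.L => rcases h with ⟨rfl, -⟩ | ⟨rfl, -⟩ <;> cases z <;> simp [sgn, Gen.odd]
  case T.Gp => rcases h with rfl; cases z <;> simp [sgn, Gen.odd]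
  case T.Gm => rcases h with rfl; cases z <;> simp [sgn, Gen.odd]
  case Gp.T => rcases h with rfl; cases z <;> simp [sgn, Gen.odd]
  case Gm.T => rcases h with rfl; cases z <;> simp [sgn, Gen.odd]
  all_goals (rcases h with ⟨rfl, -⟩; cases z <;> simp [sgn, Gen.odd])

end

theorem toU_rel {x y : Free} (h : Rel x y) : toU x = toU y := RingQuot.mkAlgHom_rel ℂ h

/-- The exchange relation of two generators. -/
def Exch {A : Type*} [Ring A] [Algebra ℂ A] (φ : Gen → A) : Prop :=
  ∀ x y, φ x * φ y = sgn x y • (φ y * φ x) + brk φ x y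

theorem exch_symm {A : Type*} [Ring A] [Algebra ℂ A] {φ : Gen → A} {x y : Gen}
    (h : φ x * φ y = sgn x y • (φ y * φ x) + brk φ x y) :
    φ y * φ x = sgn y x • (φ x * φ y) + brk φ y x := by
  rw [brk_symm φ x y, h, sgn_comm y x, smul_add, smul_smul, sgn_mul_self]
  module

/-- An algebra map from the free algebra satisfies the relations if the images of the generators
satisfy the exchange relations. -/
theorem rel_of_exch {A : Type*} [Ring A] [Algebra ℂ A] (f : Free →ₐ[ℂ] A)
    (h : Exch fun g => f (fr g)) {x y : Free} (hr : Rel x y) : f x = f y := by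
  cases hr <;> simp only [comm, anti, map_sub, map_add, map_mul, map_smul, map_neg, map_zero]
  case LL m n => have := h (.L m) (.L n); simp [sgn, Gen.odd, brk] at this ⊢; rw [this]; abel
  case LGp m n => have := h (.L m) (.Gp n); simp [sgn, Gen.odd, brk] at this ⊢; rw [this]; abel
  case LGm m n => have := h (.L m) (.Gm n); simp [sgn, Gen.odd, brk] at this ⊢; rw [this]; abel
  case LT m n => have := h (.L m) (.T n); simp [sgn, Gen.odd, brk] at this ⊢; rw [this]; abel
  case TT m n => have := h (.T m) (.T n); simp [sgn, Gen.odd, brk] at this ⊢; rw [this]; abel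
  case TGp m n => have := h (.T m) (.Gp n); simp [sgn, Gen.odd, brk] at this ⊢; rw [this]; abel
  case TGm m n => have := h (.T m) (.Gm n); simp [sgn, Gen.odd, brk] at this ⊢; rw [this]; abel
  case GpGm m n => have := h (.Gp m) (.Gm n); simp [sgn, Gen.odd, brk] at this ⊢; rw [this]; abel
  case GpGp m n => have := h (.Gp m) (.Gp n); simp [sgn, Gen.odd, brk] at this ⊢; rw [this]; abel
  case GmGm m n => have := h (.Gm m) (.Gm n); simp [sgn, Gen.odd, brk] at this ⊢; rw [this]; abel
  case C g => have := h g .C; cases g <;> simp [sgn, Gen.odd, brk] at this ⊢ <;> rw [this] <;> abel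

/-- Each defining relation gives the exchange rule for one order of its two letters; `exch_symm`
supplies the other order. -/
theorem gen_exch : Exch gen := by
  have hg : ∀ g, toU (fr g) = gen g := fun _ => rfl
  have e : ∀ {a b c : U}, a - b = c → a = b + c := fun h => by rw [← h]; abel
  have e' : ∀ {a b c : U}, a + b = c → a = (-1 : ℂ) • b + c := fun h => by
    rw [← h]; module
  have base : ∀ x y : Gen, gen x * gen y = sgn x y • (gen y * gen x) + brk gen x y ∨
      gen y * gen x = sgn y x • (gen x * gen y) + brk gen y x := by
    have hC : ∀ g, gen g * gen .C = sgn g .C • (gen .C * gen g) + brk gen g .C := by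
      intro g
      have := toU_rel (Rel.C g)
      simp only [comm, map_sub, map_mul, map_zero, hg] at this
      cases g <;> simpa [sgn, Gen.odd, brk] using e this
    intro x y
    cases x <;> cases y
    case L.L m n => 
      have := toU_rel (Rel.LL m n)
      simp only [comm, map_sub, map_add, map_mul, map_smul, hg] at this
      left; simpa [sgn, Gen.odd, brk] using e this
    case L.T m n => 
      have := toU_rel (Rel.LT m n)
      simp only [comm, map_sub, map_add, map_mul, map_smul, hg] at this
      left; simpa [sgn, Gen.odd, brk] using e this
    case T.L n m => 
      have := toU_rel (Rel.LT m n)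
      simp only [comm, map_sub, map_add, map_mul, map_smul, hg] at this
      right; simpa [sgn, Gen.odd, brk] using e this
    case L.Gp m n => 
      have := toU_rel (Rel.LGp m n)
      simp only [comm, map_sub, map_add, map_mul, map_smul, hg] at this
      left; simpa [sgn, Gen.odd, brk] using e this
    case Gp.L n m => 
      have := toU_rel (Rel.LGp m n)
      simp only [comm, map_sub, map_add, map_mul, map_smul, hg] at this
      right; simpa [sgn, Gen.odd, brk] using e this
    case L.Gm m n => 
      have := toU_rel (Rel.LGm m n)
      simp only [comm, map_sub, map_add, map_mul, map_smul, hg] at this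
      left; simpa [sgn, Gen.odd, brk] using e this
    case Gm.L n m => 
      have := toU_rel (Rel.LGm m n)
      simp only [comm, map_sub, map_add, map_mul, map_smul, hg] at this
      right; simpa [sgn, Gen.odd, brk] using e this
    case T.T m n => 
      have := toU_rel (Rel.TT m n)
      simp only [comm, map_sub, map_add, map_mul, map_smul, hg] at this
      left; simpa [sgn, Gen.odd, brk] using e this
    case T.Gp m n => 
      have := toU_rel (Rel.TGp m n)
      simp only [comm, map_sub, map_add, map_mul, map_smul, hg] at this
      left; simpa [sgn, Gen.odd, brk] using e this
    case Gp.T n m => 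
      have := toU_rel (Rel.TGp m n)
      simp only [comm, map_sub, map_add, map_mul, map_smul, hg] at this
      right; simpa [sgn, Gen.odd, brk] using e this
    case T.Gm m n => 
      have := toU_rel (Rel.TGm m n)
      simp only [comm, map_sub, map_add, map_mul, map_neg, hg] at this
      left; simpa [sgn, Gen.odd, brk] using e this
    case Gm.T n m => 
      have := toU_rel (Rel.TGm m n)
      simp only [comm, map_sub, map_add, map_mul, map_neg, hg] at this
      right; simpa [sgn, Gen.odd, brk] using e this
    case Gp.Gm m n => 
      have := toU_rel (Rel.GpGm m n)
      simp only [anti, map_sub, map_add, map_mul, map_smul, hg] at this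
      left; simpa [sgn, Gen.odd, brk] using e' this
    case Gm.Gp n m => 
      have := toU_rel (Rel.GpGm m n)
      simp only [anti, map_sub, map_add, map_mul, map_smul, hg] at this
      right; simpa [sgn, Gen.odd, brk] using e' this
    case Gp.Gp m n => 
      have := toU_rel (Rel.GpGp m n)
      simp only [anti, map_sub, map_add, map_mul, map_zero, hg] at this
      left; simpa [sgn, Gen.odd, brk] using e' this
    case Gm.Gm m n => 
      have := toU_rel (Rel.GmGm m n)
      simp only [anti, map_sub, map_add, map_mul, map_zero, hg] at this
      left; simpa [sgn, Gen.odd, brk] using e' this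
    case C.C => exact Or.inl (hC _)
    case C.L => exact Or.inr (hC _)
    case C.T => exact Or.inr (hC _)
    case C.Gp => exact Or.inr (hC _)
    case C.Gm => exact Or.inr (hC _)
    all_goals exact Or.inl (hC _)
  intro x y
  rcases base x y with h | h
  · exact h
  · exact exch_symm h

theorem gen_sq {x : Gen} (h : x.odd = true) : gen x * gen x = 0 := by
  have := gen_exch x x
  have h2 : brk gen x x = 0 := by cases x <;> simp [Gen.odd] at h <;> rfl
  rw [h2, sgn, h] at this
  simp only [Bool.and_self, if_true, add_zero] at this
  have h3 : (2 : ℂ) • (gen x * gen x) = 0 := by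
    rw [two_smul]; nth_rw 1 [this]; simp
  simpa using h3

/-! ### Normal forms -/

/-- Existence of normal forms for a terminating and locally confluent linear rewriting system. -/
theorem exists_normalForm {X : Type*} {r : X → X → Prop} (wf : WellFounded r)
    (Red : X → (X →₀ ℂ) → Prop) (hlt : ∀ x ρ, Red x ρ → ∀ y ∈ ρ.support, r y x)
    (conf : ∀ x ρ₁ ρ₂, Red x ρ₁ → Red x ρ₂ → ρ₁ - ρ₂ ∈
      Submodule.span ℂ {f | ∃ y ρ, Red y ρ ∧ r y x ∧ f = Finsupp.single y 1 - ρ}) :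
    ∃ N : (X →₀ ℂ) →ₗ[ℂ] (X →₀ ℂ), (∀ x ρ, Red x ρ → N (Finsupp.single x 1) = N ρ) ∧
      ∀ x, (¬ ∃ ρ, Red x ρ) → N (Finsupp.single x 1) = Finsupp.single x 1 := by
  classical
  -- One reduct is chosen for each reducible element and normalised recursively. That the choice
  -- does not matter is the content of the induction at the end: two reducts differ by relations
  -- with smaller leading elements, which `N` already kills.
  let F : ∀ x : X, (∀ y, r y x → (X →₀ ℂ)) → (X →₀ ℂ) := fun x ih =>
    if h : ∃ ρ, Red x ρ then
      ∑ y ∈ h.choose.support.attach, h.choose y • ih y (hlt x _ h.choose_spec y y.2)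
    else Finsupp.single x 1
  let σ : X → (X →₀ ℂ) := wf.fix F
  let N := Finsupp.linearCombination ℂ σ
  have hσ : ∀ x, σ x = F x fun y _ => σ y := fun x => wf.fix_eq F x
  have h1 : ∀ x (h : ∃ ρ, Red x ρ), N (Finsupp.single x 1) = N h.choose := by
    intro x h
    have : σ x = N h.choose := by
      rw [hσ x]
      simp only [F, dif_pos h, N, Finsupp.linearCombination_apply, Finsupp.sum]
      exact Finset.sum_attach _ (fun y => h.choose y • σ y)
    simpa [N] using this
  have h2 : ∀ x, (¬ ∃ ρ, Red x ρ) → N (Finsupp.single x 1) = Finsupp.single x 1 := by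
    intro x h
    have : σ x = Finsupp.single x 1 := by
      rw [hσ x]; simp only [F, dif_neg h]
    simpa [N] using this
  refine ⟨N, fun x => ?_, h2⟩
  induction x using wf.induction with
  | _ x ih =>
    intro ρ hρ
    have h : ∃ ρ, Red x ρ := ⟨ρ, hρ⟩
    rw [h1 x h, ← sub_eq_zero, ← map_sub, ← LinearMap.mem_ker]
    refine (Submodule.span_le.2 ?_) (conf x _ _ h.choose_spec hρ)
    rintro f ⟨y, ρ', hy, hr, rfl⟩
    simp only [SetLike.mem_coe, LinearMap.mem_ker, map_sub, sub_eq_zero]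
    exact ih y hr ρ' hy

/-! ### Words and their rewriting rules -/

/-- The block of a generator in the order used for normal words. -/
def Gen.blk : Gen → ℕ
  | .L n => if n ≤ -2 then 0 else 4
  | .T n => if n ≤ -1 then 1 else 5
  | .Gp n => if n ≤ -1 then 2 else 6
  | .Gm n => if n ≤ -1 then 3 else 7
  | .C => 8

/-- The mode of a generator, as an integer label. -/
def Gen.md : Gen → ℤ
  | .L n => n
  | .T n => n
  | .Gp n => n
  | .Gm n => n
  | .C => 0

/-- The sort key of a generator. -/
def Gen.key (g : Gen) : ℕ ×ₗ ℤ := toLex (g.blk, g.md)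

theorem Gen.key_injective : Function.Injective Gen.key := by
  intro x y h
  have h1 : x.blk = y.blk := congrArg (fun k => (ofLex k).1) h
  have h2 : x.md = y.md := congrArg (fun k => (ofLex k).2) h
  cases x <;> cases y <;> simp only [Gen.blk, Gen.md] at h1 h2 <;> first
    | (subst h2; rfl) | rfl | (exfalso; split_ifs at h1 <;> simp at h1)

instance : LinearOrder Gen := LinearOrder.lift' Gen.key Gen.key_injective

theorem Gen.lt_iff {x y : Gen} : x < y ↔ x.blk < y.blk ∨ x.blk = y.blk ∧ x.md < y.md :=
  Prod.Lex.lt_iff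

/-- The odd raising generators. -/
def Gen.oddRaising : Gen → Bool
  | .Gp n => 0 ≤ n
  | .Gm n => 0 ≤ n
  | _ => false

/-- The generators acting on the highest weight symbols by the defining relations. -/
def Gen.Tail : Gen → Prop
  | .L n => -1 ≤ n
  | .T n => 0 ≤ n
  | .Gp n => 0 ≤ n
  | .Gm n => 0 ≤ n
  | .C => True

/-- The blocks are numbered so that the letters acting on the symbol, `L_{-1}` among them, come
after all others. Sorting therefore pushes them to the right end of a word, where the highest weight
rules apply. -/
theorem Gen.tail_iff {x : Gen} : x.Tail ↔ 4 ≤ x.blk := by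
  cases x <;> simp only [Gen.Tail, Gen.blk] <;> first | (split_ifs <;> omega) | simp

theorem Gen.Tail.of_le {x y : Gen} (hx : x.Tail) (h : x ≤ y) : y.Tail := by
  rw [Gen.tail_iff] at *
  rcases h.lt_or_eq with h | rfl
  · rw [Gen.lt_iff] at h; omega
  · exact hx

/-- The number of odd raising letters of a word. -/
def pcount (l : List Gen) : ℕ := l.countP Gen.oddRaising

/-- The number of inversions of a word. -/
def inversions : List Gen → ℕ
  | [] => 0
  | x :: l => l.countP (· < x) + inversions l

/-- The order on words along which rewriting proceeds. -/
def Below (l' l : List Gen) : Prop :=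
  l'.length < l.length ∨ (l'.length = l.length ∧ pcount l' < pcount l) ∨
    (l'.Perm l ∧ inversions l' < inversions l)

theorem Below.trans {l₁ l₂ l₃ : List Gen} (h : Below l₁ l₂) (h' : Below l₂ l₃) : Below l₁ l₃ := by
  unfold Below at *
  rcases h with h | ⟨h, h2⟩ | ⟨h, h2⟩ <;> rcases h' with h' | ⟨h', h3⟩ | ⟨h', h3⟩
  · left; omega
  · left; omega
  · left; rw [← h'.length_eq]; exact h
  · left; omega
  · right; left; omega
  · right; left; rw [← h'.length_eq, pcount, pcount, ← h'.countP_eq]; exact ⟨h, h2⟩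
  · left; rw [h.length_eq]; exact h'
  · right; left; rw [h.length_eq, pcount, h.countP_eq]; exact ⟨h', h3⟩
  · right; right; exact ⟨h.trans h', h2.trans h3⟩

/-- This is contained in a lexicographic order on (length, number of odd raising letters,
inversions): a permutation leaves the first two unchanged. -/
theorem below_wf : WellFounded Below := by
  have wf : WellFounded (Prod.Lex (· < ·) (Prod.Lex (· < ·) (· < ·)) : ℕ × ℕ × ℕ → _ → Prop) :=
    WellFounded.prod_lex Nat.lt_wfRel.wf (WellFounded.prod_lex Nat.lt_wfRel.wf Nat.lt_wfRel.wf)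
  refine Subrelation.wf ?_ (InvImage.wf (fun l : List Gen => (l.length, pcount l, inversions l)) wf)
  intro l' l h
  simp only [InvImage, Prod.lex_def]
  rcases h with h | ⟨h, h2⟩ | ⟨h, h2⟩
  · exact Or.inl h
  · exact Or.inr ⟨h, Or.inl h2⟩
  · exact Or.inr ⟨h.length_eq, Or.inr ⟨h.countP_eq _, h2⟩⟩

theorem Below.cons {l' l : List Gen} (g : Gen) (h : Below l' l) : Below (g :: l') (g :: l) := by
  unfold Below at *
  rcases h with h | ⟨h, h2⟩ | ⟨h, h2⟩
  · left; simpa using h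
  · right; left
    simp only [pcount, List.countP_cons, List.length_cons] at *
    omega
  · right; right
    refine ⟨h.cons g, ?_⟩
    simp only [inversions]
    rw [h.countP_eq]; omega

theorem Below.swap {x y : Gen} (h : y < x) (v : List Gen) : Below (y :: x :: v) (x :: y :: v) := by
  refine Or.inr (Or.inr ⟨List.Perm.swap x y v, ?_⟩)
  simp only [inversions, List.countP_cons]
  simp [h, not_lt.2 h.le]
  omega

theorem Below.of_length {l l' : List Gen} (h : l'.length < l.length) : Below l' l := Or.inl h

/-- Formal combinations of words applied to the symbols `L_{-1}^b |h,q,c⟩`. -/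
abbrev WMod : Type := (List Gen × ℂ) →₀ ℂ

/-- A word, as an element of the free module. -/
def wd (l : List Gen) (b : ℂ) : WMod := Finsupp.single (l, b) 1

/-- Multiplication of words by a letter from the left. -/
def consL (g : Gen) : WMod →ₗ[ℂ] WMod := Finsupp.lmapDomain ℂ ℂ fun w => (g :: w.1, w.2)

@[simp] theorem consL_wd (g : Gen) (l : List Gen) (b : ℂ) : consL g (wd l b) = wd (g :: l) b := by
  simp [consL, wd]

/-- The action of the letters of the highest weight conditions on a symbol. -/
def act (ω : Weight) : Gen → ℂ → WMod
  | .L n, b => (((n + 1).toNat : ℂ) * fall b ((n + 1).toNat - 1) * ω.h + fall b (n + 1).toNat) •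
      wd [] (b - n)
  | .T n, b => (fall b n.toNat * ω.q) • wd [] (b - n)
  | .Gp n, b => fall b (n + 1).toNat • wd [.Gp (-1)] (b - (n + 1))
  | .Gm n, b => fall b (n + 1).toNat • wd [.Gm (-1)] (b - (n + 1))
  | .C, b => ω.c • wd [] b

/-- The rewriting rules for words. -/
inductive Red (ω : Weight) : List Gen × ℂ → WMod → Prop
  | swap {x y : Gen} (h : y < x) (v : List Gen) (b : ℂ) :
      Red ω (x :: y :: v, b) (sgn x y • wd (y :: x :: v) b + brk (fun g => wd (g :: v) b) x y)
  | sq {x : Gen} (h : x.odd = true) (v : List Gen) (b : ℂ) : Red ω (x :: x :: v, b) 0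
  | tail {x : Gen} (h : x.Tail) (b : ℂ) : Red ω ([x], b) (act ω x b)
  | cons (x : Gen) {v : List Gen} {b : ℂ} {ρ : WMod} (h : Red ω (v, b) ρ) :
      Red ω (x :: v, b) (consL x ρ)

/-- The combinations of words below a given one. -/
def belowSpan (l : List Gen) : Submodule ℂ WMod :=
  Finsupp.supported ℂ ℂ {w : List Gen × ℂ | Below w.1 l}

theorem wd_mem_belowSpan {l l' : List Gen} (b : ℂ) (h : Below l' l) : wd l' b ∈ belowSpan l :=
  Finsupp.single_mem_supported ℂ _ h

theorem consL_belowSpan {l : List Gen} {f : WMod} (g : Gen) (h : f ∈ belowSpan l) :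
    consL g f ∈ belowSpan (g :: l) := by
  have : belowSpan l ≤ (belowSpan (g :: l)).comap (consL g) := by
    rw [belowSpan, Finsupp.supported_eq_span_single, Submodule.span_le]
    rintro _ ⟨⟨l', b⟩, h, rfl⟩
    have := wd_mem_belowSpan b (Below.cons g h)
    rw [← consL_wd] at this
    exact this
  exact this h

/-- A swap removes an inversion, and brackets and even tail letters shorten the word. An odd raising
letter at the symbol becomes `G^±_{-1/2}`, which keeps the length; this is why `Below` also counts
odd raising letters. -/
theorem Red.lower {ω : Weight} {w : List Gen × ℂ} {ρ : WMod} (h : Red ω w ρ) :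
    ρ ∈ belowSpan w.1 := by
  induction h with
  | swap h v b =>
    refine Submodule.add_mem _ (Submodule.smul_mem _ _ (wd_mem_belowSpan b (Below.swap h v))) ?_
    exact brk_mem _ _ _ _ fun g _ => wd_mem_belowSpan b (Below.of_length (by simp))
  | sq => exact Submodule.zero_mem _
  | @tail x h b =>
    have h0 : Below [] [x] := Below.of_length (by simp)
    cases x with
    | L n => exact Submodule.smul_mem _ _ (wd_mem_belowSpan _ h0)
    | T n => exact Submodule.smul_mem _ _ (wd_mem_belowSpan _ h0)
    | C => exact Submodule.smul_mem _ _ (wd_mem_belowSpan _ h0)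
    | Gp n => 
      refine Submodule.smul_mem _ _ (wd_mem_belowSpan _ (Or.inr (Or.inl ⟨rfl, ?_⟩)))
      have h : 0 ≤ n := h
      simp [pcount, Gen.oddRaising, h]
    | Gm n => 
      refine Submodule.smul_mem _ _ (wd_mem_belowSpan _ (Or.inr (Or.inl ⟨rfl, ?_⟩)))
      have h : 0 ≤ n := h
      simp [pcount, Gen.oddRaising, h]
  | cons x h ih => exact consL_belowSpan x ih

/-! ### Exchange relations modulo smaller words. -/

/-- The span of the rewriting relations with leading word below a given one. -/
def relBelow (ω : Weight) (l : List Gen) : Submodule ℂ WMod :=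
  Submodule.span ℂ {f | ∃ w ρ, Red ω w ρ ∧ Below w.1 l ∧ f = Finsupp.single w 1 - ρ}

theorem Red.mem {ω : Weight} {l l' : List Gen} {b : ℂ} {ρ : WMod} (h : Red ω (l', b) ρ)
    (h' : Below l' l) : wd l' b - ρ ∈ relBelow ω l :=
  Submodule.subset_span ⟨_, _, h, h', rfl⟩

theorem consL_relBelow {ω : Weight} {l : List Gen} {f : WMod} (g : Gen) (h : f ∈ relBelow ω l) :
    consL g f ∈ relBelow ω (g :: l) := by
  have : relBelow ω l ≤ (relBelow ω (g :: l)).comap (consL g) := by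
    refine Submodule.span_le.2 ?_
    rintro _ ⟨⟨l', b⟩, ρ, h1, h2, rfl⟩
    simp only [SetLike.mem_coe, Submodule.mem_comap, map_sub]
    have := Red.mem (h1.cons g) (h2.cons g)
    rwa [← consL_wd] at this
  exact this h

/-- The difference of the two sides of the exchange relation, applied to a word. -/
def exch (x y : Gen) (v : List Gen) (b : ℂ) : WMod :=
  wd (x :: y :: v) b - sgn x y • wd (y :: x :: v) b - brk (fun g => wd (g :: v) b) x y

theorem brk_self_of_even {M : Type*} [AddCommGroup M] [Module ℂ M] (φ : Gen → M) {x : Gen}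
    (h : x.odd = false) : brk φ x x = 0 := by
  have := brk_symm φ x x
  simp only [sgn, h, Bool.and_self, Bool.false_eq_true, if_false] at this
  have h2 : (2 : ℂ) • brk φ x x = 0 := by
    rw [two_smul]; nth_rw 1 [this]; simp
  simpa using h2

theorem brk_self_of_odd {M : Type*} [AddCommGroup M] [Module ℂ M] (φ : Gen → M) {x : Gen}
    (h : x.odd = true) : brk φ x x = 0 := by
  cases x <;> simp [Gen.odd] at h <;> rfl

theorem exch_self_of_odd {x : Gen} (h : x.odd = true) (v : List Gen) (b : ℂ) :
    exch x x v b = (2 : ℂ) • wd (x :: x :: v) b := by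
  rw [exch, brk_self_of_odd _ h, sgn, h]
  simp only [Bool.and_self, if_true]
  module

theorem exch_comm (x y : Gen) (v : List Gen) (b : ℂ) :
    exch y x v b = (-sgn x y) • exch x y v b := by
  have h := sgn_mul_self x y
  rw [exch, exch, brk_symm _ x y, sgn_comm y x, smul_sub, smul_sub, smul_smul, neg_mul, h]
  module

/-- Whichever of the two orders is unsorted is the left-hand side of a rule. For equal letters the
expression is zero (even) or twice the square rule (odd). -/
theorem exch_mem {ω : Weight} {x y : Gen} {v l : List Gen} (b : ℂ) (h : Below (x :: y :: v) l)
    (h' : Below (y :: x :: v) l) : exch x y v b ∈ relBelow ω l := by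
  rcases lt_trichotomy y x with hxy | rfl | hxy
  · have := Red.mem (Red.swap (ω := ω) hxy v b) h
    rwa [← sub_sub] at this
  · rcases hy : y.odd with _ | _
    · rw [exch, brk_self_of_even _ hy, sgn, hy]
      simp
    · rw [exch_self_of_odd hy]
      have := Red.mem (Red.sq (ω := ω) hy v b) h
      rw [sub_zero] at this
      exact Submodule.smul_mem _ _ this
  · have := Red.mem (Red.swap (ω := ω) hxy v b) h'
    rw [← sub_sub] at this
    rw [exch_comm]
    exact Submodule.smul_mem _ _ this

/-- The terms come from the two ways of reversing three letters. The words with three letters in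
front of `v` cancel in the alternating sum, the double brackets cancel by `jacobi`, and what remains
are exchanges with a bracket letter, whose words are one letter shorter and so below automatically.
-/
theorem exch_jacobi (ω : Weight) (x y z : Gen) (v : List Gen) (b : ℂ) :
    exch x y (z :: v) b - consL x (exch y z v b) + sgn x y • consL y (exch x z v b)
      - sgn y z • exch x z (y :: v) b + (sgn x y * sgn x z) • exch y z (x :: v) b
      - (sgn x z * sgn y z) • consL z (exch x y v b) ∈ relBelow ω (x :: y :: z :: v) := by
  have hB : ∀ p q r s : Gen, brk (fun g => exch g p v b) r s ∈ relBelow ω (x :: y :: z :: v) ∧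
      brk (fun g => exch q g v b) r s ∈ relBelow ω (x :: y :: z :: v) := by
    intro p q r s
    constructor <;> refine brk_mem _ _ _ _ fun g _ => exch_mem b ?_ ?_ <;>
      exact Below.of_length (by simp)
  have key : exch x y (z :: v) b - consL x (exch y z v b) + sgn x y • consL y (exch x z v b)
      - sgn y z • exch x z (y :: v) b + (sgn x y * sgn x z) • exch y z (x :: v) b
      - (sgn x z * sgn y z) • consL z (exch x y v b)
      = - brk (fun g => exch g z v b) x y + brk (fun g => exch x g v b) y z
        - sgn x y • brk (fun g => exch y g v b) x z := by
    have J := jacobi (fun g => wd (g :: v) b) x y z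
    have e1 : brk (fun g => exch g z v b) x y = brk (fun g => wd (g :: z :: v) b) x y
        - (sgn x z * sgn y z) • brk (fun g => wd (z :: g :: v) b) x y
        - brk (fun g => brk (fun g' => wd (g' :: v) b) g z) x y := by
      rw [← brk_smul, ← brk_sub, ← brk_sub]
      exact brk_congr fun g hg => by rw [exch, sgn_occ hg]
    have e2 : ∀ x y z : Gen, brk (fun g => exch x g v b) y z = brk (fun g => wd (x :: g :: v) b) y z
        - (sgn x y * sgn x z) • brk (fun g => wd (g :: x :: v) b) y z
        - brk (fun g => brk (fun g' => wd (g' :: v) b) x g) y z := by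
      intro x y z
      rw [← brk_smul, ← brk_sub, ← brk_sub]
      exact brk_congr fun g hg => by
        rw [exch, sgn_comm x g, sgn_occ hg, sgn_comm x y, sgn_comm x z]
    rw [e1, e2 x y z, e2 y x z, sgn_comm y x]
    simp only [exch, map_sub, map_smul, consL_wd, map_brk]
    have J' := eq_sub_of_add_eq J
    rw [zero_sub] at J'
    have J'' := sub_eq_iff_eq_add.1 J'
    rw [J'']
    rcases mul_self_eq_one_iff.1 (sgn_mul_self x y) with hs | hs <;> simp only [hs] <;> module
  rw [key]
  exact Submodule.sub_mem _ (Submodule.add_mem _ (Submodule.neg_mem _ (hB z z x y).1)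
    (hB z x y z).2) (Submodule.smul_mem _ _ (hB z y x z).2)

/-! ### Falling factorials and the compatibility of the highest weight rules with the brackets. -/

theorem fall_zero (a : ℂ) : fall a 0 = 1 := by simp [fall]

theorem fall_succ (a : ℂ) (n : ℕ) : fall a (n + 1) = fall a n * (a - n) :=
  Finset.prod_range_succ _ _

theorem fall_add (a : ℂ) (m n : ℕ) : fall a (m + n) = fall a m * fall (a - m) n := by
  rw [fall, Finset.prod_range_add]
  refine congrArg _ (Finset.prod_congr rfl fun j _ => ?_)
  push_cast; ring

theorem fall_succ' (a : ℂ) (n : ℕ) : fall (a + 1) (n + 1) = (a + 1) * fall a n := by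
  rw [add_comm n 1, fall_add]; simp [fall]

/-- The failure of the highest weight conditions to be compatible with an exchange relation. -/
def tailDefect (ω : Weight) (x y : Gen) (b : ℂ) : WMod :=
  consL x (act ω y b) - sgn x y • consL y (act ω x b) - brk (fun g => wd [g] b) x y

theorem tailDefect_comm (ω : Weight) (x y : Gen) (b : ℂ) :
    tailDefect ω y x b = (-sgn x y) • tailDefect ω x y b := by
  rcases mul_self_eq_one_iff.1 (sgn_mul_self x y) with hs | hs <;>
    rw [tailDefect, tailDefect, brk_symm _ x y, sgn_comm y x] <;> simp only [hs] <;> module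

theorem fall_add_one (b : ℂ) (n : ℕ) : fall (b + 1) n = fall b n + n * fall b (n - 1) := by
  rcases n with _ | n
  · simp [fall_zero]
  · rw [fall_succ', fall_succ, Nat.add_sub_cancel]; push_cast; ring

/-- Indexing by `i = n + 1` treats `L_{-1}` and the modes `n ≥ 0` uniformly: at `i = 0` the
truncated `i - 1` is harmless because of the factor `i`. -/
theorem act_L {ω : Weight} {n : ℤ} {i : ℕ} (hn : n = (i : ℤ) - 1) {b : ℂ} {e : ℂ}
    (he : e = b - i + 1) : act ω (.L n) b =
    ((i : ℂ) * fall b (i - 1) * ω.h + fall b i) • wd [] e := by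
  subst hn he
  rw [act, show ((i : ℤ) - 1 + 1).toNat = i by omega]
  congr 2
  push_cast; ring

theorem act_T {ω : Weight} {n : ℤ} {i : ℕ} (hn : n = i) {b : ℂ} {e : ℂ} (he : e = b - i) :
    act ω (.T n) b = (fall b i * ω.q) • wd [] e := by
  subst hn he
  rw [act]; simp

theorem act_Gp {ω : Weight} {n : ℤ} {i : ℕ} (hn : n = i) {b : ℂ} {e : ℂ} (he : e = b - (i + 1)) :
    act ω (.Gp n) b = fall b (i + 1) • wd [.Gp (-1)] e := by
  subst hn he
  rw [act]; simp

theorem act_Gm {ω : Weight} {n : ℤ} {i : ℕ} (hn : n = i) {b : ℂ} {e : ℂ} (he : e = b - (i + 1)) :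
    act ω (.Gm n) b = fall b (i + 1) • wd [.Gm (-1)] e := by
  subst hn he
  rw [act]; simp

section

variable {M : Type*} [AddCommGroup M] [Module ℂ M]

/-- Images of words modulo the highest weight conditions and the exchange relations with
`G^±_{-1/2}` for letters with fewer than `p` odd raising letters. -/
structure IsEval (ω : Weight) (p : ℕ) (q : WMod →ₗ[ℂ] M) : Prop where
  tail : ∀ g, g.Tail → ∀ b, q (wd [g] b) = q (act ω g b)
  exch : ∀ g G, (G = .Gp (-1) ∨ G = .Gm (-1)) → pcount [g] < p → ∀ b, q (exch g G [] b) = 0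
  cons : ∀ g G, (G = .Gp (-1) ∨ G = .Gm (-1)) → pcount [g] < p → g.Tail → ∀ b,
    q (wd [G, g] b) = q (consL G (act ω g b))

variable {ω : Weight} {p : ℕ} {q : WMod →ₗ[ℂ] M}

/-- The only letters that the highest weight rules leave in front of the symbol are `G^±_{-1/2}`, so
evaluating a second tail letter requires moving it past one of these. -/
theorem IsEval.comm (hq : IsEval ω p q) {g G : Gen} (hG : G = .Gp (-1) ∨ G = .Gm (-1))
    (hp : pcount [g] < p) (hg : g.Tail) (b : ℂ) :
    q (wd [g, G] b) = sgn g G • q (consL G (act ω g b)) + brk (fun g' => q (wd [g'] b)) g G := by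
  have := hq.exch g G hG hp b
  rw [N2.exch, map_sub, map_sub, map_brk, map_smul, sub_eq_zero] at this
  rw [← hq.cons g G hG hp hg, ← this]
  abel

theorem IsEval.L (hq : IsEval ω p q) {n : ℤ} (i : ℕ) (hn : n = (i : ℤ) - 1) {b : ℂ} {e : ℂ}
    (he : e = b - i + 1) : q (wd [.L n] b) =
    ((i : ℂ) * fall b (i - 1) * ω.h + fall b i) • q (wd [] e) := by
  rw [hq.tail _ (by simp only [Gen.Tail]; omega), act_L hn he, map_smul]

theorem IsEval.T (hq : IsEval ω p q) {n : ℤ} (i : ℕ) (hn : n = i) {b : ℂ} {e : ℂ}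
    (he : e = b - i) : q (wd [.T n] b) = (fall b i * ω.q) • q (wd [] e) := by
  rw [hq.tail _ (by simp only [Gen.Tail]; omega), act_T hn he, map_smul]

theorem IsEval.C (hq : IsEval ω p q) (b : ℂ) : q (wd [.C] b) = ω.c • q (wd [] b) := by
  rw [hq.tail _ (by simp [Gen.Tail]), act, map_smul]

theorem IsEval.Gp (hq : IsEval ω p q) {n : ℤ} (i : ℕ) (hn : n = (i : ℤ) - 1) {b : ℂ} {e : ℂ}
    (he : e = b - i) : q (wd [.Gp n] b) = fall b i • q (wd [.Gp (-1)] e) := by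
  subst he
  rcases i with _ | i
  · subst hn; simp [fall_zero]
  · rw [hq.tail _ (by simp only [Gen.Tail]; omega), act_Gp (i := i) (by subst hn; push_cast; ring)
      (e := b - (i + 1 : ℕ)) (by push_cast; rfl), map_smul]

theorem IsEval.Gm (hq : IsEval ω p q) {n : ℤ} (i : ℕ) (hn : n = (i : ℤ) - 1) {b : ℂ} {e : ℂ}
    (he : e = b - i) : q (wd [.Gm n] b) = fall b i • q (wd [.Gm (-1)] e) := by
  subst he
  rcases i with _ | i
  · subst hn; simp [fall_zero]
  · rw [hq.tail _ (by simp only [Gen.Tail]; omega), act_Gm (i := i) (by subst hn; push_cast; ring)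
      (e := b - (i + 1 : ℕ)) (by push_cast; rfl), map_smul]

theorem pcount_L (n : ℤ) : pcount [.L n] = 0 := rfl
theorem pcount_T (n : ℤ) : pcount [.T n] = 0 := rfl
theorem pcount_Gp (n : ℕ) : pcount [.Gp n] = 1 := by simp [pcount, Gen.oddRaising]
theorem pcount_Gm (n : ℕ) : pcount [.Gm n] = 1 := by simp [pcount, Gen.oddRaising]

/-- Two modes `≥ -1` adding up to zero are `-1`, `0` or `1`, the roots of `m³ - m`. -/
theorem central_LL {m n : ℤ} (hm : -1 ≤ m) (hn : -1 ≤ n) :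
    (if m + n = 0 then ((m : ℂ) ^ 3 - m) / 12 else 0) = 0 := by
  split_ifs with h
  · have : m = -1 ∨ m = 0 ∨ m = 1 := by omega
    rcases this with rfl | rfl | rfl <;> norm_num
  · rfl

theorem IsEval.defect_LL (hq : IsEval ω p q) (i j : ℕ) (b : ℂ) :
    q (tailDefect ω (.L ((i : ℤ) - 1)) (.L ((j : ℤ) - 1)) b) = 0 := by
  -- `L_{-1}` raises the exponent instead of lowering it, so this case needs `fall_add_one`; the
  -- others follow by splitting `fall b (i + j)` in both orders with `fall_add`.
  have h0 : ∀ j : ℕ, q (tailDefect ω (.L ((0 : ℕ) - 1)) (.L ((j : ℤ) - 1)) b) = 0 := by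
    intro j
    simp only [tailDefect, brk, sgn, Gen.odd, Bool.and_self, Bool.false_eq_true, if_false, one_smul]
    rw [central_LL (by omega) (by omega), zero_smul, add_zero, act_L rfl (e := b - j + 1) rfl,
      act_L (i := 0) rfl (e := b + 1) (by push_cast; ring)]
    simp only [map_sub, map_smul, consL_wd]
    rw [hq.L 0 rfl (e := b - j + 2) (by push_cast; ring), hq.L j rfl (e := b - j + 2) (by ring)]
    rcases j with _ | j
    · simp [fall_zero]
    · rw [hq.L j (by push_cast; ring) (e := b - (j + 1 : ℕ) + 2) (by push_cast; ring), fall_add_one b,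
        fall_add_one b]
      simp only [fall_zero, Nat.add_sub_cancel]
      push_cast
      module
  rcases i with _ | i
  · exact h0 j
  rcases j with _ | j
  · rw [tailDefect_comm, map_smul, h0, smul_zero]
  simp only [tailDefect, brk, sgn, Gen.odd, Bool.and_self, Bool.false_eq_true, if_false, one_smul]
  rw [central_LL (by omega) (by omega), zero_smul, add_zero, act_L rfl (e := b - j) (by push_cast; ring),
      act_L rfl (e := b - i) (by push_cast; ring)]
  simp only [map_sub, map_smul, consL_wd]
  rw [hq.L (i + 1) rfl (e := b - i - j) (by push_cast; ring),
    hq.L (j + 1) rfl (e := b - i - j) (by push_cast; ring),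
    hq.L (i + j + 1) (by push_cast; ring) (e := b - i - j) (by push_cast; ring)]
  simp only [Nat.add_sub_cancel]
  have e1 := fall_add b i j
  have e2 := fall_add b j i
  rw [add_comm j i] at e2
  simp only [fall_succ, e1]
  rw [e1] at e2
  push_cast
  match_scalars
  linear_combination (-((i+1)*(j+1)* ω.h ^ 2 + (j + 1) * (b - i - j) * ω.h + (i+1) * (b-j)*ω.h + (b-j)*(b-i-j))) * e2

theorem IsEval.defect_LT (hq : IsEval ω p q) (i j : ℕ) (b : ℂ) :
    q (tailDefect ω (.L ((i : ℤ) - 1)) (.T j) b) = 0 := by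
  simp only [tailDefect, brk, sgn, Gen.odd, Bool.and_self, Bool.false_eq_true, if_false, one_smul]
  rw [act_L rfl (e := b - i + 1) rfl, act_T rfl (e := b - j) rfl]
  simp only [map_sub, map_smul, consL_wd]
  rw [hq.L i rfl (e := b - i - j + 1) (by ring), hq.T j rfl (e := b - i - j + 1) (by ring)]
  rcases i with _ | i
  · rcases j with _ | j
    · simp [fall_zero]
    · rw [hq.T j (by push_cast; ring) (e := b - (0 : ℕ) - (j + 1 : ℕ) + 1) (by push_cast; ring)]
      simp only [fall_zero]
      push_cast
      rw [sub_zero, fall_add_one b]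
      simp only [Nat.add_sub_cancel]
      push_cast
      module
  · rw [hq.T (i + j) (by push_cast; ring) (e := b - (i + 1 : ℕ) - j + 1) (by push_cast; ring)]
    have e1 := fall_add b i j
    have e2 := fall_add b j i
    rw [add_comm j i] at e2
    rw [show b - ((i + 1 : ℕ) : ℂ) + 1 = b - i by push_cast; ring]
    simp only [fall_succ, e1, Nat.add_sub_cancel]
    rw [e1] at e2
    push_cast
    match_scalars
    linear_combination (-(ω.q * ((i + 1) * ω.h + (b - i - j)))) * e2

theorem IsEval.defect_LGp (hq : IsEval ω p q) (hp : 0 < p) (i j : ℕ) (b : ℂ) :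
    q (tailDefect ω (.L ((i : ℤ) - 1)) (.Gp j) b) = 0 := by
  simp only [tailDefect, brk, sgn, Gen.odd, Bool.false_and, Bool.false_eq_true, if_false, one_smul]
  rw [act_L rfl (e := b - i + 1) rfl, act_Gp rfl (e := b - (j + 1)) rfl]
  simp only [map_sub, map_smul, consL_wd]
  rw [hq.comm (by simp) (by rwa [pcount_L]) (by simp only [Gen.Tail]; omega),
    act_L rfl (e := b - i - j) (by ring)]
  simp only [brk, sgn, Gen.odd, Bool.false_and, Bool.false_eq_true, if_false, one_smul, map_smul,
    consL_wd]
  rw [hq.Gp (n := j) (j + 1) (by push_cast; ring) (e := b - i - j) (by push_cast; ring),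
    hq.Gp (n := i - 1 + j) (i + j) (by push_cast; ring) (e := b - i - j) (by push_cast; ring)]
  rcases i with _ | i
  · simp only [fall_zero]
    push_cast
    rw [sub_zero, fall_add_one b, Nat.add_sub_cancel, zero_add]
    push_cast
    module
  · rw [hq.Gp (n := (i + 1 : ℕ) - 1 + -1) i (by push_cast; ring) (e := b - (i + 1 : ℕ) - j) (by push_cast; ring)]
    have e1 := fall_add b i (j + 1)
    have e2 := fall_add b (j + 1) i
    rw [add_comm (j + 1) i] at e2
    push_cast at e1 e2
    rw [show b - ((i + 1 : ℕ) : ℂ) + 1 = b - i by push_cast; ring,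
      show i + 1 + j = i + (j + 1) by ring, Nat.add_sub_cancel, fall_succ _ i, fall_succ _ i, e1]
    rw [e1] at e2
    push_cast
    match_scalars
    linear_combination (-((i + 1) * ω.h + (b - i - j - 1) + (i + 1) / 2)) * e2

theorem IsEval.defect_LGm (hq : IsEval ω p q) (hp : 0 < p) (i j : ℕ) (b : ℂ) :
    q (tailDefect ω (.L ((i : ℤ) - 1)) (.Gm j) b) = 0 := by
  simp only [tailDefect, brk, sgn, Gen.odd, Bool.false_and, Bool.false_eq_true, if_false, one_smul]
  rw [act_L rfl (e := b - i + 1) rfl, act_Gm rfl (e := b - (j + 1)) rfl]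
  simp only [map_sub, map_smul, consL_wd]
  rw [hq.comm (by simp) (by rwa [pcount_L]) (by simp only [Gen.Tail]; omega),
    act_L rfl (e := b - i - j) (by ring)]
  simp only [brk, sgn, Gen.odd, Bool.false_and, Bool.false_eq_true, if_false, one_smul, map_smul,
    consL_wd]
  rw [hq.Gm (n := j) (j + 1) (by push_cast; ring) (e := b - i - j) (by push_cast; ring),
    hq.Gm (n := i - 1 + j) (i + j) (by push_cast; ring) (e := b - i - j) (by push_cast; ring)]
  rcases i with _ | i
  · simp only [fall_zero]
    push_cast
    rw [sub_zero, fall_add_one b, Nat.add_sub_cancel, zero_add]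
    push_cast
    module
  · rw [hq.Gm (n := (i + 1 : ℕ) - 1 + -1) i (by push_cast; ring) (e := b - (i + 1 : ℕ) - j) (by push_cast; ring)]
    have e1 := fall_add b i (j + 1)
    have e2 := fall_add b (j + 1) i
    rw [add_comm (j + 1) i] at e2
    push_cast at e1 e2
    rw [show b - ((i + 1 : ℕ) : ℂ) + 1 = b - i by push_cast; ring,
      show i + 1 + j = i + (j + 1) by ring, Nat.add_sub_cancel, fall_succ _ i, fall_succ _ i, e1]
    rw [e1] at e2
    push_cast
    match_scalars
    linear_combination (-((i + 1) * ω.h + (b - i - j - 1) + (i + 1) / 2)) * e2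

theorem IsEval.defect_TGp (hq : IsEval ω p q) (hp : 0 < p) (i j : ℕ) (b : ℂ) :
    q (tailDefect ω (.T i) (.Gp j) b) = 0 := by
  simp only [tailDefect, brk, sgn, Gen.odd, Bool.false_and, Bool.false_eq_true, if_false, one_smul]
  rw [act_T rfl (e := b - i) rfl, act_Gp rfl (e := b - (j + 1)) rfl]
  simp only [map_sub, map_smul, consL_wd]
  rw [hq.comm (by simp) (by rwa [pcount_T]) (by simp only [Gen.Tail]; omega),
    act_T rfl (e := b - i - j - 1) (by ring)]
  simp only [brk, sgn, Gen.odd, Bool.false_and, Bool.false_eq_true, if_false, one_smul, map_smul,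
    consL_wd]
  rw [hq.Gp (n := j) (j + 1) (by push_cast; ring) (e := b - i - j - 1) (by push_cast; ring),
    hq.Gp (n := i + j) (i + (j + 1)) (by push_cast; ring) (e := b - i - j - 1) (by push_cast; ring),
    hq.Gp (n := i + -1) i (by push_cast; ring) (e := b - i - j - 1) (by push_cast; ring)]
  have e1 := fall_add b i (j + 1)
  have e2 := fall_add b (j + 1) i
  rw [add_comm (j + 1) i, e1] at e2
  push_cast at e1 e2
  rw [e1]
  match_scalars
  linear_combination (-(ω.q + 1)) * e2

theorem IsEval.defect_TGm (hq : IsEval ω p q) (hp : 0 < p) (i j : ℕ) (b : ℂ) :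
    q (tailDefect ω (.T i) (.Gm j) b) = 0 := by
  simp only [tailDefect, brk, sgn, Gen.odd, Bool.false_and, Bool.false_eq_true, if_false, one_smul]
  rw [act_T rfl (e := b - i) rfl, act_Gm rfl (e := b - (j + 1)) rfl]
  simp only [map_sub, map_smul, map_neg, consL_wd]
  rw [hq.comm (by simp) (by rwa [pcount_T]) (by simp only [Gen.Tail]; omega),
    act_T rfl (e := b - i - j - 1) (by ring)]
  simp only [brk, sgn, Gen.odd, Bool.false_and, Bool.false_eq_true, if_false, one_smul, map_smul,
    consL_wd]
  rw [hq.Gm (n := j) (j + 1) (by push_cast; ring) (e := b - i - j - 1) (by push_cast; ring),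
    hq.Gm (n := i + j) (i + (j + 1)) (by push_cast; ring) (e := b - i - j - 1) (by push_cast; ring),
    hq.Gm (n := i + -1) i (by push_cast; ring) (e := b - i - j - 1) (by push_cast; ring)]
  have e1 := fall_add b i (j + 1)
  have e2 := fall_add b (j + 1) i
  rw [add_comm (j + 1) i, e1] at e2
  push_cast at e1 e2
  rw [e1]
  match_scalars
  linear_combination (-(ω.q - 1)) * e2

theorem IsEval.defect_GpGp (hq : IsEval ω p q) (hp : 1 < p) (i j : ℕ) (b : ℂ) :
    q (tailDefect ω (.Gp i) (.Gp j) b) = 0 := by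
  have h0 : ∀ e, q (wd [.Gp (-1), .Gp (-1)] e) = 0 := by
    intro e
    have := hq.exch (.Gp (-1)) (.Gp (-1)) (by simp) (by simp [pcount, Gen.oddRaising]; omega) e
    rw [exch_self_of_odd rfl, map_smul] at this
    simpa using this
  simp only [tailDefect, brk, sgn, Gen.odd, Bool.and_self, if_true]
  rw [act_Gp rfl rfl, act_Gp rfl rfl]
  simp only [map_sub, map_smul, map_zero, consL_wd]
  rw [hq.comm (by simp) (by rwa [pcount_Gp]) (by simp only [Gen.Tail]; omega),
    hq.comm (by simp) (by rwa [pcount_Gp]) (by simp only [Gen.Tail]; omega),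
    act_Gp rfl rfl, act_Gp rfl rfl]
  simp only [brk, map_smul, consL_wd, h0]
  simp

theorem IsEval.defect_GmGm (hq : IsEval ω p q) (hp : 1 < p) (i j : ℕ) (b : ℂ) :
    q (tailDefect ω (.Gm i) (.Gm j) b) = 0 := by
  have h0 : ∀ e, q (wd [.Gm (-1), .Gm (-1)] e) = 0 := by
    intro e
    have := hq.exch (.Gm (-1)) (.Gm (-1)) (by simp) (by simp [pcount, Gen.oddRaising]; omega) e
    rw [exch_self_of_odd rfl, map_smul] at this
    simpa using this
  simp only [tailDefect, brk, sgn, Gen.odd, Bool.and_self, if_true]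
  rw [act_Gm rfl rfl, act_Gm rfl rfl]
  simp only [map_sub, map_smul, map_zero, consL_wd]
  rw [hq.comm (by simp) (by rwa [pcount_Gm]) (by simp only [Gen.Tail]; omega),
    hq.comm (by simp) (by rwa [pcount_Gm]) (by simp only [Gen.Tail]; omega),
    act_Gm rfl rfl, act_Gm rfl rfl]
  simp only [brk, map_smul, consL_wd, h0]
  simp

theorem IsEval.defect_TT (hq : IsEval ω p q) (i j : ℕ) (b : ℂ) :
    q (tailDefect ω (.T i) (.T j) b) = 0 := by
  have hc : (if (i : ℤ) + j = 0 then (((i : ℤ) : ℂ)) / 3 else 0) = 0 := by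
    split_ifs with h
    · obtain rfl : i = 0 := by omega
      simp
    · rfl
  simp only [tailDefect, brk, sgn, Gen.odd, Bool.and_self, Bool.false_eq_true, if_false, one_smul]
  rw [hc, act_T rfl (e := b - i) rfl, act_T rfl (e := b - j) rfl]
  simp only [map_sub, map_smul, consL_wd]
  rw [hq.T i rfl (e := b - i - j) (by ring), hq.T j rfl (e := b - i - j) (by ring)]
  have e1 := fall_add b i j
  have e2 := fall_add b j i
  rw [add_comm j i, e1] at e2
  simp only [zero_smul]
  match_scalars
  linear_combination (-(ω.q ^ 2)) * e2

/-- After one odd letter has acted, the other must pass `G^±_{-1/2}` while being the only odd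
raising letter of its word; hence `1 < p`. Both remaining scalars are compared by splitting `fall b
(i + j + 1)` in three ways. -/
theorem IsEval.defect_GpGm (hq : IsEval ω p q) (hp : 1 < p) (i j : ℕ) (b : ℂ) :
    q (tailDefect ω (.Gp i) (.Gm j) b) = 0 := by
  have h0 : ∀ e f, f = e + 1 → q (wd [.Gm (-1), .Gp (-1)] e) = - q (wd [.Gp (-1), .Gm (-1)] e)
      + (2 : ℂ) • q (wd [] f) := by
    intro e f hf
    have := hq.exch (.Gm (-1)) (.Gp (-1)) (by simp) (by simp [pcount, Gen.oddRaising]; omega) e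
    have hL := hq.L (n := -1) 0 (by norm_num) (b := e) (e := f) (by push_cast; linear_combination hf)
    simp [fall_zero] at hL
    simp [N2.exch, sgn, Gen.odd, brk, hL] at this
    rw [← sub_eq_zero, ← this]
    module
  simp only [tailDefect, brk, sgn, Gen.odd, Bool.and_self, if_true]
  rw [act_Gp rfl (e := b - (i + 1)) rfl, act_Gm rfl (e := b - (j + 1)) rfl,
    if_neg (by omega), zero_smul, add_zero]
  simp only [map_sub, map_add, map_smul, consL_wd]
  rw [hq.comm (by simp) (by rwa [pcount_Gp]) (by simp only [Gen.Tail]; omega),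
    hq.comm (by simp) (by rwa [pcount_Gm]) (by simp only [Gen.Tail]; omega),
    act_Gp rfl (e := b - i - j - 2) (by ring), act_Gm rfl (e := b - i - j - 2) (by ring)]
  have hc : ∀ i : ℕ, (if (i : ℤ) + -1 + 1 = 0 then (((i : ℤ) : ℂ)) * ((i : ℤ) + 1) / 3 else 0) = 0 := by
    intro i
    split_ifs with h
    · obtain rfl : i = 0 := by omega
      simp
    · rfl
  simp only [brk, map_smul, consL_wd, hc, sgn, Gen.odd, Bool.and_self, if_true, zero_smul, add_zero]
  rw [h0 _ (b - i - j - 1) (by ring),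
    hq.L (i + 1) (by push_cast; ring) (e := b - i - j - 1) (by push_cast; ring),
    hq.L (j + 1) (by push_cast; ring) (e := b - i - j - 1) (by push_cast; ring),
    hq.L (i + j + 2) (by push_cast; ring) (e := b - i - j - 1) (by push_cast; ring),
    hq.T i (by push_cast; ring) (e := b - i - j - 1) (by push_cast; ring),
    hq.T j (by push_cast; ring) (e := b - i - j - 1) (by push_cast; ring),
    hq.T (i + (j + 1)) (by push_cast; ring) (e := b - i - j - 1) (by push_cast; ring)]
  rw [show i + j + 2 - 1 = i + (j + 1) by omega, show i + j + 2 = i + (j + 1) + 1 by omega]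
  simp only [Nat.add_sub_cancel, fall_succ _ (i + _)]
  have e1 := fall_add b i (j + 1)
  have e2 := fall_add b (j + 1) i
  have e3 := fall_add b (i + 1) j
  rw [add_comm (j + 1) i, e1] at e2
  rw [show i + 1 + j = i + (j + 1) by omega, e1] at e3
  rw [e1]
  simp only [fall_succ _ i, fall_succ _ j] at e1 e2 e3 ⊢
  push_cast at e1 e2 e3 ⊢
  match_scalars
  · linear_combination (b - i - j - 1) * (e3 - e2)
  · linear_combination (-(2 * (i + 1) * ω.h + (i + 1) * ω.q)) * e2
      - (2 * (j + 1) * ω.h + 2 * (b - i - j - 1) - (j + 1) * ω.q) * e3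

theorem IsEval.defect_C (hq : IsEval ω p q) {x : Gen} (hx : x.Tail) (hp : pcount [x] ≤ p) (b : ℂ) :
    q (tailDefect ω x .C b) = 0 := by
  have h0 : brk (fun g => wd [g] b) x .C = 0 := by cases x <;> rfl
  have hs : sgn x .C = 1 := by cases x <;> simp [sgn, Gen.odd]
  rw [tailDefect, h0, hs, one_smul, sub_zero]
  simp only [act, map_sub, map_smul, consL_wd]
  rw [hq.tail _ hx]
  cases x with
  | L n => simp only [act, map_smul, consL_wd, hq.C]; module
  | T n => simp only [act, map_smul, consL_wd, hq.C]; module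
  | C => simp only [act, map_smul, consL_wd, hq.C]; module
  | Gp n =>
    have hp : 0 < p := by simp [pcount, Gen.oddRaising, show 0 ≤ n from hx] at hp; omega
    simp only [act, map_smul, consL_wd]
    rw [hq.comm (g := .C) (by simp) hp trivial]
    simp [act, sgn, Gen.odd, brk]
    module
  | Gm n =>
    have hp : 0 < p := by simp [pcount, Gen.oddRaising, show 0 ≤ n from hx] at hp; omega
    simp only [act, map_smul, consL_wd]
    rw [hq.comm (g := .C) (by simp) hp trivial]
    simp [act, sgn, Gen.odd, brk]
    module

end

theorem tailDefect_eq_zero {M : Type*} [AddCommGroup M] [Module ℂ M] {ω : Weight}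
    {q : WMod →ₗ[ℂ] M} {x y : Gen} (hq : IsEval ω (pcount [x, y]) q) (hx : x.Tail) (hy : y.Tail)
    (b : ℂ) : q (tailDefect ω x y b) = 0 := by
  have flip : ∀ {p : ℕ}, (∀ q : WMod →ₗ[ℂ] M, IsEval ω p q → q (tailDefect ω y x b) = 0) →
      p = pcount [x, y] → q (tailDefect ω x y b) = 0 := by
    rintro p h rfl
    rw [tailDefect_comm, map_smul, h q hq, smul_zero]
  have hL : ∀ n : ℤ, (Gen.L n).Tail → ∃ i : ℕ, n = (i : ℤ) - 1 := fun n h => by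
    have h : -1 ≤ n := h
    exact ⟨(n + 1).toNat, by omega⟩
  have hN : ∀ n : ℤ, 0 ≤ n → ∃ i : ℕ, n = i := fun n h => ⟨n.toNat, by omega⟩
  have hle : ∀ l, pcount [x] ≤ pcount (x :: l) ∧ ∀ y, pcount [y] ≤ pcount [x, y] := by
    intro l; simp [pcount, List.countP_cons]
  cases y with
  | C => exact hq.defect_C hx (hle _).1 b
  | L n =>
    obtain ⟨j, rfl⟩ := hL n hy
    cases x with
    | L m => obtain ⟨i, rfl⟩ := hL m hx; exact hq.defect_LL i j b
    | T m => obtain ⟨i, rfl⟩ := hN m hx; exact flip (fun q hq => hq.defect_LT j i b) rfl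
    | Gp m =>
      obtain ⟨i, rfl⟩ := hN m hx
      exact flip (fun q hq => hq.defect_LGp (by simp [pcount, Gen.oddRaising]) j i b) rfl
    | Gm m =>
      obtain ⟨i, rfl⟩ := hN m hx
      exact flip (fun q hq => hq.defect_LGm (by simp [pcount, Gen.oddRaising]) j i b) rfl
    | C => exact flip (fun q hq => hq.defect_C hy ((hle []).2 _) b) rfl
  | T n =>
    obtain ⟨j, rfl⟩ := hN n hy
    cases x with
    | L m => obtain ⟨i, rfl⟩ := hL m hx; exact hq.defect_LT i j b
    | T m => obtain ⟨i, rfl⟩ := hN m hx; exact hq.defect_TT i j b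
    | Gp m =>
      obtain ⟨i, rfl⟩ := hN m hx
      exact flip (fun q hq => hq.defect_TGp (by simp [pcount, Gen.oddRaising]) j i b) rfl
    | Gm m =>
      obtain ⟨i, rfl⟩ := hN m hx
      exact flip (fun q hq => hq.defect_TGm (by simp [pcount, Gen.oddRaising]) j i b) rfl
    | C => exact flip (fun q hq => hq.defect_C hy ((hle []).2 _) b) rfl
  | Gp n =>
    obtain ⟨j, rfl⟩ := hN n hy
    cases x with
    | L m => obtain ⟨i, rfl⟩ := hL m hx; exact hq.defect_LGp (by simp [pcount, Gen.oddRaising]) i j b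
    | T m => obtain ⟨i, rfl⟩ := hN m hx; exact hq.defect_TGp (by simp [pcount, Gen.oddRaising]) i j b
    | Gp m => obtain ⟨i, rfl⟩ := hN m hx; exact hq.defect_GpGp (by simp [pcount, Gen.oddRaising]) i j b
    | Gm m =>
      obtain ⟨i, rfl⟩ := hN m hx
      exact flip (fun q hq => hq.defect_GpGm (by simp [pcount, Gen.oddRaising]) j i b) rfl
    | C => exact flip (fun q hq => hq.defect_C hy ((hle []).2 _) b) rfl
  | Gm n =>
    obtain ⟨j, rfl⟩ := hN n hy
    cases x with
    | L m => obtain ⟨i, rfl⟩ := hL m hx; exact hq.defect_LGm (by simp [pcount, Gen.oddRaising]) i j b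
    | T m => obtain ⟨i, rfl⟩ := hN m hx; exact hq.defect_TGm (by simp [pcount, Gen.oddRaising]) i j b
    | Gp m => obtain ⟨i, rfl⟩ := hN m hx; exact hq.defect_GpGm (by simp [pcount, Gen.oddRaising]) i j b
    | Gm m => obtain ⟨i, rfl⟩ := hN m hx; exact hq.defect_GmGm (by simp [pcount, Gen.oddRaising]) i j b
    | C => exact flip (fun q hq => hq.defect_C hy ((hle []).2 _) b) rfl

/-- The restriction to fewer odd raising letters in `IsEval` avoids circularity: the words of length
two that occur are then strictly below `[x, y]`, although they have the same length. -/
theorem isEval_mkQ (ω : Weight) (x y : Gen) :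
    IsEval ω (pcount [x, y]) (relBelow ω [x, y]).mkQ where
  tail g hg b := by
    rw [← sub_eq_zero, ← map_sub, Submodule.mkQ_apply, Submodule.Quotient.mk_eq_zero]
    exact (Red.tail hg b).mem (Below.of_length (by simp))
  exch g G hG hp b := by
    rw [Submodule.mkQ_apply, Submodule.Quotient.mk_eq_zero]
    have h0 : pcount [g, G] < pcount [x, y] ∧ pcount [G, g] < pcount [x, y] := by
      rcases hG with rfl | rfl <;> simpa [pcount, List.countP_cons, Gen.oddRaising] using hp
    exact exch_mem b (Or.inr (Or.inl ⟨rfl, h0.1⟩)) (Or.inr (Or.inl ⟨rfl, h0.2⟩))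
  cons g G hG hp hg b := by
    rw [← sub_eq_zero, ← map_sub, Submodule.mkQ_apply, Submodule.Quotient.mk_eq_zero]
    have h0 : pcount [G, g] < pcount [x, y] := by
      rcases hG with rfl | rfl <;> simpa [pcount, List.countP_cons, Gen.oddRaising] using hp
    exact ((Red.tail hg b).cons G).mem (Or.inr (Or.inl ⟨rfl, h0⟩))

theorem tailDefect_mem {ω : Weight} {x y : Gen} (hx : x.Tail) (hy : y.Tail) (b : ℂ) :
    tailDefect ω x y b ∈ relBelow ω [x, y] := by
  have := tailDefect_eq_zero (isEval_mkQ ω x y) hx hy b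
  rwa [Submodule.mkQ_apply, Submodule.Quotient.mk_eq_zero] at this

/-! ### Critical pairs and confluence. -/

/-- The reducts of a word at its first two letters. -/
def HeadRed (x y : Gen) (v : List Gen) (b : ℂ) (ρ : WMod) : Prop :=
  (y < x ∧ ρ = sgn x y • wd (y :: x :: v) b + brk (fun g => wd (g :: v) b) x y) ∨
    (x = y ∧ x.odd = true ∧ ρ = 0)

theorem Red.cases_cons {ω : Weight} {x : Gen} {v : List Gen} {b : ℂ} {ρ : WMod}
    (h : Red ω (x :: v, b) ρ) : (∃ y v', v = y :: v' ∧ HeadRed x y v' b ρ) ∨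
      (v = [] ∧ x.Tail ∧ ρ = act ω x b) ∨ ∃ ρ', Red ω (v, b) ρ' ∧ ρ = consL x ρ' := by
  cases h with
  | swap h v b => exact Or.inl ⟨_, _, rfl, Or.inl ⟨h, rfl⟩⟩
  | sq h v b => exact Or.inl ⟨_, _, rfl, Or.inr ⟨rfl, h, rfl⟩⟩
  | tail h b => exact Or.inr (Or.inl ⟨rfl, h, rfl⟩)
  | cons x h => exact Or.inr (Or.inr ⟨_, h, rfl⟩)

theorem not_red_nil {ω : Weight} {b : ℂ} {ρ : WMod} : ¬ Red ω ([], b) ρ := by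
  intro h; cases h

theorem HeadRed.exch {x y : Gen} {v : List Gen} {b : ℂ} {ρ : WMod} (h : HeadRed x y v b ρ) :
    (y < x ∧ wd (x :: y :: v) b - ρ = N2.exch x y v b) ∨
      (x = y ∧ x.odd = true ∧ (2 : ℂ) • (wd (x :: y :: v) b - ρ) = N2.exch x y v b) := by
  rcases h with ⟨h, rfl⟩ | ⟨rfl, h, rfl⟩
  · exact Or.inl ⟨h, by rw [N2.exch, sub_sub]⟩
  · exact Or.inr ⟨rfl, h, by rw [exch_self_of_odd h, sub_zero]⟩

theorem HeadRed.le {x y : Gen} {v : List Gen} {b : ℂ} {ρ : WMod} (h : HeadRed x y v b ρ) :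
    y ≤ x := by
  rcases h with ⟨h, -⟩ | ⟨rfl, -⟩
  exacts [h.le, le_rfl]

theorem Submodule.of_two_smul {M : Type*} [AddCommGroup M] [Module ℂ M] {S : Submodule ℂ M} {m : M}
    (h : (2 : ℂ) • m ∈ S) : m ∈ S := by
  have := S.smul_mem (1 / 2 : ℂ) h
  rwa [smul_smul, show (1 / 2 : ℂ) * 2 = 1 by norm_num, one_smul] at this

/-- This is the overlap on three letters. `exch_jacobi` writes the difference of the two reducts
through exchanges of smaller words. A square rule is half of an exchange, which explains the
division by `2` when odd letters coincide. -/
theorem headRed_triple {ω : Weight} {x y z : Gen} {v : List Gen} {b : ℂ} {ρ₁ ρ₂ : WMod}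
    (h₁ : HeadRed x y (z :: v) b ρ₁) (h₂ : HeadRed y z v b ρ₂) :
    ρ₁ - consL x ρ₂ ∈ relBelow ω (x :: y :: z :: v) := by
  have J := exch_jacobi ω x y z v b
  have e : ρ₁ - consL x ρ₂ = consL x (wd (y :: z :: v) b - ρ₂) - (wd (x :: y :: z :: v) b - ρ₁) := by
    rw [map_sub, consL_wd]; abel
  rw [e]
  set A := wd (x :: y :: z :: v) b - ρ₁ with hA
  set B := wd (y :: z :: v) b - ρ₂ with hB
  rcases h₁.exch with ⟨hxy, eA⟩ | ⟨rfl, hx, eA⟩ <;> rcases h₂.exch with ⟨hyz, eB⟩ | ⟨rfl, hy, eB⟩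
  · have b1 : Below (y :: x :: z :: v) (x :: y :: z :: v) := Below.swap hxy _
    have b2 : Below (x :: z :: y :: v) (x :: y :: z :: v) := (Below.swap hyz _).cons x
    have b3 : Below (y :: z :: x :: v) (x :: y :: z :: v) :=
      ((Below.swap (hyz.trans hxy) v).cons y).trans b1
    have b4 : Below (z :: x :: y :: v) (x :: y :: z :: v) := (Below.swap (hyz.trans hxy) _).trans b2
    have b5 : Below (z :: y :: x :: v) (x :: y :: z :: v) := (Below.swap hyz _).trans b3
    have m1 : consL y (N2.exch x z v b) ∈ relBelow ω (x :: y :: z :: v) := by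
      simp only [N2.exch, map_sub, map_smul, map_brk, consL_wd]
      have := (Red.cons y (Red.swap (ω := ω) (hyz.trans hxy) v b)).mem b1
      simpa only [map_add, map_smul, map_brk, consL_wd, sub_sub] using this
    have m2 : consL z (N2.exch x y v b) ∈ relBelow ω (x :: y :: z :: v) := by
      simp only [N2.exch, map_sub, map_smul, map_brk, consL_wd]
      have := (Red.cons z (Red.swap (ω := ω) hxy v b)).mem b4
      simpa only [map_add, map_smul, map_brk, consL_wd, sub_sub] using this
    have m3 := exch_mem (ω := ω) b b2 b4
    have m4 := exch_mem (ω := ω) b b3 b5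
    rw [← eA, ← eB] at J
    have := Submodule.sub_mem _ (Submodule.add_mem _ (Submodule.sub_mem _ (Submodule.add_mem _
      (Submodule.neg_mem _ J) (Submodule.smul_mem _ (sgn x y) m1)) (Submodule.smul_mem _ (sgn y z) m3))
      (Submodule.smul_mem _ (sgn x y * sgn x z) m4)) (Submodule.smul_mem _ (sgn x z * sgn y z) m2)
    convert this using 1
    module
  · have b1 : Below (y :: x :: y :: v) (x :: y :: y :: v) := Below.swap hxy _
    have b2 : Below (y :: y :: x :: v) (x :: y :: y :: v) := ((Below.swap hxy _).cons y).trans b1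
    have m1 : consL y (N2.exch x y v b) ∈ relBelow ω (x :: y :: y :: v) := by
      simp only [N2.exch, map_sub, map_smul, map_brk, consL_wd]
      have := (Red.cons y (Red.swap (ω := ω) hxy v b)).mem b1
      simpa only [map_add, map_smul, map_brk, consL_wd, sub_sub] using this
    have m2 := exch_mem (ω := ω) b b2 b2
    have hs : sgn y y = -1 := by simp [sgn, hy]
    rw [← eA, ← eB, map_smul, hs] at J
    refine Submodule.of_two_smul ?_
    have := Submodule.sub_mem _ (Submodule.add_mem _ (Submodule.neg_mem _ J)
      (Submodule.smul_mem _ (2 * sgn x y) m1)) (Submodule.smul_mem _ (-(sgn x y * sgn x y)) m2)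
    convert this using 1
    module
  · have b1 : Below (x :: z :: x :: v) (x :: x :: z :: v) := (Below.swap hyz _).cons x
    have b2 : Below (z :: x :: x :: v) (x :: x :: z :: v) := (Below.swap hyz _).trans b1
    have m1 : consL z (N2.exch x x v b) ∈ relBelow ω (x :: x :: z :: v) := by
      rw [exch_self_of_odd hx, map_smul, consL_wd]
      have := (Red.cons z (Red.sq (ω := ω) hx v b)).mem b2
      rw [map_zero, sub_zero] at this
      exact Submodule.smul_mem _ _ this
    have m2 := exch_mem (ω := ω) b b1 b2
    have hs : sgn x x = -1 := by simp [sgn, hx]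
    rw [← eA, ← eB, hs] at J
    refine Submodule.of_two_smul ?_
    have := Submodule.sub_mem _ (Submodule.neg_mem _ J)
      (Submodule.smul_mem _ (sgn x z * sgn x z) m1)
    have := Submodule.sub_mem _ this (Submodule.smul_mem _ (2 * sgn x z) m2)
    convert this using 1
    module
  · rw [hA, hB, map_sub, consL_wd]
    rcases h₁ with ⟨h, -⟩ | ⟨-, -, rfl⟩
    · exact absurd h (lt_irrefl _)
    rcases h₂ with ⟨h, -⟩ | ⟨-, -, rfl⟩
    · exact absurd h (lt_irrefl _)
    simp

theorem headRed_tail {ω : Weight} {x y : Gen} {b : ℂ} {ρ : WMod} (h : HeadRed x y [] b ρ)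
    (hy : y.Tail) : ρ - consL x (act ω y b) ∈ relBelow ω [x, y] := by
  have hx : x.Tail := hy.of_le h.le
  have D := tailDefect_mem (ω := ω) hx hy b
  have e : ρ - consL x (act ω y b) = (wd [x, y] b - consL x (act ω y b)) - (wd [x, y] b - ρ) := by abel
  have key : N2.exch x y [] b - (wd [x, y] b - consL x (act ω y b))
      + sgn x y • (wd [y, x] b - consL y (act ω x b)) = tailDefect ω x y b := by
    rw [N2.exch, tailDefect]; module
  rw [e]
  set A := wd [x, y] b - ρ with hA
  rcases h.exch with ⟨hxy, eA⟩ | ⟨rfl, hx', eA⟩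
  · have m1 := ((Red.tail (ω := ω) hx b).cons y).mem (Below.swap hxy [])
    rw [← key, ← eA] at D
    have := Submodule.sub_mem _ (Submodule.smul_mem _ (sgn x y) m1) D
    convert this using 1
    module
  · have hs : sgn x x = -1 := by simp [sgn, hx']
    rw [← key, ← eA, hs] at D
    refine Submodule.of_two_smul ?_
    convert Submodule.neg_mem _ D using 1
    module

/-- The rules act on disjoint parts of the word and hence commute: the exchange at the head holds
for each smaller word that can occur in place of `v`, and so by linearity for the reduct of `v`. -/
theorem headRed_cons {ω : Weight} {x y : Gen} {v : List Gen} {b : ℂ} {ρ₁ ρ₂ : WMod}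
    (h₁ : HeadRed x y v b ρ₁) (h₂ : Red ω (v, b) ρ₂) :
    ρ₁ - consL x (consL y ρ₂) ∈ relBelow ω (x :: y :: v) := by
  have hlow := h₂.lower
  rcases h₁ with ⟨hxy, rfl⟩ | ⟨rfl, hx, rfl⟩
  · have e1 : belowSpan v ≤ (relBelow ω (x :: y :: v)).comap
        (sgn x y • (consL y ∘ₗ consL x) + brk (fun g => consL g) x y - consL x ∘ₗ consL y) := by
      rw [belowSpan, Finsupp.supported_eq_span_single, Submodule.span_le]
      rintro _ ⟨⟨l', b'⟩, h, rfl⟩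
      have hb : Below l' v := h
      have := exch_mem (ω := ω) b' ((hb.cons y).cons x)
        (((hb.cons x).cons y).trans (Below.swap hxy v))
      have e := map_brk (LinearMap.applyₗ (wd l' b') : (WMod →ₗ[ℂ] WMod) →ₗ[ℂ] WMod)
        (fun g => consL g) x y
      simp only [LinearMap.applyₗ_apply_apply, consL_wd] at e
      rw [SetLike.mem_coe, Submodule.mem_comap, show (fun i : List Gen × ℂ => (Finsupp.single i 1 : WMod)) (l', b') = wd l' b' from rfl]
      simp only [LinearMap.sub_apply, LinearMap.add_apply, LinearMap.smul_apply,
        LinearMap.comp_apply, consL_wd, e]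
      convert Submodule.neg_mem _ this using 1
      rw [N2.exch]
      abel
    have e2 := e1 hlow
    have m1 := ((h₂.cons x).cons y).mem (Below.swap hxy v)
    have m2 : brk (fun g => wd (g :: v) b - consL g ρ₂) x y ∈ relBelow ω (x :: y :: v) :=
      brk_mem _ _ _ _ fun g _ => (h₂.cons g).mem (Below.of_length (by simp))
    have e := map_brk (LinearMap.applyₗ ρ₂ : (WMod →ₗ[ℂ] WMod) →ₗ[ℂ] WMod)
        (fun g => consL g) x y
    simp only [LinearMap.applyₗ_apply_apply] at e
    simp only [Submodule.mem_comap, LinearMap.sub_apply, LinearMap.add_apply,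
      LinearMap.smul_apply, LinearMap.comp_apply, e] at e2
    rw [brk_sub] at m2
    have := Submodule.add_mem _ (Submodule.add_mem _ e2 (Submodule.smul_mem _ (sgn x y) m1)) m2
    convert this using 1
    module
  · have e1 : belowSpan v ≤ (relBelow ω (x :: x :: v)).comap (consL x ∘ₗ consL x) := by
      rw [belowSpan, Finsupp.supported_eq_span_single, Submodule.span_le]
      rintro _ ⟨⟨l', b'⟩, h, rfl⟩
      have hb : Below l' v := h
      have := (Red.sq (ω := ω) hx l' b').mem ((hb.cons x).cons x)
      rw [SetLike.mem_coe, Submodule.mem_comap, show (fun i : List Gen × ℂ => (Finsupp.single i 1 : WMod)) (l', b') = wd l' b' from rfl]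
      simpa only [LinearMap.comp_apply, consL_wd, sub_zero] using this
    rw [zero_sub]
    exact Submodule.neg_mem _ (e1 hlow)

theorem headRed_red {ω : Weight} {x y : Gen} {v : List Gen} {b : ℂ} {ρ₁ ρ₂ : WMod}
    (h₁ : HeadRed x y v b ρ₁) (h₂ : Red ω (y :: v, b) ρ₂) :
    ρ₁ - consL x ρ₂ ∈ relBelow ω (x :: y :: v) := by
  rcases h₂.cases_cons with ⟨z, v', rfl, h⟩ | ⟨rfl, h, rfl⟩ | ⟨ρ', h, rfl⟩
  · exact headRed_triple h₁ h
  · exact headRed_tail h₁ h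
  · exact headRed_cons h₁ h

theorem red_confluent {ω : Weight} {l : List Gen} {b : ℂ} {ρ₁ ρ₂ : WMod} (h₁ : Red ω (l, b) ρ₁)
    (h₂ : Red ω (l, b) ρ₂) : ρ₁ - ρ₂ ∈ relBelow ω l := by
  induction l generalizing ρ₁ ρ₂ with
  | nil => exact absurd h₁ not_red_nil
  | cons x v ih =>
    rcases h₁.cases_cons with ⟨y, v', rfl, h⟩ | ⟨rfl, h, rfl⟩ | ⟨ρ', h, rfl⟩
    · rcases h₂.cases_cons with ⟨y', v'', e, h'⟩ | ⟨e, -⟩ | ⟨ρ', h', rfl⟩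
      · obtain ⟨rfl, rfl⟩ := List.cons.inj e
        rcases h with ⟨h, rfl⟩ | ⟨rfl, h, rfl⟩ <;> rcases h' with ⟨h', rfl⟩ | ⟨h', h3, rfl⟩
        · simp
        · exact absurd h (h' ▸ lt_irrefl _)
        · exact absurd h' (lt_irrefl _)
        · simp
      · simp at e
      · exact headRed_red h h'
    · rcases h₂.cases_cons with ⟨y', v'', e, h'⟩ | ⟨-, -, rfl⟩ | ⟨ρ', h', rfl⟩
      · simp at e
      · simp
      · exact absurd h' not_red_nil
    · rcases h₂.cases_cons with ⟨y', v'', rfl, h'⟩ | ⟨rfl, -⟩ | ⟨ρ'', h', rfl⟩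
      · rw [← neg_sub]
        exact Submodule.neg_mem _ (headRed_red h' h)
      · exact absurd h not_red_nil
      · rw [← map_sub]
        exact consL_relBelow x (ih h h')

/-- Normal forms of words. -/
theorem exists_nf (ω : Weight) : ∃ N : WMod →ₗ[ℂ] WMod,
    (∀ w ρ, Red ω w ρ → N (Finsupp.single w 1) = N ρ) ∧
      ∀ w, (¬ ∃ ρ, Red ω w ρ) → N (Finsupp.single w 1) = Finsupp.single w 1 := by
  refine exists_normalForm (r := fun w' w : List Gen × ℂ => Below w'.1 w.1)
    (InvImage.wf Prod.fst below_wf) (Red ω) (fun w ρ h y hy => ?_) (fun w ρ₁ ρ₂ h₁ h₂ => ?_)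
  · exact (Finsupp.mem_supported ℂ ρ).1 h.lower hy
  · exact red_confluent (l := w.1) (b := w.2) h₁ h₂

/-! ### Ordered monomials as words -/

/-- The product of the letters of a word. -/
def word (l : List Gen) : U := (l.map gen).prod

@[simp] theorem word_nil : word [] = 1 := rfl

@[simp] theorem word_cons (x : Gen) (l : List Gen) : word (x :: l) = gen x * word l := by
  simp [word]

theorem word_append (l l' : List Gen) : word (l ++ l') = word l * word l' := by
  simp [word]

/-- The letters of an ordered monomial. -/
def Idx.letters (X : Idx) : List Gen :=
  (X.I.sort (· ≥ ·)).map (fun n : ℕ => Gen.L (-((n : ℤ) + 2)))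
    ++ (X.J.sort (· ≥ ·)).map (fun n : ℕ => Gen.T (-((n : ℤ) + 1)))
    ++ (X.Kp.sort (· ≥ ·)).map (fun n : ℕ => Gen.Gp (-((n : ℤ) + 1)))
    ++ (X.Km.sort (· ≥ ·)).map (fun n : ℕ => Gen.Gm (-((n : ℤ) + 1)))

theorem mono_eq_word (X : Idx) : mono X = word X.letters := by
  simp only [mono, Idx.letters, word, List.map_append, List.prod_append, List.map_map]
  rfl

/-- The multiset of letters of an ordered monomial. -/
def Idx.lettersM (X : Idx) : Multiset Gen :=
  X.I.map (fun n : ℕ => Gen.L (-((n : ℤ) + 2))) + X.J.map (fun n : ℕ => Gen.T (-((n : ℤ) + 1)))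
    + X.Kp.val.map (fun n : ℕ => Gen.Gp (-((n : ℤ) + 1)))
    + X.Km.val.map (fun n : ℕ => Gen.Gm (-((n : ℤ) + 1)))

theorem Idx.coe_letters (X : Idx) : (X.letters : Multiset Gen) = X.lettersM := by
  simp only [Idx.letters, Idx.lettersM, ← Multiset.coe_add, ← Multiset.map_coe, Multiset.sort_eq,
    Finset.sort_eq]

theorem Multiset.filterMap_none {α β : Type*} (s : Multiset α) :
    Multiset.filterMap (fun _ => (none : Option β)) s = 0 := by
  induction s using Multiset.induction_on with
  | empty => rfl
  | cons a s ih => rw [Multiset.filterMap_cons_none _ _ rfl, ih]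

theorem Idx.lettersM_injective : Function.Injective Idx.lettersM := by
  intro X Y h
  have e : ∀ f : Gen → Option ℕ, _ := fun f => congrArg (Multiset.filterMap f) h
  simp only [Idx.lettersM, Multiset.filterMap_add, Multiset.filterMap_map] at e
  ext1
  · have := e (fun g => match g with | .L n => some (-n - 2).toNat | _ => none)
    simpa [Function.comp_def, Multiset.filterMap_none] using this
  · have := e (fun g => match g with | .T n => some (-n - 1).toNat | _ => none)
    simpa [Function.comp_def, Multiset.filterMap_none] using this
  · have := e (fun g => match g with | .Gp n => some (-n - 1).toNat | _ => none)
    simpa [Function.comp_def, Multiset.filterMap_none] using this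
  · have := e (fun g => match g with | .Gm n => some (-n - 1).toNat | _ => none)
    simpa [Function.comp_def, Multiset.filterMap_none] using this

/-- The words that are letters of ordered monomials. -/
def Good (l : List Gen) : Prop :=
  l.Pairwise (fun x y => x ≤ y ∧ (x = y → x.odd = false)) ∧ ∀ x ∈ l, ¬ x.Tail

theorem Good.of_cons {x : Gen} {l : List Gen} (h : Good (x :: l)) : Good l :=
  ⟨(List.pairwise_cons.1 h.1).2, fun y hy => h.2 y (List.mem_cons_of_mem _ hy)⟩

theorem Good.not_red {ω : Weight} {w : List Gen × ℂ} {ρ : WMod} (h : Red ω w ρ) : ¬ Good w.1 := by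
  induction h with
  | swap h v b => exact fun hg => not_lt.2 ((List.pairwise_cons.1 hg.1).1 _ (by simp)).1 h
  | sq h v b => 
    intro hg
    have := ((List.pairwise_cons.1 hg.1).1 _ (List.mem_cons_self)).2 rfl
    simp [h] at this
  | tail h b => exact fun hg => hg.2 _ (by simp) h
  | cons x h ih => exact fun hg => ih hg.of_cons

theorem good_of_not_red {ω : Weight} {b : ℂ} {l : List Gen} (h : ¬ ∃ ρ, Red ω (l, b) ρ) :
    Good l := by
  induction l with
  | nil => exact ⟨List.Pairwise.nil, by simp⟩
  | cons x v ih =>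
    have hv := ih fun ⟨ρ, hρ⟩ => h ⟨_, hρ.cons x⟩
    rcases v with _ | ⟨y, v⟩
    · exact ⟨by simp, by simpa using fun hx => h ⟨_, Red.tail hx b⟩⟩
    · have h1 : x ≤ y := not_lt.1 fun hxy => h ⟨_, Red.swap hxy v b⟩
      have h2 : x = y → x.odd = false := by
        rintro rfl
        by_contra hx
        exact h ⟨_, Red.sq (by simpa using hx) v b⟩
      refine ⟨List.pairwise_cons.2 ⟨fun z hz => ?_, hv.1⟩, fun z hz => ?_⟩
      · rcases List.mem_cons.1 hz with rfl | hz
        · exact ⟨h1, h2⟩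
        · have hyz := ((List.pairwise_cons.1 hv.1).1 z hz).1
          exact ⟨h1.trans hyz, fun hxz => h2 (le_antisymm h1 (hxz ▸ hyz))⟩
      · rcases List.mem_cons.1 hz with rfl | hz
        · exact fun hx => hv.2 y (by simp) (hx.of_le h1)
        · exact hv.2 z hz

theorem Idx.good_letters (X : Idx) : Good X.letters := by
  have hI : ∀ s : Multiset ℕ, (s.sort (· ≥ ·)).Pairwise (· ≥ ·) := fun s => s.pairwise_sort _
  have hK : ∀ s : Finset ℕ, (s.sort (· ≥ ·)).Pairwise (· > ·) := fun s => by
    exact s.sortedGT_sort.pairwise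
  constructor
  · simp only [Idx.letters, List.pairwise_append, List.pairwise_map, List.mem_append, List.mem_map]
    have bL : ∀ n : ℕ, (Gen.L (-((n : ℤ) + 2))).blk = 0 := fun n => if_pos (by omega)
    have bT : ∀ n : ℕ, (Gen.T (-((n : ℤ) + 1))).blk = 1 := fun n => if_pos (by omega)
    have bP : ∀ n : ℕ, (Gen.Gp (-((n : ℤ) + 1))).blk = 2 := fun n => if_pos (by omega)
    have bM : ∀ n : ℕ, (Gen.Gm (-((n : ℤ) + 1))).blk = 3 := fun n => if_pos (by omega)
    have lt : ∀ {x y : Gen}, x < y → x ≤ y ∧ (x = y → x.odd = false) :=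
      fun h => ⟨h.le, fun h' => absurd h' h.ne⟩
    refine ⟨⟨⟨(hI _).imp fun {a b} h => ⟨?_, fun _ => rfl⟩,
      (hI _).imp fun {a b} h => ⟨?_, fun _ => rfl⟩, ?_⟩,
      (hK _).imp fun {a b} h => lt ?_, ?_⟩, (hK _).imp fun {a b} h => lt ?_, ?_⟩
    · rintro _ ⟨a, -, rfl⟩ _ ⟨b, -, rfl⟩
      exact lt (Gen.lt_iff.2 (Or.inl (by rw [bL, bT]; decide)))
    · exact Gen.lt_iff.2 (Or.inr ⟨by rw [bP, bP], by simp only [Gen.md]; omega⟩)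
    · rintro _ (⟨a, -, rfl⟩ | ⟨a, -, rfl⟩) _ ⟨b, -, rfl⟩
      · exact lt (Gen.lt_iff.2 (Or.inl (by rw [bL, bP]; decide)))
      · exact lt (Gen.lt_iff.2 (Or.inl (by rw [bT, bP]; decide)))
    · exact Gen.lt_iff.2 (Or.inr ⟨by rw [bM, bM], by simp only [Gen.md]; omega⟩)
    · rintro _ ((⟨a, -, rfl⟩ | ⟨a, -, rfl⟩) | ⟨a, -, rfl⟩) _ ⟨b, -, rfl⟩
      · exact lt (Gen.lt_iff.2 (Or.inl (by rw [bL, bM]; decide)))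
      · exact lt (Gen.lt_iff.2 (Or.inl (by rw [bT, bM]; decide)))
      · exact lt (Gen.lt_iff.2 (Or.inl (by rw [bP, bM]; decide)))
    · rcases (show b ≤ a from h).eq_or_lt with rfl | h
      · exact le_rfl
      · exact (Gen.lt_iff.2 (Or.inr ⟨by rw [bL, bL], by simp only [Gen.md]; omega⟩)).le
    · rcases (show b ≤ a from h).eq_or_lt with rfl | h
      · exact le_rfl
      · exact (Gen.lt_iff.2 (Or.inr ⟨by rw [bT, bT], by simp only [Gen.md]; omega⟩)).le
  · intro x hx
    simp only [Idx.letters, List.mem_append, List.mem_map] at hx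
    rcases hx with ((⟨n, -, rfl⟩ | ⟨n, -, rfl⟩) | ⟨n, -, rfl⟩) | ⟨n, -, rfl⟩ <;>
      simp only [Gen.Tail] <;> omega

theorem exists_lettersM {l : List Gen} (h : ∀ x ∈ l, ¬ x.Tail)
    (h' : l.Pairwise fun x y => x = y → x.odd = false) : ∃ X : Idx, X.lettersM = ↑l := by
  induction l with
  | nil => exact ⟨idxOne, by simp [Idx.lettersM, idxOne]⟩
  | cons x l ih =>
    obtain ⟨X, hX⟩ := ih (fun y hy => h y (by simp [hy])) (List.pairwise_cons.1 h').2
    have hx := h x (by simp)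
    have hx' : x.odd = true → x ∉ l := fun ho hl => by
      have := (List.pairwise_cons.1 h').1 x hl rfl
      simp [ho] at this
    have hl : ∀ y : Gen, y ∈ l ↔ y ∈ X.lettersM := fun y => by rw [hX]; rfl
    rw [← Multiset.cons_coe, ← hX]
    cases x with
    | L n =>
      obtain ⟨k, rfl⟩ : ∃ k : ℕ, n = -((k : ℤ) + 2) := ⟨(-n - 2).toNat, by
        simp only [Gen.Tail] at hx; omega⟩
      exact ⟨⟨k ::ₘ X.I, X.J, X.Kp, X.Km⟩, by simp [Idx.lettersM]⟩
    | T n =>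
      obtain ⟨k, rfl⟩ : ∃ k : ℕ, n = -((k : ℤ) + 1) := ⟨(-n - 1).toNat, by
        simp only [Gen.Tail] at hx; omega⟩
      exact ⟨⟨X.I, k ::ₘ X.J, X.Kp, X.Km⟩, by simp [Idx.lettersM]⟩
    | Gp n =>
      obtain ⟨k, rfl⟩ : ∃ k : ℕ, n = -((k : ℤ) + 1) := ⟨(-n - 1).toNat, by
        simp only [Gen.Tail] at hx; omega⟩
      have hk : k ∉ X.Kp := fun hk => hx' rfl ((hl _).2 (by simp [Idx.lettersM, hk]))
      exact ⟨⟨X.I, X.J, X.Kp.cons k hk, X.Km⟩, by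
        simp only [Idx.lettersM, Finset.cons_val, Multiset.map_cons, Multiset.add_cons, Multiset.cons_add]⟩
    | Gm n =>
      obtain ⟨k, rfl⟩ : ∃ k : ℕ, n = -((k : ℤ) + 1) := ⟨(-n - 1).toNat, by
        simp only [Gen.Tail] at hx; omega⟩
      have hk : k ∉ X.Km := fun hk => hx' rfl ((hl _).2 (by simp [Idx.lettersM, hk]))
      exact ⟨⟨X.I, X.J, X.Kp, X.Km.cons k hk⟩, by
        simp only [Idx.lettersM, Finset.cons_val, Multiset.map_cons, Multiset.add_cons, Multiset.cons_add]⟩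
    | C => exact absurd trivial hx

/-- A sorted word is determined by its multiset of letters. Together with `good_of_not_red` and
`Good.not_red`, this identifies the irreducible words with the ordered monomials. -/
theorem Good.exists_letters {l : List Gen} (h : Good l) : ∃ X : Idx, X.letters = l := by
  obtain ⟨X, hX⟩ := exists_lettersM h.2 (h.1.imp fun h => h.2)
  refine ⟨X, ?_⟩
  have hp : X.letters.Perm l := Multiset.coe_eq_coe.1 (X.coe_letters.trans hX)
  exact hp.eq_of_pairwise (le := (· ≤ ·)) (fun a b _ _ h1 h2 => le_antisymm h1 h2)
    (X.good_letters.1.imp fun h => h.1) (h.1.imp fun h => h.1)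

theorem Idx.letters_injective : Function.Injective Idx.letters := fun X Y h =>
  Idx.lettersM_injective (by rw [← X.coe_letters, ← Y.coe_letters, h])

/-! ### The basis of the extended Verma module -/

/-- The span of all rewriting relations. -/
def relSpan (ω : Weight) : Submodule ℂ WMod :=
  Submodule.span ℂ {f | ∃ w ρ, Red ω w ρ ∧ f = Finsupp.single w 1 - ρ}

theorem relBelow_le (ω : Weight) (l : List Gen) : relBelow ω l ≤ relSpan ω := by
  refine Submodule.span_mono ?_
  rintro f ⟨w, ρ, h1, -, rfl⟩
  exact ⟨w, ρ, h1, rfl⟩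

theorem Red.mem_relSpan {ω : Weight} {l : List Gen} {b : ℂ} {ρ : WMod} (h : Red ω (l, b) ρ) :
    wd l b - ρ ∈ relSpan ω := Submodule.subset_span ⟨_, _, h, rfl⟩

/-- Words modulo the rewriting relations. -/
abbrev WQ (ω : Weight) : Type := WMod ⧸ relSpan ω

/-- The class of a word. -/
def wq (ω : Weight) (l : List Gen) (b : ℂ) : WQ ω := Submodule.Quotient.mk (wd l b)

theorem relSpan_le_comap (ω : Weight) (g : Gen) : relSpan ω ≤ (relSpan ω).comap (consL g) := by
  refine Submodule.span_le.2 ?_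
  rintro _ ⟨⟨l, b⟩, ρ, h, rfl⟩
  have := (h.cons g).mem_relSpan
  rwa [SetLike.mem_coe, Submodule.mem_comap, map_sub,
    show consL g (Finsupp.single (l, b) 1) = wd (g :: l) b from consL_wd g l b]

/-- The action of a generator on classes of words. -/
def opQ (ω : Weight) (g : Gen) : Module.End ℂ (WQ ω) :=
  (relSpan ω).mapQ (relSpan ω) (consL g) (relSpan_le_comap ω g)

theorem opQ_wq (ω : Weight) (g : Gen) (l : List Gen) (b : ℂ) :
    opQ ω g (wq ω l b) = wq ω (g :: l) b := by
  rw [opQ, wq, Submodule.mapQ_apply, consL_wd, wq]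

theorem opQ_exch (ω : Weight) : Exch (opQ ω) := by
  intro x y
  refine Submodule.linearMap_qext _ (Finsupp.lhom_ext' fun ⟨l, b⟩ => LinearMap.ext_ring ?_)
  change (opQ ω x * opQ ω y) (wq ω l b) = (sgn x y • (opQ ω y * opQ ω x) + brk (opQ ω) x y) (wq ω l b)
  have e := map_brk (LinearMap.applyₗ (wq ω l b) : (Module.End ℂ (WQ ω)) →ₗ[ℂ] WQ ω) (opQ ω) x y
  simp only [LinearMap.applyₗ_apply_apply, opQ_wq] at e
  simp only [LinearMap.add_apply, LinearMap.smul_apply, Module.End.mul_apply, opQ_wq, e]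
  -- The bound only has to be some longer word, so that both orders lie below it; the appended
  -- letter is arbitrary.
  have h := relBelow_le ω _ (exch_mem (ω := ω) (x := x) (y := y) (v := l)
    (l := x :: y :: l ++ [x]) b (Below.of_length (by simp)) (Below.of_length (by simp)))
  rw [exch, sub_sub] at h
  have h' := (Submodule.Quotient.eq _).2 h
  rw [Submodule.Quotient.mk_add, Submodule.Quotient.mk_smul] at h'
  refine h'.trans (congrArg _ ?_)
  exact map_brk (relSpan ω).mkQ _ x y

/-- The representation of the enveloping algebra on classes of words. -/
def repQ (ω : Weight) : U →ₐ[ℂ] Module.End ℂ (WQ ω) :=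
  RingQuot.liftAlgHom ℂ ⟨FreeAlgebra.lift ℂ (opQ ω), fun _ _ h =>
    rel_of_exch _ (by
      have : (fun g => FreeAlgebra.lift ℂ (opQ ω) (fr g)) = opQ ω :=
        funext fun g => FreeAlgebra.lift_ι_apply _ _
      rw [this]; exact opQ_exch ω) h⟩

theorem repQ_gen (ω : Weight) (g : Gen) : repQ ω (gen g) = opQ ω g := by
  have : repQ ω (gen g) = FreeAlgebra.lift ℂ (opQ ω) (fr g) :=
    RingQuot.liftAlgHom_mkAlgHom_apply _ _ _ _
  rw [this]
  exact FreeAlgebra.lift_ι_apply _ _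

theorem repQ_word (ω : Weight) (l l' : List Gen) (b : ℂ) :
    repQ ω (word l) (wq ω l' b) = wq ω (l ++ l') b := by
  induction l with
  | nil => simp
  | cons x l ih => rw [word_cons, map_mul, Module.End.mul_apply, ih, repQ_gen, opQ_wq, List.cons_append]

/-- Evaluation of the free module of symbols on classes of words. -/
def toWQ (ω : Weight) : (ℂ →₀ U) →ₗ[ℂ] WQ ω :=
  Finsupp.lsum ℂ fun b => (LinearMap.applyₗ (wq ω [] b)) ∘ₗ (repQ ω).toLinearMap

theorem toWQ_single (ω : Weight) (b : ℂ) (u : U) :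
    toWQ ω (Finsupp.single b u) = repQ ω u (wq ω [] b) := by
  simp [toWQ]

theorem toWQ_smul (ω : Weight) (u : U) (f : ℂ →₀ U) : toWQ ω (u • f) = repQ ω u (toWQ ω f) := by
  induction f using Finsupp.induction_linear with
  | zero => simp
  | add f g hf hg => rw [smul_add, map_add, map_add, map_add, hf, hg]
  | single b v => 
    rw [Finsupp.smul_single, smul_eq_mul, toWQ_single, toWQ_single, map_mul, Module.End.mul_apply]

theorem toWQ_gen_sym (ω : Weight) (g : Gen) (b : ℂ) : toWQ ω (gen g • sym b) = wq ω [g] b := by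
  rw [toWQ_smul, sym, toWQ_single, map_one, Module.End.one_apply, repQ_gen, opQ_wq]

theorem wq_tail (ω : Weight) {x : Gen} (h : x.Tail) (b : ℂ) :
    wq ω [x] b = (relSpan ω).mkQ (act ω x b) :=
  (Submodule.Quotient.eq _).2 (Red.tail h b).mem_relSpan

theorem toWQ_vermaRels {ω : Weight} {f : ℂ →₀ U} (hf : f ∈ vermaRels ω) : toWQ ω f = 0 := by
  have hs : ∀ (c b : ℂ), toWQ ω (c • sym b) = (relSpan ω).mkQ (c • wd [] b) := fun c b => by
    rw [map_smul, map_smul, sym, toWQ_single, map_one]; rfl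
  have hg : ∀ (c b : ℂ) (g : Gen), toWQ ω (c • (gen g • sym b)) = (relSpan ω).mkQ (c • wd [g] b) :=
    fun c b g => by
      rw [LinearMap.map_smul, LinearMap.map_smul, toWQ_gen_sym]; rfl
  obtain ⟨a, rfl | rfl | ⟨m, rfl | rfl | rfl | rfl⟩⟩ := hf
  · rw [map_sub, toWQ_gen_sym, wq_tail ω (by simp [Gen.Tail]), ← one_smul ℂ (sym (a + 1)), hs, act]
    simp [fall_zero, sub_neg_eq_add]
  · rw [map_sub, toWQ_gen_sym, wq_tail ω (by simp [Gen.Tail]), hs, act, sub_self]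
  · rw [map_sub, toWQ_gen_sym, wq_tail ω (by simp only [Gen.Tail]; omega), hs,
      act_L (i := m + 1) (by simp) (e := a - m) (by push_cast; ring), Nat.add_sub_cancel, sub_eq_zero]
    push_cast; rfl
  · rw [map_sub, toWQ_gen_sym, wq_tail ω (by simp [Gen.Tail]), hs, act_T rfl rfl, sub_self]
  · rw [map_sub, toWQ_gen_sym, wq_tail ω (by simp [Gen.Tail]), hg, act_Gp rfl rfl, sub_self]
  · rw [map_sub, toWQ_gen_sym, wq_tail ω (by simp [Gen.Tail]), hg, act_Gm rfl rfl, sub_self]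

/-- The map from the extended Verma module to words modulo the rewriting relations. -/
def vermaToWQ (ω : Weight) : Verma ω →ₗ[ℂ] WQ ω :=
  (((Submodule.span U (vermaRels ω)).restrictScalars ℂ).liftQ (toWQ ω) (by
    intro f hf
    rw [Submodule.restrictScalars_mem] at hf
    induction hf using Submodule.span_induction with
    | mem f hf => exact toWQ_vermaRels hf
    | zero => exact Submodule.zero_mem _
    | add f g _ _ hf hg => exact Submodule.add_mem _ hf hg
    | smul u f _ hf => rw [LinearMap.mem_ker] at hf ⊢; rw [toWQ_smul, hf, map_zero])) ∘ₗ
    { (Submodule.Quotient.restrictScalarsEquiv ℂ (Submodule.span U (vermaRels ω))).symm.toLinearMap with }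

theorem word_smul_sym (l : List Gen) (b : ℂ) : word l • sym b = Finsupp.single b (word l) := by
  simp [sym]

theorem vermaToWQ_word (ω : Weight) (l : List Gen) (b : ℂ) :
    vermaToWQ ω (word l • vec ω b) = wq ω l b := by
  have : vermaToWQ ω (word l • vec ω b) = toWQ ω (word l • sym b) := rfl
  rw [this, word_smul_sym, toWQ_single, repQ_word, List.append_nil]

/-- Passing to words modulo the rules and then to normal forms sends these vectors to distinct
single words. -/
theorem linearIndependent_mono (ω : Weight) :
    LinearIndependent ℂ fun p : Idx × ℂ => mono p.1 • vec ω p.2 := by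
  obtain ⟨N, hN, hN'⟩ := exists_nf ω
  let F : WQ ω →ₗ[ℂ] WMod := (relSpan ω).liftQ N (by
    refine Submodule.span_le.2 ?_
    rintro _ ⟨w, ρ, h, rfl⟩
    rw [SetLike.mem_coe, LinearMap.mem_ker, map_sub, hN w ρ h, sub_self])
  have h : ∀ p : Idx × ℂ, (F ∘ₗ vermaToWQ ω) (mono p.1 • vec ω p.2)
      = Finsupp.single (p.1.letters, p.2) 1 := by
    intro p
    rw [LinearMap.comp_apply, mono_eq_word, vermaToWQ_word]
    exact hN' _ fun ⟨ρ, hρ⟩ => Good.not_red hρ p.1.good_letters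
  refine LinearIndependent.of_comp (F ∘ₗ vermaToWQ ω) ?_
  have e : (F ∘ₗ vermaToWQ ω) ∘ (fun p : Idx × ℂ => mono p.1 • vec ω p.2)
      = (fun w : List Gen × ℂ => (Finsupp.single w 1 : WMod)) ∘ fun p : Idx × ℂ => (p.1.letters, p.2) :=
    funext h
  rw [e]
  refine LinearIndependent.comp (Finsupp.linearIndependent_single_one ℂ _) _ ?_
  rintro ⟨X, a⟩ ⟨Y, b⟩ h
  simp only [Prod.mk.injEq] at h
  rw [Idx.letters_injective h.1, h.2]

/-! ### Rewriting of words in modules -/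

/-- The word and the exponent resulting from the action of a letter on a symbol. -/
def tailOut : Gen → ℂ → List Gen × ℂ
  | .L n, b => ([], b - n)
  | .T n, b => ([], b - n)
  | .Gp n, b => ([.Gp (-1)], b - (n + 1))
  | .Gm n, b => ([.Gm (-1)], b - (n + 1))
  | .C, b => ([], b)

theorem act_eq_smul (ω : Weight) (x : Gen) (b : ℂ) :
    ∃ c : ℂ, act ω x b = c • wd (tailOut x b).1 (tailOut x b).2 := by
  cases x <;> exact ⟨_, rfl⟩

/-- Multiplication of words by a word from the left. -/
def consList (u : List Gen) : WMod →ₗ[ℂ] WMod := Finsupp.lmapDomain ℂ ℂ fun w => (u ++ w.1, w.2)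

theorem consL_consList (x : Gen) (u : List Gen) (f : WMod) :
    consL x (consList u f) = consList (x :: u) f := by
  induction f using Finsupp.induction_linear with
  | zero => simp
  | add f g hf hg => simp only [map_add, hf, hg]
  | single w c => simp [consL, consList]

theorem consList_nil (f : WMod) : consList [] f = f := by
  induction f using Finsupp.induction_linear with
  | zero => simp
  | add f g hf hg => simp only [map_add, hf, hg]
  | single w c => simp [consList]

theorem Red.split {ω : Weight} {l : List Gen} {b : ℂ} {ρ : WMod} (h : Red ω (l, b) ρ) :
    ∃ u, (∃ x y v, y < x ∧ l = u ++ x :: y :: v ∧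
        ρ = sgn x y • wd (u ++ y :: x :: v) b + brk (fun g => wd (u ++ g :: v) b) x y) ∨
      (∃ x v, x.odd = true ∧ l = u ++ x :: x :: v ∧ ρ = 0) ∨
      (∃ x, x.Tail ∧ l = u ++ [x] ∧ ρ = consList u (act ω x b)) := by
  generalize hw : (l, b) = w at h
  induction h generalizing l with
  | @swap x y h v b => 
    cases hw
    exact ⟨[], Or.inl ⟨x, y, v, h, rfl, rfl⟩⟩
  | @sq x h v b => 
    cases hw
    exact ⟨[], Or.inr (Or.inl ⟨x, v, h, rfl, rfl⟩)⟩
  | @tail x h b => 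
    cases hw
    exact ⟨[], Or.inr (Or.inr ⟨x, h, rfl, (consList_nil _).symm⟩)⟩
  | @cons z v b ρ h ih =>
    cases hw
    obtain ⟨u, ⟨x, y, v, hx, rfl, rfl⟩ | ⟨x, v, hx, rfl, rfl⟩ | ⟨x, hx, rfl, rfl⟩⟩ := ih rfl
    · refine ⟨z :: u, Or.inl ⟨x, y, v, hx, rfl, ?_⟩⟩
      simp only [map_add, map_smul, consL_wd, map_brk, List.cons_append]
    · exact ⟨z :: u, Or.inr (Or.inl ⟨x, v, hx, rfl, map_zero _⟩)⟩
    · exact ⟨z :: u, Or.inr (Or.inr ⟨x, hx, rfl, consL_consList _ _ _⟩)⟩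

section

variable {M : Type*} [AddCommGroup M] [Module U M] [Module ℂ M]

/-- Evaluation of words on a family of vectors. -/
def ev (e : ℂ → M) : WMod →ₗ[ℂ] M := Finsupp.linearCombination ℂ fun w => word w.1 • e w.2

@[simp] theorem ev_wd (e : ℂ → M) (l : List Gen) (b : ℂ) : ev e (wd l b) = word l • e b := by
  simp [ev, wd]

variable [IsScalarTower ℂ U M]

theorem smul_comm_U (c : ℂ) (u : U) (m : M) : u • c • m = c • u • m := by
  rw [← one_smul U m, ← smul_assoc c (1 : U) m, ← mul_smul, ← mul_smul, ← smul_assoc]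
  simp

theorem word_exchange (u v : List Gen) (x y : Gen) :
    word (u ++ x :: y :: v) = sgn x y • word (u ++ y :: x :: v)
      + brk (fun g => word (u ++ g :: v)) x y := by
  have h := map_brk ((LinearMap.mulLeft ℂ (word u)) ∘ₗ (LinearMap.mulRight ℂ (word v))) gen x y
  simp only [LinearMap.comp_apply, LinearMap.mulLeft_apply, LinearMap.mulRight_apply] at h
  simp only [word_append, word_cons, ← h]
  rw [← mul_assoc (gen x), gen_exch x y, add_mul, mul_add, smul_mul_assoc, mul_smul_comm, mul_assoc]

/-- A property of words with exponents that is stable under rewriting. -/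
structure Tracked (P : List Gen → ℂ → Prop) : Prop where
  swap {u v : List Gen} {x y : Gen} {b : ℂ} (h : P (u ++ x :: y :: v) b) (hxy : y < x) :
    P (u ++ y :: x :: v) b
  brk {u v : List Gen} {x y g : Gen} {b : ℂ} (h : P (u ++ x :: y :: v) b) (hxy : y < x)
    (hg : Occ x y g) : P (u ++ g :: v) b
  tail {u : List Gen} {x : Gen} {b : ℂ} (h : P (u ++ [x]) b) (hx : x.Tail) :
    P (u ++ (tailOut x b).1) (tailOut x b).2

theorem Tracked.true : Tracked fun _ _ => True := ⟨fun _ _ => trivial, fun _ _ _ => trivial,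
  fun _ _ => trivial⟩

theorem below_append {l l' : List Gen} (u : List Gen) (h : Below l' l) :
    Below (u ++ l') (u ++ l) := by
  induction u with
  | nil => exact h
  | cons z u ih => exact ih.cons z

theorem below_tailOut {x : Gen} (hx : x.Tail) (b : ℂ) : Below (tailOut x b).1 [x] := by
  cases x with
  | Gp n =>
    refine Or.inr (Or.inl ⟨rfl, ?_⟩)
    have h : 0 ≤ n := hx
    simp [tailOut, pcount, Gen.oddRaising, h]
  | Gm n =>
    refine Or.inr (Or.inl ⟨rfl, ?_⟩)
    have h : 0 ≤ n := hx
    simp [tailOut, pcount, Gen.oddRaising, h]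
  | _ => exact Below.of_length (by simp [tailOut])

/-- To show that words with a tracked property lie in a subspace, it is enough to consider the
ordered monomials and the words ending in a letter of the highest weight conditions. -/
theorem Tracked.mem_of_tail {P : List Gen → ℂ → Prop} (hP : Tracked P) {e : ℂ → M}
    {S : Submodule ℂ M}
    (hT : ∀ u x b, x.Tail → P (u ++ [x]) b →
      (∀ l' b', P l' b' → Below l' (u ++ [x]) → word l' • e b' ∈ S) → word (u ++ [x]) • e b ∈ S)
    (hS : ∀ X b, P (Idx.letters X) b → mono X • e b ∈ S)
    {l : List Gen} {b : ℂ} (h : P l b) : word l • e b ∈ S := by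
  induction l using below_wf.induction generalizing b with
  | _ l ih =>
    -- Whether a word is reducible, and its exchange reducts, do not depend on the weight, so any
    -- weight serves. The rule for tail letters, the only one that sees the weight, is delegated to
    -- `hT`.
    by_cases hr : ∃ ρ, Red ⟨0, 0, 0⟩ (l, b) ρ
    · obtain ⟨ρ, hρ⟩ := hr
      obtain ⟨u, ⟨x, y, v, hx, rfl, rfl⟩ | ⟨x, v, hx, rfl, rfl⟩ | ⟨x, hx, rfl, rfl⟩⟩ := hρ.split
      · have hB : ∀ g, Below (u ++ g :: v) (u ++ x :: y :: v) :=
          fun g => Below.of_length (by simp)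
        have hB' : Below (u ++ y :: x :: v) (u ++ x :: y :: v) :=
          below_append u (Below.swap hx v)
        have e1 := map_brk ((LinearMap.toSpanSingleton U M (e b)).restrictScalars ℂ)
            (fun g => word (u ++ g :: v)) x y
        simp only [LinearMap.restrictScalars_apply, LinearMap.toSpanSingleton_apply] at e1
        rw [word_exchange, add_smul, smul_assoc, e1]
        exact S.add_mem (S.smul_mem _ (ih _ hB' (hP.swap h hx)))
          (brk_mem _ _ _ _ fun g hg => ih _ (hB g) (hP.brk h hx hg))
      · rw [word_append, word_cons, word_cons, ← mul_assoc (gen x), gen_sq hx]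
        simp
      · exact hT u x b hx h fun l' b' hl' hb => ih l' hb hl'
    · obtain ⟨X, rfl⟩ := (good_of_not_red hr).exists_letters
      rw [← mono_eq_word]
      exact hS X b h

/-- To show that words with a tracked property lie in a subspace, it is enough to consider the
ordered monomials. -/
theorem Tracked.mem {P : List Gen → ℂ → Prop} (hP : Tracked P) {ω : Weight} {e : ℂ → M}
    (he : ∀ u x b, x.Tail → P (u ++ [x]) b → ev e (act ω x b) = gen x • e b)
    {S : Submodule ℂ M} (hS : ∀ X b, P (Idx.letters X) b → mono X • e b ∈ S)
    {l : List Gen} {b : ℂ} (h : P l b) : word l • e b ∈ S := by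
  refine hP.mem_of_tail (fun u x b hx hu ih => ?_) hS h
  obtain ⟨c, hc⟩ := act_eq_smul ω x b
  rw [word_append, mul_smul, word_cons, word_nil, mul_one, ← he u x b hx hu, hc, map_smul, ev_wd,
    smul_comm_U, ← mul_smul, ← word_append]
  exact S.smul_mem _ (ih _ _ (hP.tail hu hx) (below_append u (below_tailOut hx b)))

end

/-! ### The basis of the extended Verma module -/

theorem vec_rel {ω : Weight} {f g : ℂ →₀ U} (h : f - g ∈ vermaRels ω) :
    (Submodule.Quotient.mk f : Verma ω) = Submodule.Quotient.mk g :=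
  (Submodule.Quotient.eq _).2 (Submodule.subset_span h)

theorem vec_L_neg (ω : Weight) (b : ℂ) : gen (.L (-1)) • vec ω b = vec ω (b + 1) :=
  vec_rel ⟨b, Or.inl rfl⟩

theorem vec_C (ω : Weight) (b : ℂ) : gen .C • vec ω b = ω.c • vec ω b :=
  vec_rel ⟨b, Or.inr (Or.inl rfl)⟩

theorem vec_L (ω : Weight) (b : ℂ) (m : ℕ) : gen (.L m) • vec ω b =
    ((m + 1) * fall b m * ω.h + fall b (m + 1)) • vec ω (b - m) :=
  vec_rel ⟨b, Or.inr (Or.inr ⟨m, Or.inl rfl⟩)⟩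

theorem vec_T (ω : Weight) (b : ℂ) (m : ℕ) : gen (.T m) • vec ω b =
    (fall b m * ω.q) • vec ω (b - m) :=
  vec_rel ⟨b, Or.inr (Or.inr ⟨m, Or.inr (Or.inl rfl)⟩)⟩

theorem vec_Gp (ω : Weight) (b : ℂ) (m : ℕ) : gen (.Gp m) • vec ω b =
    fall b (m + 1) • gen (.Gp (-1)) • vec ω (b - (m + 1)) :=
  vec_rel ⟨b, Or.inr (Or.inr ⟨m, Or.inr (Or.inr (Or.inl rfl))⟩)⟩

theorem vec_Gm (ω : Weight) (b : ℂ) (m : ℕ) : gen (.Gm m) • vec ω b =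
    fall b (m + 1) • gen (.Gm (-1)) • vec ω (b - (m + 1)) :=
  vec_rel ⟨b, Or.inr (Or.inr ⟨m, Or.inr (Or.inr (Or.inr rfl))⟩)⟩

theorem ev_act_L_neg {M : Type*} [AddCommGroup M] [Module U M] [Module ℂ M] (ω : Weight) (e : ℂ → M)
    (b : ℂ) : ev e (act ω (.L (-1)) b) = e (b + 1) := by
  rw [act_L (i := 0) (n := -1) (by simp) (e := b + 1) (by simp)]
  simp [fall_zero]

theorem ev_act (ω : Weight) {x : Gen} (hx : x.Tail) (b : ℂ) :
    ev (vec ω) (act ω x b) = gen x • vec ω b := by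
  cases x with
  | L n =>
    rcases eq_or_ne n (-1) with rfl | hn
    · rw [ev_act_L_neg, vec_L_neg]
    · obtain ⟨m, rfl⟩ := Int.eq_ofNat_of_zero_le (show 0 ≤ n by simp only [Gen.Tail] at hx; omega)
      rw [vec_L, act_L (i := m + 1) (by simp) (e := b - m) (by push_cast; ring), Nat.add_sub_cancel,
        map_smul, ev_wd, word_nil, one_smul]
      push_cast; rfl
  | T n =>
    obtain ⟨m, rfl⟩ := Int.eq_ofNat_of_zero_le hx
    rw [vec_T, act_T rfl rfl, map_smul, ev_wd, word_nil, one_smul]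
  | Gp n =>
    obtain ⟨m, rfl⟩ := Int.eq_ofNat_of_zero_le hx
    rw [vec_Gp, act_Gp rfl rfl, map_smul, ev_wd, word_cons, word_nil, mul_one]
  | Gm n =>
    obtain ⟨m, rfl⟩ := Int.eq_ofNat_of_zero_le hx
    rw [vec_Gm, act_Gm rfl rfl, map_smul, ev_wd, word_cons, word_nil, mul_one]
  | C => rw [vec_C, act, map_smul, ev_wd, word_nil, one_smul]

theorem Tracked.mem_verma {P : List Gen → ℂ → Prop} (hP : Tracked P) {ω : Weight}
    {S : Submodule ℂ (Verma ω)} (hS : ∀ X b, P (Idx.letters X) b → mono X • vec ω b ∈ S)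
    {l : List Gen} {b : ℂ} (h : P l b) : word l • vec ω b ∈ S :=
  hP.mem (fun _ _ b hx _ => ev_act ω hx b) hS h

theorem U_induction {p : U → Prop} (h1 : ∀ c : ℂ, p (algebraMap ℂ U c)) (hg : ∀ g, p (gen g))
    (ha : ∀ u v, p u → p v → p (u + v)) (hm : ∀ u v, p u → p v → p (u * v)) (u : U) : p u := by
  obtain ⟨f, rfl⟩ := RingQuot.mkAlgHom_surjective ℂ Rel u
  induction f using FreeAlgebra.induction with
  | grade0 c => rw [AlgHom.commutes]; exact h1 c
  | grade1 g => exact hg g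
  | mul a b ha hb => rw [map_mul]; exact hm _ _ ha hb
  | add a b h h' => rw [map_add]; exact ha _ _ h h'

theorem mem_span_word (u : U) : u ∈ Submodule.span ℂ (Set.range word) := by
  induction u using U_induction with
  | h1 c =>
    rw [Algebra.algebraMap_eq_smul_one]
    exact Submodule.smul_mem _ _ (Submodule.subset_span ⟨[], rfl⟩)
  | hg g => exact Submodule.subset_span ⟨[g], by simp⟩
  | ha u v hu hv => exact Submodule.add_mem _ hu hv
  | hm u v hu hv =>
    have := Submodule.mul_mem_mul hu hv
    rw [Submodule.span_mul_span] at this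
    refine Submodule.span_mono (t := Set.range word) ?_ this
    rintro _ ⟨_, ⟨l, rfl⟩, _, ⟨l', rfl⟩, rfl⟩
    exact ⟨l ++ l', word_append _ _⟩

theorem mk_single (ω : Weight) (b : ℂ) (u : U) :
    (Submodule.Quotient.mk (Finsupp.single b u) : Verma ω) = u • vec ω b := by
  rw [vec, ← Submodule.Quotient.mk_smul, sym, Finsupp.smul_single, smul_eq_mul, mul_one]

theorem span_mono_vec (ω : Weight) :
    ⊤ ≤ Submodule.span ℂ (Set.range fun p : Idx × ℂ => mono p.1 • vec ω p.2) := by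
  rintro v -
  obtain ⟨f, rfl⟩ := Submodule.Quotient.mk_surjective _ v
  induction f using Finsupp.induction_linear with
  | zero => exact Submodule.zero_mem _
  | add f g hf hg => exact Submodule.add_mem _ hf hg
  | single b u =>
    rw [mk_single]
    have h : Submodule.span ℂ (Set.range word) ≤ (Submodule.span ℂ (Set.range
        fun p : Idx × ℂ => mono p.1 • vec ω p.2)).comap
        ((LinearMap.toSpanSingleton U (Verma ω) (vec ω b)).restrictScalars ℂ) := by
      rw [Submodule.span_le]
      rintro _ ⟨l, rfl⟩
      exact Tracked.true.mem_verma (S := Submodule.span ℂ (Set.range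
        fun p : Idx × ℂ => mono p.1 • vec ω p.2))
        (fun X b _ => Submodule.subset_span ⟨(X, b), rfl⟩) trivial
    exact h (mem_span_word u)

/-- The basis of the extended Verma module by ordered monomials. -/
def vb (ω : Weight) : Module.Basis (Idx × ℂ) ℂ (Verma ω) :=
  Module.Basis.mk (linearIndependent_mono ω) (span_mono_vec ω)

theorem vb_apply (ω : Weight) (X : Idx) (b : ℂ) : vb ω (X, b) = mono X • vec ω b :=
  Module.Basis.mk_apply _ _ _

/-! ### Filtrations of the extended Verma module -/

/-- The span of the basis vectors with index in a given set. -/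
def supp (ω : Weight) (s : Set (Idx × ℂ)) : Submodule ℂ (Verma ω) :=
  (Finsupp.supported ℂ ℂ s).comap (vb ω).repr.toLinearMap

theorem mono_vec_mem_supp {ω : Weight} {s : Set (Idx × ℂ)} {X : Idx} {b : ℂ} (h : (X, b) ∈ s) :
    mono X • vec ω b ∈ supp ω s := by
  rw [supp, Submodule.mem_comap, ← vb_apply]
  simpa using Finsupp.single_mem_supported ℂ (1 : ℂ) h

theorem mem_supp_iff {ω : Weight} {s : Set (Idx × ℂ)} {v : Verma ω} :
    v ∈ supp ω s ↔ ∀ p, (vb ω).repr v p ≠ 0 → p ∈ s := by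
  rw [supp, Submodule.mem_comap, Finsupp.mem_supported]
  simp [Set.subset_def]

theorem supp_le {ω : Weight} {s : Set (Idx × ℂ)} {S : Submodule ℂ (Verma ω)}
    (h : ∀ X b, (X, b) ∈ s → mono X • vec ω b ∈ S) : supp ω s ≤ S := by
  intro v hv
  rw [← (vb ω).linearCombination_repr v, Finsupp.linearCombination_apply]
  refine Submodule.sum_mem _ fun p hp => Submodule.smul_mem _ _ ?_
  rw [vb_apply]
  exact h _ _ (mem_supp_iff.1 hv p (Finsupp.mem_support_iff.1 hp))

theorem supp_mono {ω : Weight} {s t : Set (Idx × ℂ)} (h : s ⊆ t) : supp ω s ≤ supp ω t :=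
  supp_le fun _ _ hs => mono_vec_mem_supp (h hs)

theorem supp_inter {ω : Weight} {s t : Set (Idx × ℂ)} {v : Verma ω} (h : v ∈ supp ω s)
    (h' : v ∈ supp ω t) : v ∈ supp ω (s ∩ t) :=
  mem_supp_iff.2 fun p hp => ⟨mem_supp_iff.1 h p hp, mem_supp_iff.1 h' p hp⟩

theorem order_eq_supp (ω : Weight) (b : ℂ) :
    order (vec ω) b = supp ω {p | ∃ k : ℕ, p.2 = b - (k : ℂ) / 2} := by
  apply le_antisymm
  · refine Submodule.span_le.2 ?_
    rintro _ ⟨X, k, rfl⟩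
    exact mono_vec_mem_supp ⟨k, rfl⟩
  · refine supp_le ?_
    rintro X _ ⟨k, rfl⟩
    exact Submodule.subset_span ⟨X, k, rfl⟩

/-- Linear multiplication by an element of the enveloping algebra. -/
def mulU (ω : Weight) (u : U) : Verma ω →ₗ[ℂ] Verma ω where
  toFun v := u • v
  map_add' := smul_add u
  map_smul' c v := smul_comm_U c u v

@[simp] theorem mulU_apply (ω : Weight) (u : U) (v : Verma ω) : mulU ω u v = u • v := rfl

theorem Tracked.supp_smul {P : List Gen → ℂ → Prop} (hP : Tracked P) {ω : Weight}
    {s t : Set (Idx × ℂ)} {l : List Gen} (h : ∀ X b, (X, b) ∈ s → P (l ++ Idx.letters X) b)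
    (h' : ∀ X b, P (Idx.letters X) b → (X, b) ∈ t) {v : Verma ω} (hv : v ∈ supp ω s) :
    word l • v ∈ supp ω t := by
  have : supp ω s ≤ (supp ω t).comap (mulU ω (word l)) := by
    refine supp_le fun X b hX => ?_
    rw [Submodule.mem_comap, mulU_apply, mono_eq_word, ← mul_smul, ← word_append]
    exact hP.mem_verma (fun X b h => mono_vec_mem_supp (h' X b h)) (h X b hX)
  exact this hv

/-- An upper bound for a total weight is stable under rewriting. -/
theorem Tracked.of_le {φ : Gen → ℝ} {τ : ℝ} (h : ∀ x y g, Occ x y g → φ g ≤ φ x + φ y)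
    (hT : ∀ x : Gen, x.Tail → ∀ b, τ * (tailOut x b).2.re + ((tailOut x b).1.map φ).sum
      ≤ τ * b.re + φ x) (r : ℝ) :
    Tracked fun l b => τ * b.re + (l.map φ).sum ≤ r where
  swap h _ := by
    simp only [List.map_append, List.map_cons, List.sum_append, List.sum_cons] at *
    linarith
  brk h' _ hg := by
    have := h _ _ _ hg
    simp only [List.map_append, List.map_cons, List.sum_append, List.sum_cons] at *
    linarith
  tail {u x b} h' hx := by
    have := hT x hx b
    simp only [List.map_append, List.map_cons, List.sum_append, List.sum_cons, List.map_nil,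
      List.sum_nil] at *
    linarith

/-- The value of a total weight is stable under rewriting. -/
theorem Tracked.of_eq {A : Type*} [AddCommGroup A] {φ : Gen → A} {ψ : ℂ → A}
    (h : ∀ x y g, Occ x y g → φ g = φ x + φ y)
    (hT : ∀ x : Gen, x.Tail → ∀ b, ψ (tailOut x b).2 + ((tailOut x b).1.map φ).sum
      = ψ b + φ x) (r : A) :
    Tracked fun l b => ψ b + (l.map φ).sum = r where
  swap h _ := by
    simp only [List.map_append, List.map_cons, List.sum_append, List.sum_cons] at *
    rw [← h]; abel
  brk h' _ hg := by
    have := h _ _ _ hg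
    simp only [List.map_append, List.map_cons, List.sum_append, List.sum_cons] at *
    rw [← h', this]; abel
  tail {u x b} h' hx := by
    have := hT x hx b
    simp only [List.map_append, List.map_cons, List.sum_append, List.sum_cons, List.map_nil,
      List.sum_nil] at *
    rw [← h']
    calc _ = (u.map φ).sum + (ψ (tailOut x b).2 + ((tailOut x b).1.map φ).sum) := by abel
      _ = _ := by rw [this]; abel

/-! ### Grade, charge and level. -/

/-- Twice the grade of a generator. -/
def Gen.gr : Gen → ℤ
  | .L n => -(2 * n)
  | .T n => -(2 * n)
  | .Gp n => -(2 * n + 1)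
  | .Gm n => -(2 * n + 1)
  | .C => 0

/-- The charge of a generator. -/
def Gen.ch : Gen → ℤ
  | .Gp _ => 1
  | .Gm _ => -1
  | _ => 0

/-- The level of a generator. -/
def Gen.lev : Gen → ℕ
  | .L n => if n = -1 then 2 else 1
  | .Gp _ => 1
  | .Gm _ => 1
  | _ => 0

theorem Gen.gr_occ {x y g : Gen} (h : Occ x y g) : g.gr = x.gr + y.gr := by
  cases x <;> cases y <;> simp only [Occ] at h
  case Gp.Gm => rcases h with rfl | ⟨rfl, -⟩ | ⟨rfl, h, -⟩ <;> simp only [Gen.gr] <;> omega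
  case Gm.Gp => rcases h with rfl | ⟨rfl, -⟩ | ⟨rfl, h, -⟩ <;> simp only [Gen.gr] <;> omega
  case L.L => rcases h with ⟨rfl, -⟩ | ⟨rfl, h⟩ <;> simp only [Gen.gr] <;> omega
  case T.T => rcases h with ⟨rfl, h, -⟩; simp only [Gen.gr]; omega
  case T.Gp => rcases h with rfl; simp only [Gen.gr]; omega
  case T.Gm => rcases h with rfl; simp only [Gen.gr]; omega
  case Gp.T => rcases h with rfl; simp only [Gen.gr]; omega
  case Gm.T => rcases h with rfl; simp only [Gen.gr]; omega
  all_goals (rcases h with ⟨rfl, -⟩; simp only [Gen.gr]; omega)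

theorem Gen.ch_occ {x y g : Gen} (h : Occ x y g) : g.ch = x.ch + y.ch := by
  cases x <;> cases y <;> simp only [Occ] at h
  case Gp.Gm => rcases h with rfl | ⟨rfl, -⟩ | ⟨rfl, h, -⟩ <;> simp [Gen.ch]
  case Gm.Gp => rcases h with rfl | ⟨rfl, -⟩ | ⟨rfl, h, -⟩ <;> simp [Gen.ch]
  case L.L => rcases h with ⟨rfl, -⟩ | ⟨rfl, h⟩ <;> simp [Gen.ch]
  case T.Gp => rcases h with rfl; simp [Gen.ch]
  case T.Gm => rcases h with rfl; simp [Gen.ch]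
  case Gp.T => rcases h with rfl; simp [Gen.ch]
  case Gm.T => rcases h with rfl; simp [Gen.ch]
  all_goals (rcases h with ⟨rfl, -⟩; simp [Gen.ch])

theorem Gen.lev_L_le (n : ℤ) : (Gen.L n).lev ≤ 2 := by
  change (if n = -1 then 2 else 1) ≤ 2
  split_ifs <;> omega

theorem Gen.one_le_lev_L (n : ℤ) : 1 ≤ (Gen.L n).lev := by
  change 1 ≤ (if n = -1 then 2 else 1)
  split_ifs <;> omega

theorem Gen.lev_occ {x y g : Gen} (h : Occ x y g) : g.lev ≤ x.lev + y.lev := by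
  have h1 := Gen.lev_L_le
  have h2 := Gen.one_le_lev_L
  cases x <;> cases y <;> simp only [Occ] at h
  case Gp.Gm => rcases h with rfl | ⟨rfl, -⟩ | ⟨rfl, h, -⟩ <;> first | exact h1 _ | simp [Gen.lev]
  case Gm.Gp => rcases h with rfl | ⟨rfl, -⟩ | ⟨rfl, h, -⟩ <;> first | exact h1 _ | simp [Gen.lev]
  case L.L m n =>
    rcases h with ⟨rfl, -⟩ | ⟨rfl, h⟩
    · exact (h1 _).trans (Nat.add_le_add (h2 m) (h2 n))
    · simp [Gen.lev]
  case T.Gp => rcases h with rfl; simp [Gen.lev]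
  case T.Gm => rcases h with rfl; simp [Gen.lev]
  case Gp.T => rcases h with rfl; simp [Gen.lev]
  case Gm.T => rcases h with rfl; simp [Gen.lev]
  all_goals (rcases h with ⟨rfl, -⟩; simp [Gen.lev])

/-- Twice the grade, the charge and the level of an ordered monomial. -/
def Idx.gr (X : Idx) : ℤ := (X.letters.map Gen.gr).sum

def Idx.ch (X : Idx) : ℤ := (X.letters.map Gen.ch).sum

def Idx.lev (X : Idx) : ℕ := (X.letters.map Gen.lev).sum

theorem Idx.sum_letters {A : Type*} [AddCommMonoid A] (f : Gen → A) (X : Idx) :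
    (X.letters.map f).sum = (X.I.map fun n : ℕ => f (.L (-((n : ℤ) + 2)))).sum
      + (X.J.map fun n : ℕ => f (.T (-((n : ℤ) + 1)))).sum
      + ∑ n ∈ X.Kp, f (.Gp (-((n : ℤ) + 1))) + ∑ n ∈ X.Km, f (.Gm (-((n : ℤ) + 1))) := by
  rw [← Multiset.sum_coe, ← Multiset.map_coe, Idx.coe_letters]
  simp only [Idx.lettersM, Multiset.map_add, Multiset.sum_add, Multiset.map_map]
  rfl

theorem Idx.gr_eq (X : Idx) : X.gr = twoGrade X := by
  rw [Idx.gr, Idx.sum_letters, twoGrade]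
  push_cast
  simp only [Multiset.map_map, Gen.gr, Function.comp_def]
  push_cast
  have h1 : ∀ n : ℕ, -(2 * (-((n : ℤ) + 2))) = 2 * (n + 2) := fun n => by ring
  have h2 : ∀ n : ℕ, -(2 * (-((n : ℤ) + 1))) = 2 * (n + 1) := fun n => by ring
  have h3 : ∀ n : ℕ, -(2 * (-((n : ℤ) + 1)) + 1) = 2 * n + 1 := fun n => by ring
  simp only [h1, h2, h3]

theorem Idx.ch_eq (X : Idx) : X.ch = (X.Kp.card : ℤ) - X.Km.card := by
  rw [Idx.ch, Idx.sum_letters]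
  simp [Gen.ch, sub_eq_add_neg]

theorem Idx.lev_eq (X : Idx) : X.lev = Multiset.card X.I + X.Kp.card + X.Km.card := by
  have h : ∀ n : ℕ, (Gen.L (-((n : ℤ) + 2))).lev = 1 := fun n => by
    change (if -((n : ℤ) + 2) = -1 then 2 else 1) = 1
    exact if_neg (by omega)
  rw [Idx.lev, Idx.sum_letters]
  simp only [h]
  simp [Gen.lev]

/-- Odd letters are exactly those with odd doubled grade, and also those with odd charge. This is
the parity condition on the cut-offs. -/
theorem Idx.gr_modEq_ch (X : Idx) : (twoGrade X : ℤ) ≡ X.ch [ZMOD 2] := by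
  rw [← X.gr_eq, Idx.gr, Idx.ch]
  induction X.letters with
  | nil => rfl
  | cons x l ih =>
    simp only [List.map_cons, List.sum_cons]
    refine Int.ModEq.add ?_ ih
    cases x <;> simp only [Gen.gr, Gen.ch, Int.ModEq] <;> omega

theorem tracked_gr (t : ℂ) :
    Tracked fun l b => 2 * b + (l.map fun g => ((Gen.gr g : ℤ) : ℂ)).sum = t := by
  refine Tracked.of_eq (ψ := fun b => 2 * b) (fun x y g h => by rw [Gen.gr_occ h]; push_cast; ring)
    (fun x hx b => ?_) t
  cases x <;> simp [tailOut, Gen.gr] <;> ring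

theorem tracked_ch (t : ℤ) : Tracked fun l _ => (l.map Gen.ch).sum = t := by
  have := Tracked.of_eq (φ := Gen.ch) (ψ := fun _ => 0) (fun x y g h => Gen.ch_occ h)
    (fun x hx b => ?_) t
  · simpa using this
  · cases x <;> simp [tailOut, Gen.ch]

/-- One unit of the exponent counts `2`, like `L_{-1}`, so absorbing `L_{-1}` preserves the total.
Every other tail letter does not raise the exponent, and an odd one turns into a single odd letter.
-/
theorem tracked_lev (r : ℝ) :
    Tracked fun l b => 2 * b.re + (l.map fun g => ((Gen.lev g : ℕ) : ℝ)).sum ≤ r := by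
  refine Tracked.of_le (fun x y g h => by exact_mod_cast Gen.lev_occ h) (fun x hx b => ?_) r
  cases x with
  | L n =>
    have : (-1 : ℤ) ≤ n := hx
    have h1 : (-1 : ℝ) ≤ n := by exact_mod_cast this
    by_cases hn : n = -1
    · subst hn; simp [tailOut, Gen.lev]; linarith
    · have h2 : (0 : ℤ) ≤ n := by omega
      have h3 : (0 : ℝ) ≤ n := by exact_mod_cast h2
      simp [tailOut, Gen.lev, hn]; linarith
  | T n =>
    simp [tailOut, Gen.lev]; exact hx
  | Gp n =>
    have h3 : (0 : ℝ) ≤ n := by exact_mod_cast (show (0 : ℤ) ≤ n from hx)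
    simp [tailOut, Gen.lev]; linarith
  | Gm n =>
    have h3 : (0 : ℝ) ≤ n := by exact_mod_cast (show (0 : ℤ) ≤ n from hx)
    simp [tailOut, Gen.lev]; linarith
  | C => simp [tailOut, Gen.lev]

theorem List.sum_map_cast {A : Type*} [AddCommGroupWithOne A] (f : Gen → ℤ) (l : List Gen) :
    (l.map fun g => ((f g : ℤ) : A)).sum = (((l.map f).sum : ℤ) : A) := by
  induction l with
  | nil => simp
  | cons x l ih => simp [ih]

theorem List.sum_map_natCast {A : Type*} [AddCommMonoidWithOne A] (f : Gen → ℕ) (l : List Gen) :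
    (l.map fun g => ((f g : ℕ) : A)).sum = (((l.map f).sum : ℕ) : A) := by
  induction l with
  | nil => simp
  | cons x l ih => simp [ih]

/-- Words shift the total grade by their grade. -/
theorem supp_gr {ω : Weight} {t : ℂ} {v : Verma ω} (l : List Gen)
    (hv : v ∈ supp ω {p | 2 * p.2 + twoGrade p.1 = t}) :
    word l • v ∈ supp ω {p | 2 * p.2 + twoGrade p.1 = t + ((l.map Gen.gr).sum : ℤ)} := by
  refine (tracked_gr (t + ((l.map Gen.gr).sum : ℤ))).supp_smul (fun X b hX => ?_) (fun X b h => ?_) hv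
  · rw [Set.mem_ofPred_eq] at hX
    rw [List.map_append, List.sum_append, List.sum_map_cast, List.sum_map_cast, ← hX, ← Idx.gr,
      Idx.gr_eq]
    push_cast; ring
  · rw [List.sum_map_cast, ← Idx.gr, Idx.gr_eq] at h
    rw [Set.mem_ofPred_eq, ← h]; push_cast; rfl

/-- Words shift the charge by their charge. -/
theorem supp_ch {ω : Weight} {t : ℤ} {v : Verma ω} (l : List Gen)
    (hv : v ∈ supp ω {p | p.1.ch = t}) :
    word l • v ∈ supp ω {p | p.1.ch = t + (l.map Gen.ch).sum} := by
  refine (tracked_ch _).supp_smul (fun X b hX => ?_) (fun X b h => h) hv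
  rw [Set.mem_ofPred_eq] at hX
  rw [List.map_append, List.sum_append, ← hX, add_comm]
  rfl

/-- The level of a basis vector, twice the real part of the exponent included. -/
def Lev (ω : Weight) (r : ℝ) : Submodule ℂ (Verma ω) := supp ω {p | 2 * p.2.re + p.1.lev ≤ r}

/-- Words raise the level by at most their level. -/
theorem word_smul_Lev {ω : Weight} {r : ℝ} {v : Verma ω} (l : List Gen) (hv : v ∈ Lev ω r) :
    word l • v ∈ Lev ω (r + (l.map Gen.lev).sum) := by
  refine (tracked_lev (r + (l.map Gen.lev).sum)).supp_smul (fun X b hX => ?_) (fun X b h => ?_) hv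
  · rw [Set.mem_ofPred_eq] at hX
    rw [List.map_append, List.sum_append, List.sum_map_natCast, List.sum_map_natCast, ← Idx.lev]
    linarith
  · rw [List.sum_map_natCast, ← Idx.lev] at h
    exact h

/-! ### Lowering letters -/

/-- The letters `L_n` (`n ≤ -2`), `T_n` (`n ≤ -1`), `G^±_r` (`r ≤ -3/2`). -/
def Gen.Np : Gen → Prop
  | .L n => n ≤ -2
  | .T n => n ≤ -1
  | .Gp n => n ≤ -2
  | .Gm n => n ≤ -2
  | .C => False

/-- The lowering letters, of negative mode number. -/
def Gen.Low : Gen → Prop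
  | .L n => n ≤ -1
  | .T n => n ≤ -1
  | .Gp n => n ≤ -1
  | .Gm n => n ≤ -1
  | .C => False

theorem Gen.low_occ {x y g : Gen} (hx : x.Low) (hy : y.Low) (h : Occ x y g) : g.Low := by
  cases x <;> cases y <;> simp only [Occ, Gen.Low] at h hx hy
  case Gp.Gm => rcases h with rfl | ⟨rfl, -⟩ | ⟨rfl, h, -⟩ <;> simp only [Gen.Low] <;> omega
  case Gm.Gp => rcases h with rfl | ⟨rfl, -⟩ | ⟨rfl, h, -⟩ <;> simp only [Gen.Low] <;> omega
  case L.L => rcases h with ⟨rfl, -⟩ | ⟨rfl, h⟩ <;> simp only [Gen.Low] <;> omega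
  case T.T => rcases h with ⟨rfl, h, -⟩; simp only [Gen.Low]; omega
  case T.Gp => rcases h with rfl; simp only [Gen.Low]; omega
  case T.Gm => rcases h with rfl; simp only [Gen.Low]; omega
  case Gp.T => rcases h with rfl; simp only [Gen.Low]; omega
  case Gm.T => rcases h with rfl; simp only [Gen.Low]; omega
  all_goals (rcases h with ⟨rfl, -⟩; simp only [Gen.Low]; omega)

theorem Gen.np_occ {x y g : Gen} (hx : x.Low) (hy : y.Low)
    (h1 : ¬ (x = .Gp (-1) ∧ y = .Gm (-1))) (h2 : ¬ (x = .Gm (-1) ∧ y = .Gp (-1)))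
    (h : Occ x y g) : g.Np := by
  cases x <;> cases y <;> simp only [Occ, Gen.Low] at h hx hy
  case Gp.Gm =>
    simp only [Gen.Gp.injEq, Gen.Gm.injEq] at h1
    rcases h with rfl | ⟨rfl, -⟩ | ⟨rfl, h, -⟩ <;> simp only [Gen.Np] <;> omega
  case Gm.Gp =>
    simp only [Gen.Gp.injEq, Gen.Gm.injEq] at h2
    rcases h with rfl | ⟨rfl, -⟩ | ⟨rfl, h, -⟩ <;> simp only [Gen.Np] <;> omega
  case L.L => rcases h with ⟨rfl, -⟩ | ⟨rfl, h⟩ <;> simp only [Gen.Np] <;> omega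
  case T.T => rcases h with ⟨rfl, h, -⟩; simp only [Gen.Np]; omega
  case T.Gp => rcases h with rfl; simp only [Gen.Np]; omega
  case T.Gm => rcases h with rfl; simp only [Gen.Np]; omega
  case Gp.T => rcases h with rfl; simp only [Gen.Np]; omega
  case Gm.T => rcases h with rfl; simp only [Gen.Np]; omega
  all_goals (rcases h with ⟨rfl, -⟩; simp only [Gen.Np]; omega)

theorem Gen.Np.low {x : Gen} (h : x.Np) : x.Low := by
  cases x <;> simp only [Gen.Np, Gen.Low] at * <;> omega

theorem Gen.low_iff {x : Gen} : x.Low ↔ x.Np ∨ x = .Gp (-1) ∨ x = .Gm (-1) ∨ x = .L (-1) := by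
  cases x <;> simp [Gen.Np, Gen.Low] <;> omega

theorem Gen.not_tail {x : Gen} (h : ¬ x.Tail) : x.Np ∨ x = .Gp (-1) ∨ x = .Gm (-1) := by
  cases x <;> simp [Gen.Np, Gen.Tail] at * <;> omega

theorem Gen.Np.not_tail {x : Gen} (h : x.Np) : ¬ x.Tail := by
  cases x <;> simp [Gen.Np, Gen.Tail] at * <;> omega

theorem Gen.Low.eq_of_tail {x : Gen} (h : x.Low) (h' : x.Tail) : x = .L (-1) := by
  cases x <;> simp [Gen.Low, Gen.Tail] at * <;> omega

theorem Gen.not_tail_low {x : Gen} (h : ¬ x.Tail) : x.Low := by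
  cases x <;> simp [Gen.Low, Gen.Tail] at * <;> omega

theorem Gm_not_lt_Gp : ¬ Gen.Gm (-1) < Gen.Gp (-1) := by
  rw [Gen.lt_iff]; simp [Gen.blk]

/-- Words in lowering letters, with exponent in a set stable under increments. -/
theorem tracked_low {Q : ℂ → Prop} (hQ : ∀ b, Q b → Q (b + 1)) :
    Tracked fun l b => (∀ x ∈ l, x.Low) ∧ Q b where
  swap h _ := by
    refine ⟨fun z hz => h.1 z ?_, h.2⟩
    simp only [List.mem_append, List.mem_cons] at *
    tauto
  brk {u v x y g b} h _ hg := by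
    refine ⟨fun z hz => ?_, h.2⟩
    rcases List.mem_append.1 hz with hz | hz
    · exact h.1 z (by simp [hz])
    · rcases List.mem_cons.1 hz with rfl | hz
      · exact Gen.low_occ (h.1 x (by simp)) (h.1 y (by simp)) hg
      · exact h.1 z (by simp [hz])
  tail {u x b} h hx := by
    obtain rfl := (h.1 x (by simp)).eq_of_tail hx
    have := hQ b h.2
    refine ⟨fun z hz => h.1 z ?_, by simpa [tailOut] using this⟩
    simp only [tailOut, List.append_nil] at hz
    simp [hz]

/-- Words in lowering letters with a letter other than `L_{-1}` and `G^±_{-1/2}`. -/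
theorem tracked_np : Tracked fun l _ => (∀ x ∈ l, x.Low) ∧ ∃ x ∈ l, x.Np where
  swap {u v x y b} h hxy := by
    refine ⟨((tracked_low (Q := fun _ => True) (by simp)).swap (b := b) ⟨h.1, trivial⟩ hxy).1, ?_⟩
    obtain ⟨z, hz, h'⟩ := h.2
    refine ⟨z, ?_, h'⟩
    simp only [List.mem_append, List.mem_cons] at *
    tauto
  brk {u v x y g b} h hxy hg := by
    refine ⟨((tracked_low (Q := fun _ => True) (by simp)).brk (b := b) ⟨h.1, trivial⟩ hxy hg).1, ?_⟩
    obtain ⟨z, hz, h'⟩ := h.2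
    by_cases hz' : z = x ∨ z = y
    · refine ⟨g, by simp, Gen.np_occ (h.1 x (by simp)) (h.1 y (by simp)) ?_ ?_ hg⟩
      · rintro ⟨rfl, rfl⟩
        rcases hz' with rfl | rfl <;> simp [Gen.Np] at h'
      · rintro ⟨rfl, rfl⟩
        rcases hz' with rfl | rfl <;> simp [Gen.Np] at h'
    · refine ⟨z, ?_, h'⟩
      simp only [List.mem_append, List.mem_cons] at *
      tauto
  tail {u x b} h hx := by
    refine ⟨((tracked_low (Q := fun _ => True) (by simp)).tail (b := b) ⟨h.1, trivial⟩ hx).1, ?_⟩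
    obtain ⟨z, hz, h'⟩ := h.2
    refine ⟨z, ?_, h'⟩
    simp only [List.mem_append, List.mem_singleton] at hz ⊢
    rcases hz with hz | rfl
    · exact Or.inl hz
    · exact absurd hx h'.not_tail

/-- Words in lowering letters other than `L_{-1}` in which `G⁺_{-1/2}` never follows `G⁻_{-1/2}`:
their exponent does not change. -/
def Straight (l : List Gen) : Prop :=
  (∀ x ∈ l, x.Np ∨ x = .Gp (-1) ∨ x = .Gm (-1)) ∧
    l.Pairwise fun x y => ¬ (x = .Gm (-1) ∧ y = .Gp (-1))

theorem tracked_straight (Q : ℂ → Prop) : Tracked fun l b => Straight l ∧ Q b where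
  swap {u v x y b} h hxy := by
    refine ⟨⟨fun z hz => h.1.1 z ?_, ?_⟩, h.2⟩
    · simp only [List.mem_append, List.mem_cons] at *
      tauto
    · have := h.1.2
      simp only [List.pairwise_append, List.pairwise_cons, List.mem_cons, forall_eq_or_imp] at this ⊢
      refine ⟨this.1, ⟨⟨?_, this.2.1.2.1⟩, this.2.1.1.2, this.2.1.2.2⟩, fun a ha =>
        ⟨(this.2.2 a ha).2.1, (this.2.2 a ha).1, (this.2.2 a ha).2.2⟩⟩
      rintro ⟨rfl, rfl⟩
      exact Gm_not_lt_Gp hxy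
  brk {u v x y g b} h hxy hg := by
    have low : ∀ z : Gen, z.Np ∨ z = .Gp (-1) ∨ z = .Gm (-1) → z.Low := fun z hz => Gen.low_iff.2 (by tauto)
    have p := h.1.2
    simp only [List.pairwise_append, List.pairwise_cons, List.mem_cons, forall_eq_or_imp] at p
    have hg' : g.Np := by
      refine Gen.np_occ (low _ (h.1.1 x (by simp))) (low _ (h.1.1 y (by simp))) ?_ p.2.1.1.1 hg
      rintro ⟨rfl, rfl⟩
      exact Gm_not_lt_Gp hxy
    refine ⟨⟨fun z hz => ?_, ?_⟩, h.2⟩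
    · rcases List.mem_append.1 hz with hz | hz
      · exact h.1.1 z (by simp [hz])
      · rcases List.mem_cons.1 hz with rfl | hz
        · exact Or.inl hg'
        · exact h.1.1 z (by simp [hz])
    · simp only [List.pairwise_append, List.pairwise_cons, List.mem_cons, forall_eq_or_imp]
      refine ⟨p.1, ⟨fun a _ => ?_, p.2.1.2.2⟩, fun a ha => ⟨?_, (p.2.2 a ha).2.2⟩⟩
      · rintro ⟨rfl, -⟩; simp [Gen.Np] at hg'
      · rintro ⟨-, rfl⟩; simp [Gen.Np] at hg'
  tail {u x b} h hx := by
    exfalso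
    rcases h.1.1 x (by simp) with h | rfl | rfl
    · exact h.not_tail hx
    · simp [Gen.Tail] at hx
    · simp [Gen.Tail] at hx

theorem Good.straight {l : List Gen} (h : Good l) : Straight l := by
  refine ⟨fun x hx => Gen.not_tail (h.2 x hx), h.1.imp fun {x y} hxy => ?_⟩
  rintro ⟨rfl, rfl⟩
  rcases hxy.1.lt_or_eq with h | h
  · exact Gm_not_lt_Gp h
  · simp at h

theorem Straight.cons {x : Gen} {l : List Gen} (h : Straight l) (hx : x.Np ∨ x = .Gp (-1)) :
    Straight (x :: l) := by
  refine ⟨fun y hy => ?_, List.pairwise_cons.2 ⟨fun y _ => ?_, h.2⟩⟩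
  · rcases List.mem_cons.1 hy with rfl | hy
    · tauto
    · exact h.1 y hy
  · rintro ⟨rfl, -⟩
    simp [Gen.Np] at hx

/-- `G⁻_{-1/2}` is the largest letter that is not a tail letter and, being odd, is not repeated. So
it can only be the last letter. -/
theorem Good.exists_append {l : List Gen} (h : Good l) : ∃ l₀ t, l = l₀ ++ t ∧
    (∀ x ∈ l₀, x.Np ∨ x = .Gp (-1)) ∧ (t = [] ∨ t = [.Gm (-1)]) := by
  induction l with
  | nil => exact ⟨[], [], rfl, by simp, Or.inl rfl⟩
  | cons x v ih =>
    obtain ⟨l₀, t, rfl, h1, h2⟩ := ih h.of_cons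
    rcases Gen.not_tail (h.2 x (by simp)) with hx | rfl | rfl
    · exact ⟨x :: l₀, t, rfl, by simpa using ⟨Or.inl hx, h1⟩, h2⟩
    · exact ⟨_ :: l₀, t, rfl, by simpa using h1, h2⟩
    · refine ⟨[], _, rfl, by simp, Or.inr ?_⟩
      simp only [List.cons.injEq]
      refine ⟨trivial, List.eq_nil_iff_forall_not_mem.2 fun z hz => ?_⟩
      have h3 := (List.pairwise_cons.1 h.1).1 z hz
      have h4 := h.2 z (List.mem_cons_of_mem _ hz)
      rcases h3.1.lt_or_eq with h5 | h5
      · rw [Gen.lt_iff] at h5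
        cases z <;> simp [Gen.blk, Gen.md, Gen.Tail] at h4 h5 <;> split_ifs at h5 <;> omega
      · simpa [Gen.odd] using h3.2 h5

/-! ### The filtration by the exponent -/

/-- The span of the basis vectors with bounded real part of the exponent. -/
def E (ω : Weight) (r : ℝ) : Submodule ℂ (Verma ω) := supp ω {p | p.2.re ≤ r}

theorem E_mono (ω : Weight) {r s : ℝ} (h : r ≤ s) : E ω r ≤ E ω s :=
  supp_mono fun _ hp => le_trans hp h

theorem Lev_le_E (ω : Weight) {r s : ℝ} (h : r ≤ 2 * s) : Lev ω r ≤ E ω s := by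
  refine supp_mono fun p hp => ?_
  rw [Set.mem_ofPred_eq] at *
  have : (0 : ℝ) ≤ p.1.lev := Nat.cast_nonneg _
  linarith

/-- Putting such a letter in front of an ordered monomial keeps it straight, so sorting never
creates `L_{-1}` and the exponent is unchanged. -/
theorem gen_smul_E {ω : Weight} {r : ℝ} {v : Verma ω} {x : Gen} (hx : x.Np ∨ x = .Gp (-1))
    (hv : v ∈ E ω r) : gen x • v ∈ E ω r := by
  have := (tracked_straight fun b => b.re ≤ r).supp_smul (l := [x])
    (fun X b h => ⟨X.good_letters.straight.cons hx, h⟩) (t := {p | p.2.re ≤ r}) (fun X b h => h.2) hv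
  simpa [E] using this

theorem vec_mem_Lev (ω : Weight) (b : ℂ) : vec ω b ∈ Lev ω (2 * b.re) := by
  have : mono idxOne • vec ω b ∈ Lev ω (2 * b.re) :=
    mono_vec_mem_supp (by simp [Idx.lev_eq, idxOne])
  simpa [mono, idxOne] using this

/-- Every generator raises the exponent by at most `1`. -/
theorem gen_smul_E_succ {ω : Weight} {r : ℝ} {v : Verma ω} (g : Gen) (hv : v ∈ E ω r) :
    gen g • v ∈ E ω (r + 1) := by
  have key : ∀ (l₀ t : List Gen), (∀ x ∈ l₀, x.Np ∨ x = .Gp (-1)) → (t = [] ∨ t = [.Gm (-1)]) →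
      ∀ g (b : ℂ), gen g • word (l₀ ++ t) • vec ω b ∈ E ω (b.re + 1) := by
    intro l₀ t h ht
    have lev2 : ∀ g : Gen, g.lev ≤ 2 := fun g => by
      cases g <;> first | exact Gen.lev_L_le _ | simp [Gen.lev]
    induction l₀ with
    | nil =>
      intro g b
      have hv := vec_mem_Lev ω b
      rcases ht with rfl | rfl
      · have := word_smul_Lev [g] hv
        have h2 : ((g.lev : ℕ) : ℝ) ≤ 2 := by exact_mod_cast lev2 g
        refine Lev_le_E ω ?_ (by simpa using this)
        linarith
      -- The level estimate for `L_{-1} G⁻_{-1/2}` would exceed the bound by one, but these two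
      -- letters commute. Any other generator has level at most `1`.
      · by_cases hg : g = .L (-1)
        · subst hg
          have e : gen (.L (-1)) * gen (.Gm (-1)) = gen (.Gm (-1)) * gen (.L (-1)) := by
            have := gen_exch (.L (-1)) (.Gm (-1))
            norm_num [sgn, brk, Gen.odd] at this
            exact this
          rw [List.nil_append, word_cons, word_nil, mul_one, ← mul_smul, e, mul_smul, vec_L_neg]
          have := mono_vec_mem_supp (ω := ω) (X := idxM) (b := b + 1)
            (s := {p | p.2.re ≤ b.re + 1}) (by simp)
          simpa [mono, idxM, E] using this
        · have h1 : g.lev ≤ 1 := by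
            cases g with
            | L n =>
              have hn : n ≠ -1 := fun h => hg (by rw [h])
              change (if n = -1 then 2 else 1) ≤ 1
              rw [if_neg hn]
            | _ => simp [Gen.lev]
          have h2 : ((g.lev : ℕ) : ℝ) ≤ 1 := by exact_mod_cast h1
          have := word_smul_Lev [g, .Gm (-1)] hv
          refine Lev_le_E ω (r := 2 * b.re + ([g, Gen.Gm (-1)].map Gen.lev).sum) ?_ ?_
          · have h3 : (Gen.Gm (-1)).lev = 1 := rfl
            simp only [List.map_cons, List.map_nil, List.sum_cons, List.sum_nil, h3]
            push_cast; linarith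
          · simpa [mul_smul] using this
    | cons x l₀ ih =>
      intro g b
      have hx := h x (by simp)
      have ih := ih fun y hy => h y (by simp [hy])
      -- At every stage there is exactly one generator to be moved, either `g` or one from a
      -- bracket. The letters it leaves behind preserve the exponent, so the loss of `1` occurs only
      -- once, at the symbol.
      rw [List.cons_append, word_cons, ← mul_smul, ← mul_assoc, gen_exch g x, add_mul, add_smul,
        smul_mul_assoc, smul_assoc, mul_assoc, mul_smul, mul_smul]
      refine Submodule.add_mem _ (Submodule.smul_mem _ _ (gen_smul_E hx (ih g b))) ?_
      have e := map_brk ((LinearMap.toSpanSingleton U _ (word (l₀ ++ t) • vec ω b)).restrictScalars ℂ)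
        gen g x
      simp only [LinearMap.restrictScalars_apply, LinearMap.toSpanSingleton_apply] at e
      rw [mul_smul, e]
      exact brk_mem _ _ _ _ fun g' _ => ih g' b
  have : E ω r ≤ (E ω (r + 1)).comap (mulU ω (gen g)) := by
    refine supp_le fun X b hX => ?_
    rw [Submodule.mem_comap, mulU_apply, mono_eq_word]
    obtain ⟨l₀, t, h, h1, h2⟩ := X.good_letters.exists_append
    rw [h]
    exact E_mono ω (by simpa using hX) (key l₀ t h1 h2 g b)
  exact this hv

/-- Every ordered monomial raises the exponent by at most `1`. -/
theorem mono_smul_E {ω : Weight} {r : ℝ} {v : Verma ω} (X : Idx) (hv : v ∈ E ω r) :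
    mono X • v ∈ E ω (r + 1) := by
  obtain ⟨l₀, t, h, h1, h2⟩ := X.good_letters.exists_append
  rw [mono_eq_word, h, word_append, mul_smul]
  have ht : word t • v ∈ E ω (r + 1) := by
    rcases h2 with rfl | rfl
    · simpa using E_mono ω (by linarith) hv
    · simpa using gen_smul_E_succ (.Gm (-1)) hv
  clear h h2
  induction l₀ with
  | nil => simpa using ht
  | cons x l₀ ih =>
    rw [word_cons, mul_smul]
    exact gen_smul_E (h1 x (by simp)) (ih fun y hy => h1 y (by simp [hy]))

/-! ### The adjoint action of `L_{-1}` -/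

theorem comm_mul' {A : Type*} [Ring A] (x y z : A) : comm x (y * z) = comm x y * z + y * comm x z := by
  simp only [comm]; noncomm_ring

/-- The commutator with `L_{-1}`, as a linear map. -/
def adL : Module.End ℂ U :=
  LinearMap.mulLeft ℂ (gen (.L (-1))) - LinearMap.mulRight ℂ (gen (.L (-1)))

theorem adL_apply (u : U) : adL u = comm (gen (.L (-1))) u := rfl

theorem comm_iterate (i : ℕ) (u : U) : (comm (gen (.L (-1))))^[i] u = (adL ^ i) u := by
  rw [Module.End.pow_apply]; rfl

theorem adL_mul (u v : U) : adL (u * v) = adL u * v + u * adL v := comm_mul' _ _ _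

theorem comm_L_gen (x : Gen) : comm (gen (.L (-1))) (gen x) = brk gen (.L (-1)) x := by
  rw [comm, gen_exch (.L (-1)) x]
  simp [sgn, Gen.odd]

/-- The algebra generated by the letters which preserve the exponents. -/
def lowAlg : Subalgebra ℂ U := Algebra.adjoin ℂ (gen '' {x | x.Np ∨ x = .Gp (-1)})

theorem adL_mem_lowAlg {u : U} (hu : u ∈ lowAlg) : adL u ∈ lowAlg := by
  induction hu using Algebra.adjoin_induction with
  | mem u hu =>
    obtain ⟨x, hx, rfl⟩ := hu
    rw [adL_apply, comm_L_gen]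
    have hl : x.Low := Gen.low_iff.2 (by rcases hx with h | h <;> tauto)
    refine brk_mem (Subalgebra.toSubmodule lowAlg) _ _ _ fun g hg => Algebra.subset_adjoin ⟨g, Or.inl ?_, rfl⟩
    exact Gen.np_occ (by simp [Gen.Low]) hl (by simp) (by simp) hg
  | algebraMap c =>
    rw [adL_apply, comm, Algebra.commutes c, sub_self]
    exact Subalgebra.zero_mem _
  | add u v _ _ hu hv => rw [map_add]; exact Subalgebra.add_mem _ hu hv
  | mul u v hu' hv' hu hv =>
    rw [adL_mul]
    exact Subalgebra.add_mem _ (Subalgebra.mul_mem _ hu hv') (Subalgebra.mul_mem _ hu' hv)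

theorem lowAlg_smul_E {ω : Weight} {u : U} (hu : u ∈ lowAlg) {r : ℝ} {v : Verma ω} (hv : v ∈ E ω r) :
    u • v ∈ E ω r := by
  induction hu using Algebra.adjoin_induction generalizing v with
  | mem u hu =>
    obtain ⟨x, hx, rfl⟩ := hu
    exact gen_smul_E hx hv
  | algebraMap c => 
    rw [algebraMap_smul]
    exact Submodule.smul_mem _ _ hv
  | add u u' _ _ hu hu' => rw [add_smul]; exact Submodule.add_mem _ (hu hv) (hu' hv)
  | mul u u' _ _ hu hu' => rw [mul_smul]; exact hu (hu' hv)

/-- The only letter of an ordered monomial that can change exponents is a final `G⁻_{-1/2}`, and it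
commutes with `L_{-1}`. Hence the iterated commutators of the monomial act only on the first factor.
-/
theorem mono_eq_mul (X : Idx) : ∃ u ∈ lowAlg, ∃ t : U, mono X = u * t ∧ adL t = 0 ∧
    ∀ (ω : Weight) (r : ℝ) (v : Verma ω), v ∈ E ω r → t • v ∈ E ω (r + 1) := by
  obtain ⟨l₀, t, h, h1, h2⟩ := X.good_letters.exists_append
  refine ⟨word l₀, ?_, word t, ?_, ?_, fun ω r v hv => ?_⟩
  · clear h h2
    induction l₀ with
    | nil => exact Subalgebra.one_mem _
    | cons x l₀ ih =>
      exact Subalgebra.mul_mem _ (Algebra.subset_adjoin ⟨x, h1 x (by simp), rfl⟩)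
        (ih fun y hy => h1 y (by simp [hy]))
  · rw [mono_eq_word, h, word_append]
  · rcases h2 with rfl | rfl
    · simp [adL_apply, comm]
    · rw [word_cons, word_nil, mul_one, adL_apply, comm_L_gen]
      norm_num [brk]
  · rcases h2 with rfl | rfl
    · simpa using E_mono ω (by linarith) hv
    · simpa using gen_smul_E_succ (.Gm (-1)) hv

theorem adL_pow_mul {u t : U} (ht : adL t = 0) (i : ℕ) : (adL ^ i) (u * t) = (adL ^ i) u * t := by
  induction i with
  | zero => simp
  | succ i ih =>
    rw [pow_succ', Module.End.mul_apply, Module.End.mul_apply, ih, adL_mul, ht, mul_zero, add_zero]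

theorem adL_pow_mem_lowAlg {u : U} (hu : u ∈ lowAlg) (i : ℕ) : (adL ^ i) u ∈ lowAlg := by
  induction i with
  | zero => simpa using hu
  | succ i ih =>
    rw [pow_succ', Module.End.mul_apply]
    exact adL_mem_lowAlg ih

/-- The point is that the bound is uniform in `X` and `i`: `lowAlg` is stable under `adL` and
preserves exponents. In the expansion of `L_{-1}^s Y` the falling powers of `L_{-1}` thus dominate,
and all series converge. -/
theorem adL_pow_mono_smul_E {ω : Weight} (X : Idx) (i : ℕ) {r : ℝ} {v : Verma ω} (hv : v ∈ E ω r) :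
    (adL ^ i) (mono X) • v ∈ E ω (r + 1) := by
  obtain ⟨u, hu, t, h, ht, ht'⟩ := mono_eq_mul X
  rw [h, adL_pow_mul ht, mul_smul]
  exact lowAlg_smul_E (adL_pow_mem_lowAlg hu i) (ht' ω r v hv)

theorem vec_L_pow (ω : Weight) (b : ℂ) (n : ℕ) : gen (.L (-1)) ^ n • vec ω b = vec ω (b + n) := by
  induction n with
  | zero => simp
  | succ n ih =>
    rw [pow_succ', mul_smul, ih, vec_L_neg]
    congr 1; push_cast; ring

theorem fall_nat (n i : ℕ) : fall n i = (n.descFactorial i : ℂ) := by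
  induction i with
  | zero => simp [fall_zero]
  | succ i ih =>
    rw [fall_succ, ih, Nat.descFactorial_succ]
    rcases le_or_gt i n with h | h
    · push_cast [Nat.cast_sub h]; ring
    · rw [Nat.descFactorial_eq_zero_iff_lt.2 h]; simp

theorem binom_nat (n i : ℕ) : binom n i = (n.choose i : ℂ) := by
  rw [binom, fall_nat, Nat.descFactorial_eq_factorial_mul_choose, Nat.cast_mul]
  exact mul_div_cancel_left₀ _ (Nat.cast_ne_zero.2 i.factorial_ne_zero)

/-- Left multiplication by `L_{-1}` is `adL` plus right multiplication, and these two commute; the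
formula is the binomial theorem for their sum. -/
theorem L_pow_mul (n : ℕ) (u : U) : gen (.L (-1)) ^ n * u =
    ∑ i ∈ Finset.range (n + 1), (n.choose i : ℂ) • ((adL ^ i) u * gen (.L (-1)) ^ (n - i)) := by
  have h1 : (LinearMap.mulLeft ℂ (gen (.L (-1))) : Module.End ℂ U)
      = adL + LinearMap.mulRight ℂ (gen (.L (-1))) := by rw [adL]; abel
  have hc : Commute (adL : Module.End ℂ U) (LinearMap.mulRight ℂ (gen (.L (-1)))) := by
    refine LinearMap.ext fun v => ?_
    simp only [Module.End.mul_apply, LinearMap.mulRight_apply, adL_apply, comm]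
    noncomm_ring
  have h2 := congrArg (fun f : Module.End ℂ U => f u) (hc.add_pow n)
  rw [← h1] at h2
  simp only [LinearMap.pow_mulLeft, LinearMap.mulLeft_apply, LinearMap.sum_apply,
    LinearMap.pow_mulRight] at h2
  rw [h2]
  refine Finset.sum_congr rfl fun i _ => ?_
  rw [Module.End.mul_apply, Module.End.mul_apply, LinearMap.mulRight_apply]
  have e : ((n.choose i : ℕ) : Module.End ℂ U) u = (n.choose i : ℂ) • u := by
    rw [Nat.cast_smul_eq_nsmul]; exact Module.End.natCast_apply _ _
  rw [e, smul_mul_assoc, map_smul]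
  have e2 := LinearMap.congr_fun ((hc.pow_left i).pow_right (n - i)).eq u
  simp only [Module.End.mul_apply, LinearMap.pow_mulRight, LinearMap.mulRight_apply] at e2
  rw [e2]

theorem L_pow_smul (ω : Weight) (n : ℕ) (u : U) (b : ℂ) : gen (.L (-1)) ^ n • u • vec ω b =
    ∑ i ∈ Finset.range (n + 1), binom n i • (adL ^ i) u • vec ω (b + n - i) := by
  rw [← mul_smul, L_pow_mul, Finset.sum_smul]
  refine Finset.sum_congr rfl fun i hi => ?_
  rw [smul_assoc, mul_smul, vec_L_pow, binom_nat]
  congr 3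
  rw [Nat.cast_sub (by simpa [Nat.lt_succ_iff] using hi)]
  ring

/-! ### Polynomial families of vectors -/

open Polynomial in
/-- The families of vectors depending polynomially on the exponent. -/
def PolyFam (ω : Weight) : Submodule ℂ (ℂ → Verma ω) :=
  Submodule.span ℂ {f | ∃ (p : ℂ[X]) (X : Idx) (t : ℂ), f = fun b => p.eval b • mono X • vec ω (b + t)}

open Polynomial in
theorem PolyFam.poly_smul {ω : Weight} {f : ℂ → Verma ω} (hf : f ∈ PolyFam ω) (p : ℂ[X]) :
    (fun b => p.eval b • f b) ∈ PolyFam ω := by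
  induction hf using Submodule.span_induction with
  | mem f hf =>
    obtain ⟨q, X, t, rfl⟩ := hf
    exact Submodule.subset_span ⟨p * q, X, t, by funext b; rw [eval_mul, mul_smul]⟩
  | zero => simp only [Pi.zero_apply, smul_zero]; exact (PolyFam ω).zero_mem
  | add f g _ _ hf hg => 
    have := Submodule.add_mem _ hf hg
    convert this using 1
    funext b; simp
  | smul c f _ hf => 
    have := Submodule.smul_mem _ c hf
    convert this using 1
    funext b; simp [smul_comm c]

theorem tailOut_add (x : Gen) (b t : ℂ) :
    tailOut x (b + t) = ((tailOut x t).1, b + (tailOut x t).2) := by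
  cases x <;> simp [tailOut, add_sub_assoc]

open Polynomial in
theorem fall_poly (n : ℕ) : ∃ p : ℂ[X], ∀ b, fall b n = p.eval b := by
  refine ⟨∏ j ∈ Finset.range n, (X - C (j : ℂ)), fun b => ?_⟩
  simp [fall, eval_prod]

open Polynomial in
theorem act_poly (ω : Weight) (x : Gen) : ∃ p : ℂ[X], ∀ b,
    act ω x b = p.eval b • wd (tailOut x b).1 (tailOut x b).2 := by
  cases x with
  | L n =>
    obtain ⟨p, hp⟩ := fall_poly ((n + 1).toNat - 1)
    obtain ⟨q, hq⟩ := fall_poly (n + 1).toNat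
    exact ⟨C ((n + 1).toNat : ℂ) * p * C ω.h + q, fun b => by simp [act, tailOut, hp, hq]⟩
  | T n =>
    obtain ⟨p, hp⟩ := fall_poly n.toNat
    exact ⟨p * C ω.q, fun b => by simp [act, tailOut, hp]⟩
  | Gp n =>
    obtain ⟨p, hp⟩ := fall_poly (n + 1).toNat
    exact ⟨p, fun b => by simp [act, tailOut, hp]⟩
  | Gm n =>
    obtain ⟨p, hp⟩ := fall_poly (n + 1).toNat
    exact ⟨p, fun b => by simp [act, tailOut, hp]⟩
  | C => exact ⟨C ω.c, fun b => by simp [act, tailOut]⟩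

open Polynomial in
-- Rewriting proceeds in the same way for all exponents `b + t`; only the tail rules involve `b`,
-- and their coefficients are polynomials in it.
theorem PolyFam.word_vec (ω : Weight) (l : List Gen) (t : ℂ) :
    (fun b => word l • vec ω (b + t)) ∈ PolyFam ω := by
  have := Tracked.true.mem_of_tail (e := fun t b => vec ω (b + t)) (S := PolyFam ω)
    (fun u x t hx _ ih => ?_) (fun X t _ => ?_) (l := l) (b := t) trivial
  · exact this
  · obtain ⟨p, hp⟩ := act_poly ω x
    have h := PolyFam.poly_smul (ih _ (tailOut x t).2 trivial (below_append u (below_tailOut hx t)))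
      (p.comp (X + C t))
    convert h using 1
    funext b
    rw [Pi.smul_apply, Pi.smul_apply, word_append, mul_smul, word_cons, word_nil, mul_one,
      ← ev_act ω hx, hp, map_smul, ev_wd, tailOut_add, smul_comm_U, word_append, mul_smul]
    simp
  · exact Submodule.subset_span ⟨1, X, t, by funext b; simp⟩

theorem PolyFam.smul {ω : Weight} {f : ℂ → Verma ω} (hf : f ∈ PolyFam ω) (u : U) :
    (fun b => u • f b) ∈ PolyFam ω := by
  have hw : ∀ l : List Gen, (fun b => word l • f b) ∈ PolyFam ω := by
    intro l
    induction hf using Submodule.span_induction with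
    | mem f hf =>
      obtain ⟨p, X, t, rfl⟩ := hf
      have := PolyFam.poly_smul (PolyFam.word_vec ω (l ++ X.letters) t) p
      convert this using 1
      funext b
      rw [smul_comm_U, word_append, mul_smul, mono_eq_word]
    | zero => simp only [Pi.zero_apply, smul_zero]; exact (PolyFam ω).zero_mem
    | add f g _ _ hf hg => 
      have := Submodule.add_mem _ hf hg
      convert this using 1
      funext b; simp
    | smul c f _ hf => 
      have := Submodule.smul_mem _ c hf
      convert this using 1
      funext b; simp [smul_comm_U]
  have h := mem_span_word u
  induction h using Submodule.span_induction with
  | mem u hu => obtain ⟨l, rfl⟩ := hu; exact hw l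
  | zero => simp only [zero_smul]; exact (PolyFam ω).zero_mem
  | add u v _ _ hu hv =>
    have := Submodule.add_mem _ hu hv
    convert this using 1
    funext b; simp [add_smul]
  | smul c u _ hu =>
    have := Submodule.smul_mem _ c hu
    convert this using 1
    funext b; simp [smul_assoc]

open Polynomial in
theorem PolyFam.shift {ω : Weight} {f : ℂ → Verma ω} (hf : f ∈ PolyFam ω) (s : ℂ) :
    (fun b => f (b + s)) ∈ PolyFam ω := by
  induction hf using Submodule.span_induction with
  | mem f hf =>
    obtain ⟨p, Y, t, rfl⟩ := hf
    exact Submodule.subset_span ⟨p.comp (X + C s), Y, s + t, by funext b; simp [add_assoc]⟩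
  | zero => exact Submodule.zero_mem _
  | add f g _ _ hf hg => exact Submodule.add_mem _ hf hg
  | smul c f _ hf => exact Submodule.smul_mem _ c hf

theorem PolyFam.fall_smul {ω : Weight} {f : ℂ → Verma ω} (hf : f ∈ PolyFam ω) (n : ℕ) :
    (fun b => fall b n • f b) ∈ PolyFam ω := by
  obtain ⟨p, hp⟩ := fall_poly n
  simp only [hp]
  exact PolyFam.poly_smul hf p

open Polynomial in
/-- A polynomial family which is of low exponent at the natural numbers is so everywhere. -/
theorem PolyFam.mem_E {ω : Weight} {f : ℂ → Verma ω} (hf : f ∈ PolyFam ω) {r : ℝ}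
    (h : ∀ n : ℕ, f n ∈ E ω (n + r)) (b : ℂ) : f b ∈ E ω (b.re + r) := by
  -- The exponent of a basis vector is measured relative to `b`. At a fixed relative exponent, the
  -- coefficient is then a polynomial in `b`.
  obtain ⟨F, hF⟩ : ∃ F : (Idx × ℂ) →₀ ℂ[X], ∀ b (p : Idx × ℂ),
      (vb ω).repr (f b) (p.1, b + p.2) = (F p).eval b := by
    clear h
    induction hf using Submodule.span_induction with
    | mem f hf =>
      obtain ⟨p, Y, t, rfl⟩ := hf
      refine ⟨Finsupp.single (Y, t) p, fun b q => ?_⟩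
      beta_reduce
      rw [← vb_apply]
      by_cases hq : q = (Y, t)
      · subst hq; simp
      · have h1 : (Y, b + t) ≠ (q.1, b + q.2) := by
          intro h; apply hq
          simp only [Prod.mk.injEq, add_right_inj] at h
          exact Prod.ext h.1.symm h.2.symm
        simp [h1, Ne.symm hq]
    | zero => exact ⟨0, fun b p => by simp⟩
    | add f g _ _ hf hg =>
      obtain ⟨F, hF⟩ := hf
      obtain ⟨G, hG⟩ := hg
      exact ⟨F + G, fun b p => by simp [hF, hG]⟩
    | smul c f _ hf =>
      obtain ⟨F, hF⟩ := hf
      exact ⟨c • F, fun b p => by simp [hF]⟩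
  refine mem_supp_iff.2 fun p hp => ?_
  have e : p = ((p.1, b + (p.2 - b)) : Idx × ℂ) := by simp
  rw [e, hF b (p.1, p.2 - b)] at hp
  by_contra hlt
  apply hp
  -- At a relative exponent with real part above `r`, the polynomial vanishes at every natural
  -- number.
  have : F (p.1, p.2 - b) = 0 := by
    refine Polynomial.eq_zero_of_infinite_isRoot _ (Set.Infinite.mono ?_
      (Set.infinite_range_of_injective (Nat.cast_injective (R := ℂ))))
    rintro _ ⟨n, rfl⟩
    by_contra hne
    have h2 := mem_supp_iff.1 (h n) (p.1, n + (p.2 - b)) (by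
      rw [hF n (p.1, p.2 - b)]; exact hne)
    apply hlt
    simp at h2 ⊢
    linarith
  rw [this]; simp

/-! ### Null sequences -/

/-- Sequences of vectors whose exponents tend to `-∞`. -/
def Null {ω : Weight} (v : ℕ → Verma ω) : Prop := ∀ r : ℝ, ∃ N₀, ∀ N ≥ N₀, v N ∈ E ω r

theorem Null.add {ω : Weight} {v w : ℕ → Verma ω} (hv : Null v) (hw : Null w) :
    Null fun N => v N + w N := fun r => by
  obtain ⟨N₁, h1⟩ := hv r
  obtain ⟨N₂, h2⟩ := hw r
  exact ⟨max N₁ N₂, fun N hN => Submodule.add_mem _ (h1 N (le_of_max_le_left hN))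
    (h2 N (le_of_max_le_right hN))⟩

theorem Null.smul {ω : Weight} {v : ℕ → Verma ω} (hv : Null v) (u : U) :
    Null fun N => u • v N := by
  induction u using U_induction generalizing v with
  | h1 c => 
    intro r
    obtain ⟨N₁, h1⟩ := hv r
    exact ⟨N₁, fun N hN => by
      beta_reduce
      rw [algebraMap_smul]; exact Submodule.smul_mem _ _ (h1 N hN)⟩
  | hg g => 
    intro r
    obtain ⟨N₁, h1⟩ := hv (r - 1)
    exact ⟨N₁, fun N hN => by simpa using gen_smul_E_succ g (h1 N hN)⟩
  | ha u u' hu hu' => simpa only [add_smul] using (hu hv).add (hu' hv)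
  | hm u u' hu hu' => simpa only [mul_smul] using hu (hu' hv)

theorem Null.of_bound {ω : Weight} {v : ℕ → Verma ω} {s : ℝ}
    (h : ∀ N : ℕ, v N ∈ E ω (s - N / 2)) : Null v := fun r => by
  obtain ⟨N₀, hN₀⟩ := exists_nat_ge (2 * (s - r))
  refine ⟨N₀, fun N hN => E_mono ω ?_ (h N)⟩
  have : (N₀ : ℝ) ≤ N := by exact_mod_cast hN
  linarith

/-! ### Powers of `L_{-1}` applied to a series -/

theorem mem_idxLE {m : ℕ} {X : Idx} : X ∈ idxLE m ↔ twoGrade X ≤ m := by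
  simp [idxLE]

theorem vec_mem_E (ω : Weight) {b : ℂ} {r : ℝ} (h : b.re ≤ r) : vec ω b ∈ E ω r :=
  Lev_le_E ω (by linarith) (vec_mem_Lev ω b)

theorem mono_vec_mem_E (ω : Weight) (X : Idx) {b : ℂ} {r : ℝ} (h : b.re ≤ r) :
    mono X • vec ω b ∈ E ω r := mono_vec_mem_supp h

/-- The action of the series `Θ` on the vector `L_{-1}^b Ψ`, with truncated summations, by the
binomial expansion in the powers of `ad L_{-1}`. -/
def powSeries (ω : Weight) (a : ℂ) (Θ : Series) (N : ℕ) (b : ℂ) : Verma ω :=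
  ∑ Y ∈ idxLE N, Θ Y • ∑ i ∈ Finset.range (N + 1),
    binom b i • (adL ^ i) (mono Y) • vec ω (b + a - (twoGrade Y : ℂ) / 2 - i)

theorem powSeries_mem_E (ω : Weight) (a : ℂ) (Θ : Series) (N : ℕ) (b : ℂ) :
    powSeries ω a Θ N b ∈ E ω (b.re + a.re + 1) := by
  refine Submodule.sum_mem _ fun Y _ => Submodule.smul_mem _ _ (Submodule.sum_mem _ fun i _ =>
    Submodule.smul_mem _ _ (adL_pow_mono_smul_E Y i (vec_mem_E ω ?_)))
  simp
  have h1 : (0 : ℝ) ≤ twoGrade Y := Nat.cast_nonneg _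
  have h2 : (0 : ℝ) ≤ i := Nat.cast_nonneg _
  linarith

theorem powSeries_poly (ω : Weight) (a : ℂ) (Θ : Series) (N : ℕ) :
    powSeries ω a Θ N ∈ PolyFam ω := by
  have e : powSeries ω a Θ N = ∑ Y ∈ idxLE N, Θ Y • ∑ i ∈ Finset.range (N + 1),
      fun b => binom b i • (adL ^ i) (mono Y) • vec ω (b + a - (twoGrade Y : ℂ) / 2 - i) := by
    funext b
    simp [powSeries]
  rw [e]
  refine Submodule.sum_mem _ fun Y _ => Submodule.smul_mem _ _ (Submodule.sum_mem _ fun i _ => ?_)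
  have h1 := PolyFam.smul (PolyFam.word_vec ω [] (a - (twoGrade Y : ℂ) / 2 - i)) ((adL ^ i) (mono Y))
  have h2 := Submodule.smul_mem _ ((i.factorial : ℂ)⁻¹) (PolyFam.fall_smul h1 i)
  convert h2 using 1
  funext b
  simp only [word_nil, one_smul, Pi.smul_apply]
  rw [binom, smul_smul, div_eq_inv_mul]
  congr 4
  ring

/-- For a natural exponent the binomial expansion is finite and exact, so only the terms with `i >
N` are lost. Their exponents are at most `n + a - N - 1`, and the operators raise them by at most
`1`. -/
theorem powSeries_nat (ω : Weight) (a : ℂ) (Θ : Series) (N n : ℕ) :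
    gen (.L (-1)) ^ n • cutoff (vec ω) a Θ N - powSeries ω a Θ N n ∈ E ω (n + (a.re - N)) := by
  rw [cutoff, powSeries, Finset.smul_sum, ← Finset.sum_sub_distrib]
  refine Submodule.sum_mem _ fun Y _ => ?_
  rw [smul_comm_U, ← smul_sub]
  refine Submodule.smul_mem _ _ ?_
  rw [L_pow_smul]
  set g : ℕ → Verma ω := fun i =>
    binom n i • (adL ^ i) (mono Y) • vec ω (n + a - (twoGrade Y : ℂ) / 2 - i) with hg
  have e1 : ∑ i ∈ Finset.range (n + 1), binom n i • (adL ^ i) (mono Y) •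
      vec ω (a - (twoGrade Y : ℂ) / 2 + n - i) = ∑ i ∈ Finset.range (N + 1 + n), g i := by
    have : ∀ i : ℕ, a - (twoGrade Y : ℂ) / 2 + n - i = n + a - (twoGrade Y : ℂ) / 2 - i :=
      fun i => by ring
    simp only [this]
    refine Finset.sum_subset (fun i hi => ?_) fun i _ hi => ?_
    · simp only [Finset.mem_range] at *; omega
    · rw [binom_nat, Nat.choose_eq_zero_of_lt (by simpa using hi)]; simp
  rw [e1, Finset.sum_range_add, add_sub_cancel_left]
  refine Submodule.sum_mem _ fun i _ => Submodule.smul_mem _ _ ?_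
  have := adL_pow_mono_smul_E (ω := ω) Y (N + 1 + i) (r := n + (a.re - N) - 1)
    (v := vec ω (n + a - (twoGrade Y : ℂ) / 2 - ((N + 1 + i : ℕ) : ℂ))) (vec_mem_E ω ?_)
  · simpa using this
  · simp
    have h1 : (0 : ℝ) ≤ twoGrade Y := Nat.cast_nonneg _
    have h2 : (0 : ℝ) ≤ i := Nat.cast_nonneg _
    linarith

/-- This is the recursion `fall (n+1) m = fall n m + m * fall n (m-1)`. Truncated subtraction in `n
- m` does no harm, because `fall n m` vanishes for `m > n`. -/
theorem fall_smul_rec {ω : Weight} {u : ℕ → Verma ω} (hu : ∀ k, gen (.L (-1)) • u k = u (k + 1))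
    (n m : ℕ) : gen (.L (-1)) • fall n m • u (n - m) + (m : ℂ) • fall n (m - 1) • u (n - (m - 1))
      = fall (n + 1) m • u (n + 1 - m) := by
  rw [smul_comm_U, hu]
  rcases m with _ | k
  · simp [fall_zero]
  · rw [Nat.add_sub_cancel, fall_add_one, Nat.add_sub_cancel, Nat.add_sub_add_right, add_smul,
      smul_smul]
    congr 1
    rcases le_or_gt (k + 1) n with h | h
    · rw [show n - (k + 1) + 1 = n - k by omega]
    · rw [fall_nat, Nat.descFactorial_eq_zero_iff_lt.2 h]; simp

/-- A sequence of operators moved past a power of `L_{-1}`, applied to a vector which is singular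
up to terms of low exponent. -/
theorem smul_L_pow {ω : Weight} {Ψ : Verma ω} {X : ℕ → U} {s : ℝ} {η : ℂ}
    (h0 : X 0 * gen (.L (-1)) = gen (.L (-1)) * X 0)
    (hX : ∀ m : ℕ, X (m + 1) * gen (.L (-1)) = gen (.L (-1)) * X (m + 1) + ((m : ℂ) + 1) • X m)
    (h1 : X 1 • Ψ - η • Ψ ∈ E ω s) (h2 : ∀ m ≥ 2, X m • Ψ ∈ E ω s) (n m : ℕ) :
    X m • gen (.L (-1)) ^ n • Ψ - (fall n m • X 0 • gen (.L (-1)) ^ (n - m) • Ψ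
      + (m * η) • fall n (m - 1) • gen (.L (-1)) ^ (n - (m - 1)) • Ψ) ∈ E ω (n + s) := by
  have hu2 : ∀ k, gen (.L (-1)) • gen (.L (-1)) ^ k • Ψ = gen (.L (-1)) ^ (k + 1) • Ψ := fun k => by
    rw [← mul_smul, pow_succ']
  have hu1 : ∀ k, gen (.L (-1)) • X 0 • gen (.L (-1)) ^ k • Ψ = X 0 • gen (.L (-1)) ^ (k + 1) • Ψ :=
    fun k => by rw [← hu2, ← mul_smul, ← mul_smul (X 0), h0]
  induction n generalizing m with
  | zero =>
    rcases m with _ | _ | m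
    · simp [fall_zero]
    · simpa [fall] using h1
    · have e : ∀ k : ℕ, fall ((0 : ℕ) : ℂ) (k + 1) = 0 := fun k => by
        rw [fall_nat]; simp
      rw [show m + 1 + 1 - 1 = m + 1 from rfl, e, e]
      simpa using h2 (m + 2) (by omega)
  | succ n ih =>
    push_cast
    have r1 := fall_smul_rec hu1 n m
    have r2 := fall_smul_rec hu2 n (m - 1)
    rcases m with _ | k
    · have := gen_smul_E_succ (.L (-1)) (ih 0)
      rw [smul_sub, smul_add, smul_smul, ← h0, mul_smul, hu2] at this
      have e : (n : ℝ) + s + 1 = n + 1 + s := by ring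
      rw [e] at this
      simpa [fall_zero, hu1] using this
    · rw [Nat.add_sub_cancel] at r1 r2 ⊢
      -- Moving `X (k+1)` past one more `L_{-1}` adds `(k+1) X k`, so both sides satisfy the same
      -- recursion, and the errors grow by at most one unit of exponent.
      rw [← hu2, ← mul_smul, hX, add_smul, mul_smul, smul_assoc, ← r1, ← r2]
      have i1 := gen_smul_E_succ (.L (-1)) (ih (k + 1))
      have i2 := Submodule.smul_mem _ ((k : ℂ) + 1) (ih k)
      have i2' := E_mono ω (show n + s ≤ n + s + 1 by linarith) i2
      have := Submodule.add_mem _ i1 i2'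
      rw [show (n : ℝ) + s + 1 = n + 1 + s by ring, Nat.add_sub_cancel] at this
      convert this using 1
      simp only [smul_sub, smul_add, smul_comm_U _ (gen (.L (-1)))]
      push_cast
      generalize gen (.L (-1)) • X (k + 1) • gen (.L (-1)) ^ n • Ψ = v1
      generalize gen (.L (-1)) • X 0 • gen (.L (-1)) ^ (n - (k + 1)) • Ψ = v2
      generalize gen (.L (-1)) • gen (.L (-1)) ^ (n - k) • Ψ = v3
      generalize X k • gen (.L (-1)) ^ n • Ψ = v4
      generalize X 0 • gen (.L (-1)) ^ (n - k) • Ψ = v5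
      generalize gen (.L (-1)) ^ (n - (k - 1)) • Ψ = v6
      module

/-- The relation of `smul_L_pow` for the truncated action on `L_{-1}^b Ψ`. -/
theorem smul_powSeries {ω : Weight} {a : ℂ} {Θ : Series} {N : ℕ} {X : ℕ → U} {r : ℝ} {η : ℂ}
    (h0 : X 0 * gen (.L (-1)) = gen (.L (-1)) * X 0)
    (hX : ∀ m : ℕ, X (m + 1) * gen (.L (-1)) = gen (.L (-1)) * X (m + 1) + ((m : ℂ) + 1) • X m)
    (hE : ∀ m r, ∀ v ∈ E ω r, X m • v ∈ E ω (r + 1))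
    (h1 : X 1 • cutoff (vec ω) a Θ N - η • cutoff (vec ω) a Θ N ∈ E ω r)
    (h2 : ∀ m ≥ 2, X m • cutoff (vec ω) a Θ N ∈ E ω r) (hr : a.re - N + 1 ≤ r) (m : ℕ) (b : ℂ) :
    X m • powSeries ω a Θ N b - (fall b m • X 0 • powSeries ω a Θ N (b - m)
      + (m * η) • fall b (m - 1) • powSeries ω a Θ N (b - (m - 1 : ℕ))) ∈ E ω (b.re + r) := by
  set w := powSeries ω a Θ N with hw
  have hp : w ∈ PolyFam ω := powSeries_poly ω a Θ N
  have hq : (fun b => X m • w b - (fall b m • X 0 • w (b - m)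
      + (m * η) • fall b (m - 1) • w (b - (m - 1 : ℕ)))) ∈ PolyFam ω := by
    simp only [sub_eq_add_neg (_ : ℂ)]
    exact Submodule.sub_mem _ (PolyFam.smul hp _) (Submodule.add_mem _
      (PolyFam.fall_smul (PolyFam.smul (PolyFam.shift hp _) _) _)
      (Submodule.smul_mem _ _ (PolyFam.fall_smul (PolyFam.shift hp _) _)))
  -- Natural exponents suffice, and for these the truncated series may be replaced by `L_{-1}^n`
  -- applied to the cut-off vector.
  refine PolyFam.mem_E hq (fun n => ?_) b
  have hd : ∀ k : ℕ, gen (.L (-1)) ^ k • cutoff (vec ω) a Θ N - w k ∈ E ω (k + (a.re - N)) :=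
    fun k => powSeries_nat ω a Θ N k
  have hf : ∀ k : ℕ, ∀ f : ℂ → Verma ω, fall (n : ℂ) k • f (n - k) = fall (n : ℂ) k • f ((n - k : ℕ) : ℂ) := by
    intro k f
    rcases le_or_gt k n with h | h
    · rw [Nat.cast_sub h]
    · rw [fall_nat, Nat.descFactorial_eq_zero_iff_lt.2 h]; simp
  have hsub : ∀ k : ℕ, ((n - k : ℕ) : ℝ) ≤ n := fun k => by exact_mod_cast Nat.sub_le n k
  beta_reduce
  rw [hf m (fun b => X 0 • w b), hf (m - 1) w]
  have i0 := smul_L_pow h0 hX h1 h2 n m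
  have i1 : X m • (gen (.L (-1)) ^ n • cutoff (vec ω) a Θ N - w n) ∈ E ω (n + r) :=
    E_mono ω (by linarith) (hE m _ _ (hd n))
  have i2 : X 0 • (gen (.L (-1)) ^ (n - m) • cutoff (vec ω) a Θ N - w (n - m : ℕ)) ∈ E ω (n + r) :=
    E_mono ω (by have := hsub m; linarith) (hE 0 _ _ (hd (n - m)))
  have i3 : gen (.L (-1)) ^ (n - (m - 1)) • cutoff (vec ω) a Θ N - w (n - (m - 1) : ℕ) ∈ E ω (n + r) :=
    E_mono ω (by have := hsub (m - 1); linarith) (hd (n - (m - 1)))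
  have := Submodule.add_mem _ (Submodule.sub_mem _ i0 i1) (Submodule.add_mem _
    (Submodule.smul_mem _ (fall n m) i2) (Submodule.smul_mem _ ((m * η) * fall n (m - 1)) i3))
  convert this using 1
  simp only [smul_sub]
  generalize X m • gen (.L (-1)) ^ n • cutoff (vec ω) a Θ N = v1
  generalize X 0 • gen (.L (-1)) ^ (n - m) • cutoff (vec ω) a Θ N = v2
  generalize gen (.L (-1)) ^ (n - (m - 1)) • cutoff (vec ω) a Θ N = v3
  generalize X m • w n = v4
  generalize X 0 • w (n - m : ℕ) = v5
  module

theorem L_smul_powSeries (ω : Weight) (a : ℂ) (Θ : Series) (N : ℕ) (b : ℂ) :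
    gen (.L (-1)) • powSeries ω a Θ N b - powSeries ω a Θ N (b + 1)
      ∈ E ω (b.re + (a.re - N + 1)) := by
  have hp := powSeries_poly ω a Θ N
  refine PolyFam.mem_E (Submodule.sub_mem _ (PolyFam.smul hp _) (PolyFam.shift hp 1)) (fun n => ?_) b
  have i1 := gen_smul_E_succ (.L (-1)) (powSeries_nat ω a Θ N n)
  have i2 := powSeries_nat ω a Θ N (n + 1)
  rw [smul_sub, ← mul_smul, ← pow_succ'] at i1
  push_cast at i2
  rw [show (n : ℝ) + (a.re - N) + 1 = n + (a.re - N + 1) by ring] at i1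
  rw [show (n : ℝ) + 1 + (a.re - N) = n + (a.re - N + 1) by ring] at i2
  have := Submodule.sub_mem _ i2 i1
  rw [Pi.sub_apply]
  convert this using 1
  abel

/-! ### The highest weight relations for a singular vector -/

theorem order_le_E (ω : Weight) {b : ℂ} {r : ℝ} (h : b.re ≤ r) : order (vec ω) b ≤ E ω r := by
  rw [order_eq_supp]
  refine supp_mono ?_
  rintro ⟨X, _⟩ ⟨k, rfl⟩
  have : (0 : ℝ) ≤ k := Nat.cast_nonneg _
  rw [Set.mem_ofPred_eq]
  simp
  linarith

theorem idxLE_mono {m n : ℕ} (h : m ≤ n) : idxLE m ⊆ idxLE n := fun X hX => by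
  rw [mem_idxLE] at *; omega

instance : DecidableEq Idx := Classical.decEq _

theorem cutoff_sub {V : Type*} [AddCommGroup V] [Module U V] [Module ℂ V] (e : ℂ → V) (a : ℂ)
    (Θ : Series) {m n : ℕ} (h : m ≤ n) : cutoff e a Θ n - cutoff e a Θ m
      = ∑ X ∈ idxLE n \ idxLE m, Θ X • (mono X • e (a - (twoGrade X : ℂ) / 2)) := by
  rw [cutoff, cutoff, sub_eq_iff_eq_add, Finset.sum_sdiff (idxLE_mono h)]

theorem raising_gen {x : U} (hx : x ∈ raising) : ∃ g, x = gen g := by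
  obtain ⟨n, rfl | rfl | rfl | rfl⟩ := hx <;> exact ⟨_, rfl⟩

/-- The definition controls only cut-offs of one parity. For the other parity the next cut-off is
used; it differs by terms of doubled grade above `N`, which costs at most one unit of exponent. -/
theorem IsSingularOp.raise_E {ω : Weight} {ξ : Grade} {Θ : Series} (h : IsSingularOp ω ξ Θ) (N : ℕ)
    {x : U} (hx : x ∈ raising) : x • cutoff (vec ω) ξ.a Θ N ∈ E ω (ξ.a.re - N / 2 + 1) := by
  rcases Int.emod_two_eq_zero_or_one (N - ξ.p) with hN | hN
  · have := h.raise N (Int.ModEq.symm (Int.modEq_iff_dvd.2 (Int.dvd_of_emod_eq_zero hN))) x hx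
    exact order_le_E ω (by simp) this
  · have hp : ((N + 1 : ℕ) : ℤ) ≡ ξ.p [ZMOD 2] := by
      rw [Int.ModEq]; push_cast; omega
    have h1 := order_le_E ω (r := ξ.a.re - N / 2 + 1) (by simp; linarith) (h.raise (N + 1) hp x hx)
    have h2 : x • (cutoff (vec ω) ξ.a Θ (N + 1) - cutoff (vec ω) ξ.a Θ N)
        ∈ E ω (ξ.a.re - N / 2 + 1) := by
      obtain ⟨g, rfl⟩ := raising_gen hx
      refine gen_smul_E_succ g ?_
      rw [cutoff_sub _ _ _ (Nat.le_succ N)]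
      refine Submodule.sum_mem _ fun X hX => Submodule.smul_mem _ _ (mono_vec_mem_E ω X ?_)
      rw [Finset.mem_sdiff, mem_idxLE, mem_idxLE, not_le] at hX
      have : (N : ℝ) ≤ twoGrade X := by exact_mod_cast hX.2.le
      simp
      linarith
    have := Submodule.sub_mem _ h1 h2
    rwa [← smul_sub, sub_sub_cancel] at this

theorem L_neg_comm {x : Gen} : gen x * gen (.L (-1)) = gen (.L (-1)) * gen x - brk gen (.L (-1)) x := by
  rw [← comm_L_gen, comm]; abel

theorem gen_C_comm (u : U) : gen .C * u = u * gen .C := by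
  induction u using U_induction with
  | h1 c => exact (Algebra.commutes c _).symm
  | hg g =>
    rw [gen_exch .C g]
    cases g <;> simp [sgn, brk, Gen.odd]
  | ha u v hu hv => rw [mul_add, hu, hv, add_mul]
  | hm u v hu hv => rw [← mul_assoc, hu, mul_assoc, hv, mul_assoc]

theorem C_smul (ω : Weight) (v : Verma ω) : gen .C • v = ω.c • v := by
  obtain ⟨f, rfl⟩ := Submodule.Quotient.mk_surjective _ v
  induction f using Finsupp.induction_linear with
  | zero => rw [Submodule.Quotient.mk_zero]; simp
  | add f g hf hg => rw [Submodule.Quotient.mk_add, smul_add, hf, hg, smul_add]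
  | single b u => rw [mk_single, ← mul_smul, gen_C_comm, mul_smul, vec_C, smul_comm_U]

/-- Linear extension of the truncated action of a series on the symbols `L_{-1}^b`. -/
def seriesMap (ω : Weight) (a : ℂ) (Θ : Series) (N : ℕ) : (ℂ →₀ U) →ₗ[U] Verma ω :=
  Finsupp.linearCombination U (powSeries ω a Θ N)

theorem seriesMap_sym (ω : Weight) (a : ℂ) (Θ : Series) (N : ℕ) (b : ℂ) :
    seriesMap ω a Θ N (sym b) = powSeries ω a Θ N b := by
  simp [seriesMap, sym]

theorem seriesMap_smul (ω : Weight) (a : ℂ) (Θ : Series) (N : ℕ) (c : ℂ) (f : ℂ →₀ U) :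
    seriesMap ω a Θ N (c • f) = c • seriesMap ω a Θ N f := by
  rw [← algebraMap_smul U c f, map_smul, algebraMap_smul]

theorem eigen_powSeries {ω : Weight} {a : ℂ} {Θ : Series} {N : ℕ} {g : Gen} {η : ℂ}
    (hg : gen g * gen (.L (-1)) = gen (.L (-1)) * gen g)
    (h : gen g • cutoff (vec ω) a Θ N = η • cutoff (vec ω) a Θ N) (b : ℂ) :
    gen g • powSeries ω a Θ N b - η • powSeries ω a Θ N b ∈ E ω (b.re + (a.re - N + 1)) := by
  have hp := powSeries_poly ω a Θ N
  refine PolyFam.mem_E (Submodule.sub_mem _ (PolyFam.smul hp _) (Submodule.smul_mem _ η hp))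
    (fun n => ?_) b
  have i0 := powSeries_nat ω a Θ N n
  have i1 := gen_smul_E_succ g i0
  have i2 := E_mono ω (show n + (a.re - N) ≤ n + (a.re - N) + 1 by linarith)
    (Submodule.smul_mem _ η i0)
  have e : gen g • gen (.L (-1)) ^ n • cutoff (vec ω) a Θ N
      = η • gen (.L (-1)) ^ n • cutoff (vec ω) a Θ N := by
    rw [← mul_smul, ((show Commute (gen g) (gen (.L (-1))) from hg).pow_right n).eq, mul_smul, h,
      smul_comm_U]
  rw [smul_sub, e] at i1
  have := Submodule.sub_mem _ i2 i1
  rw [show (n : ℝ) + (a.re - N) + 1 = n + (a.re - N + 1) by ring] at this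
  convert this using 1
  simp only [Pi.sub_apply, Pi.smul_apply, smul_sub]
  abel

/-- The truncated series in place of the symbols satisfies the defining relations at the shifted
weight, with an error whose exponent falls linearly in `N`. This makes precise that a singular
vector is a highest weight vector. -/
theorem IsSingularOp.vermaRels_mem {ω ω' : Weight} {ξ : Grade} {Θ : Series} (h : IsSingularOp ω ξ Θ)
    (hω : Related ω ξ ω') {z : ℂ →₀ U} (hz : z ∈ vermaRels ω') :
    ∃ s : ℝ, ∀ N : ℕ, seriesMap ω ξ.a Θ N z ∈ E ω (s - N / 2) := by
  have hh : ω'.h = ω.h + ξ.a := by rw [← hω]; rfl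
  have hq : ω'.q = ω.q + ξ.p := by rw [← hω]; rfl
  have hc : ω'.c = ω.c := by rw [← hω]; rfl
  have hN : ∀ N : ℕ, ξ.a.re - N + 1 ≤ ξ.a.re - N / 2 + 1 := fun N => by
    have : (0 : ℝ) ≤ N := Nat.cast_nonneg _
    linarith
  obtain ⟨b, hz⟩ := hz
  refine ⟨b.re + ξ.a.re + 1, fun N => ?_⟩
  rw [show b.re + ξ.a.re + 1 - (N : ℝ) / 2 = b.re + (ξ.a.re - N / 2 + 1) by ring]
  have hR : ∀ n : ℕ, ∀ x, (x = gen (.L (n + 1)) ∨ x = gen (.T (n + 1)) ∨ x = gen (.Gp n) ∨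
      x = gen (.Gm n)) → x • cutoff (vec ω) ξ.a Θ N ∈ E ω (ξ.a.re - N / 2 + 1) :=
    fun n x hx => h.raise_E N ⟨n, hx⟩
  have hE : ∀ X : ℕ → Gen, ∀ m r, ∀ v ∈ E ω r, gen (X m) • v ∈ E ω (r + 1) :=
    fun X m r v hv => gen_smul_E_succ _ hv
  obtain rfl | rfl | ⟨m, rfl | rfl | rfl | rfl⟩ := hz
  · rw [map_sub, map_smul, seriesMap_sym, seriesMap_sym]
    exact E_mono ω (by linarith [hN N]) (L_smul_powSeries ω ξ.a Θ N b)
  · rw [map_sub, map_smul, seriesMap_smul, seriesMap_sym, C_smul, hc, sub_self]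
    exact Submodule.zero_mem _
  -- The ladder `L_{m-1}` starts with `L_{-1}`, has `L_0` with eigenvalue `h + a` in position `1`,
  -- and consists of raising operators from position `2` on.
  · have key := smul_powSeries (ω := ω) (a := ξ.a) (Θ := Θ) (N := N) (X := fun m : ℕ => gen (.L ((m : ℤ) - 1)))
      (r := ξ.a.re - N / 2 + 1) (η := ω'.h) rfl (fun m => by
        rw [L_neg_comm, brk]
        push_cast
        rw [show (-1 : ℤ) + ((m : ℤ) + 1 - 1) = m - 1 by ring]
        have e : (if (m : ℤ) - 1 = 0 then ((-1 : ℂ) ^ 3 - -1) / 12 else 0) = 0 := by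
          split_ifs <;> norm_num
        rw [e]
        generalize gen (.L (-1)) * gen (.L ((m : ℤ) + 1 - 1)) = v
        module) (hE _) (by
        have := h.weight N
        norm_num
        rw [this, hh, sub_self]
        exact Submodule.zero_mem _) (fun m hm => by
        obtain ⟨k, rfl⟩ : ∃ k, m = k + 2 := ⟨m - 2, by omega⟩
        refine hR k _ (Or.inl ?_)
        congr 2; push_cast; ring) (hN N) (m + 1) b
    -- Here `X 0` is `L_{-1}` itself and is absorbed into the exponent; this produces the second
    -- summand of the coefficient in the relation.
    have k2 := Submodule.smul_mem _ (fall b (m + 1)) (E_mono ω (s := b.re + (ξ.a.re - N / 2 + 1)) (by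
      have : (0 : ℝ) ≤ m := Nat.cast_nonneg _
      have := hN N
      simp; linarith) (L_smul_powSeries ω ξ.a Θ N (b - (m + 1 : ℕ))))
    rw [map_sub, map_smul, seriesMap_smul, seriesMap_sym, seriesMap_sym]
    have := Submodule.add_mem _ key k2
    convert this using 1
    simp only [Nat.cast_zero, zero_sub, Nat.add_sub_cancel]
    push_cast
    rw [show b - (m + 1) + 1 = b - m by ring, show (m : ℤ) + 1 - 1 = m by ring]
    generalize gen (.L (-1)) • powSeries ω ξ.a Θ N (b - (m + 1)) = v1
    generalize gen (.L (m : ℤ)) • powSeries ω ξ.a Θ N b = v2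
    module
  -- The ladder starts with `T_0`, and position `1` is already raising, so `η = 0`; afterwards `T_0`
  -- is replaced by its eigenvalue `q + p`.
  · have key := smul_powSeries (ω := ω) (a := ξ.a) (Θ := Θ) (N := N) (X := fun m : ℕ => gen (.T m))
      (r := ξ.a.re - N / 2 + 1) (η := 0) (by
        rw [L_neg_comm, brk]; simp) (fun m => by
        rw [L_neg_comm, brk]
        push_cast
        rw [show (-1 : ℤ) + ((m : ℤ) + 1) = m by ring]
        generalize gen (.L (-1)) * gen (.T ((m : ℤ) + 1)) = v
        module) (hE _) (by
        simpa using hR 0 (gen (.T 1)) (by simp)) (fun m hm => by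
        obtain ⟨k, rfl⟩ : ∃ k, m = k + 2 := ⟨m - 2, by omega⟩
        refine hR (k + 1) _ (Or.inr (Or.inl ?_))
        congr 2) (hN N) m b
    have k2 := Submodule.smul_mem _ (fall b m) (E_mono ω (s := b.re + (ξ.a.re - N / 2 + 1)) (by
      have : (0 : ℝ) ≤ m := Nat.cast_nonneg _
      have := hN N
      simp; linarith) (eigen_powSeries (g := .T 0) (by rw [L_neg_comm, brk]; simp) (h.charge N) (b - m)))
    rw [← hq] at k2
    rw [map_sub, map_smul, seriesMap_smul, seriesMap_sym, seriesMap_sym]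
    convert Submodule.add_mem _ key k2 using 1
    simp only [Nat.cast_zero]
    generalize gen (.T m) • powSeries ω ξ.a Θ N b = v1
    generalize gen (.T 0) • powSeries ω ξ.a Θ N (b - m) = v2
    module
  -- The ladder starts with `G⁺_{-1/2}`, which stays in front of the symbol as the relation
  -- requires.
  · have key := smul_powSeries (ω := ω) (a := ξ.a) (Θ := Θ) (N := N) (X := fun m : ℕ => gen (.Gp ((m : ℤ) - 1)))
      (r := ξ.a.re - N / 2 + 1) (η := 0) (by
        rw [L_neg_comm, brk]; norm_num) (fun m => by
        rw [L_neg_comm, brk]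
        push_cast
        rw [show (-1 : ℤ) + ((m : ℤ) + 1 - 1) = m - 1 by ring]
        generalize gen (.L (-1)) * gen (.Gp ((m : ℤ) + 1 - 1)) = v
        module) (hE _) (by
        simpa using hR 0 (gen (.Gp 0)) (by simp)) (fun m hm => by
        obtain ⟨k, rfl⟩ : ∃ k, m = k + 2 := ⟨m - 2, by omega⟩
        refine hR (k + 1) _ (Or.inr (Or.inr (Or.inl ?_)))
        congr 2; push_cast; ring) (hN N) (m + 1) b
    rw [map_sub, map_smul, seriesMap_smul, map_smul, seriesMap_sym, seriesMap_sym]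
    convert key using 1
    simp only [Nat.cast_zero, zero_sub, mul_zero, zero_smul, add_zero]
    push_cast
    rw [show (m : ℤ) + 1 - 1 = m by ring]
  · have key := smul_powSeries (ω := ω) (a := ξ.a) (Θ := Θ) (N := N) (X := fun m : ℕ => gen (.Gm ((m : ℤ) - 1)))
      (r := ξ.a.re - N / 2 + 1) (η := 0) (by
        rw [L_neg_comm, brk]; norm_num) (fun m => by
        rw [L_neg_comm, brk]
        push_cast
        rw [show (-1 : ℤ) + ((m : ℤ) + 1 - 1) = m - 1 by ring]
        generalize gen (.L (-1)) * gen (.Gm ((m : ℤ) + 1 - 1)) = v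
        module) (hE _) (by
        simpa using hR 0 (gen (.Gm 0)) (by simp)) (fun m hm => by
        obtain ⟨k, rfl⟩ : ∃ k, m = k + 2 := ⟨m - 2, by omega⟩
        refine hR (k + 1) _ (Or.inr (Or.inr (Or.inr ?_)))
        congr 2; push_cast; ring) (hN N) (m + 1) b
    rw [map_sub, map_smul, seriesMap_smul, map_smul, seriesMap_sym, seriesMap_sym]
    convert key using 1
    simp only [Nat.cast_zero, zero_sub, mul_zero, zero_smul, add_zero]
    push_cast
    rw [show (m : ℤ) + 1 - 1 = m by ring]

/-! ### Spans of words -/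

/-- The span of the words with a given property. -/
def wspan (P : List Gen → Prop) : Submodule ℂ U := Submodule.span ℂ (word '' {l | P l})

theorem word_mem_wspan {P : List Gen → Prop} {l : List Gen} (h : P l) : word l ∈ wspan P :=
  Submodule.subset_span ⟨l, h, rfl⟩

theorem adL_mem_wspan {P Q : List Gen → Prop}
    (h : ∀ l, P l → Q (.L (-1) :: l) ∧ Q (l ++ [.L (-1)])) {u : U} (hu : u ∈ wspan P) :
    adL u ∈ wspan Q := by
  have : wspan P ≤ (wspan Q).comap adL := by
    refine Submodule.span_le.2 ?_
    rintro _ ⟨l, hl, rfl⟩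
    have h1 := word_mem_wspan (h l hl).1
    have h2 := word_mem_wspan (h l hl).2
    rw [word_cons] at h1
    rw [word_append, word_cons, word_nil, mul_one] at h2
    exact Submodule.sub_mem _ h1 h2
  exact this hu

theorem wspan_smul {M : Type*} [AddCommGroup M] [Module U M] [Module ℂ M] [IsScalarTower ℂ U M]
    {P : List Gen → Prop} {v : M} {T : Submodule ℂ M}
    (h : ∀ l, P l → word l • v ∈ T) {u : U} (hu : u ∈ wspan P) : u • v ∈ T := by
  have : wspan P ≤ T.comap ((LinearMap.toSpanSingleton U M v).restrictScalars ℂ) := by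
    refine Submodule.span_le.2 ?_
    rintro _ ⟨l, hl, rfl⟩
    exact h l hl
  exact this hu

theorem Idx.low_letters (X : Idx) : ∀ x ∈ X.letters, x.Low :=
  fun x hx => Gen.not_tail_low (X.good_letters.2 x hx)

theorem adL_pow_mono_mem (Y : Idx) (i : ℕ) : (adL ^ i) (mono Y) ∈ wspan fun l =>
    (∀ x ∈ l, x.Low) ∧ (l.map Gen.gr).sum = twoGrade Y + 2 * i ∧ (l.map Gen.ch).sum = Y.ch := by
  induction i with
  | zero =>
    rw [pow_zero, Module.End.one_apply, mono_eq_word]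
    refine word_mem_wspan ⟨Y.low_letters, ?_, rfl⟩
    have := Y.gr_eq
    rw [Idx.gr] at this
    simpa using this
  | succ i ih =>
    rw [pow_succ', Module.End.mul_apply]
    refine adL_mem_wspan (fun l hl => ?_) ih
    obtain ⟨h1, h2, h3⟩ := hl
    have hL : (Gen.L (-1)).Low := by simp [Gen.Low]
    refine ⟨⟨?_, ?_, ?_⟩, ?_, ?_, ?_⟩
    · intro x hx
      rcases List.mem_cons.1 hx with rfl | hx
      exacts [hL, h1 x hx]
    · simp [h2, Gen.gr]; ring
    · simp [h3, Gen.ch]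
    · intro x hx
      rcases List.mem_append.1 hx with hx | hx
      · exact h1 x hx
      · rw [List.mem_singleton.1 hx]; exact hL
    · simp [h2, Gen.gr]; ring
    · simp [h3, Gen.ch]

/-! ### Operators and the extended Verma module -/

/-- The action of operators on the highest weight vector. -/
def toVerma (ω : Weight) : Ops →ₗ[U] Verma ω :=
  Submodule.mapQ _ _ LinearMap.id (Submodule.span_mono (by
    rintro _ ⟨a, rfl⟩
    exact ⟨a, Or.inl rfl⟩))

@[simp] theorem toVerma_pow (ω : Weight) (b : ℂ) : toVerma ω (pow b) = vec ω b := rfl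

theorem toVerma_smul (ω : Weight) (c : ℂ) (z : Ops) : toVerma ω (c • z) = c • toVerma ω z := by
  rw [← algebraMap_smul U c z, map_smul, algebraMap_smul]

/-- `toVerma` as a map of complex vector spaces. -/
def toVermaC (ω : Weight) : Ops →ₗ[ℂ] Verma ω where
  toFun := toVerma ω
  map_add' := map_add _
  map_smul' := toVerma_smul ω

theorem toVerma_cutoff (ω : Weight) (a : ℂ) (Θ : Series) (m : ℕ) :
    toVerma ω (cutoff pow a Θ m) = cutoff (vec ω) a Θ m := by
  simp only [cutoff, map_sum, toVerma_smul, map_smul, toVerma_pow]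

theorem pow_L_neg (b : ℂ) : gen (.L (-1)) • pow b = pow (b + 1) :=
  (Submodule.Quotient.eq _).2 (Submodule.subset_span ⟨b, rfl⟩)

/-- The only tail letter that sorting a lowering word can bring to the symbol is `L_{-1}`, whose
rule also holds for operators. The weight plays no role, so it is set to zero. -/
theorem low_word_pow {s : Set (Idx × ℂ)} (hs : ∀ X b, (X, b) ∈ s) {l : List Gen}
    (hl : ∀ x ∈ l, x.Low) (b : ℂ) :
    word l • pow b ∈ Submodule.span ℂ {z | ∃ X b, (X, b) ∈ s ∧ z = mono X • pow b} := by
  refine Tracked.mem (ω := ⟨0, 0, 0⟩) (S := Submodule.span ℂ {z | ∃ X b, (X, b) ∈ s ∧ z = mono X • pow b})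
    (tracked_low (Q := fun _ => True) fun _ _ => trivial) (fun u x b hx h => ?_) (fun X b _ => Submodule.subset_span ⟨X, b, hs X b, rfl⟩) ⟨hl, trivial⟩
  obtain rfl := (h.1 x (by simp)).eq_of_tail hx
  rw [ev_act_L_neg, pow_L_neg]

/-- Ordered monomials times powers of `L_{-1}` go to distinct basis vectors, so the order of an
operator in their span can be tested on the highest weight vector. -/
theorem mem_of_toVerma_mem {ω : Weight} {s : Set (Idx × ℂ)} {z : Ops}
    (hz : z ∈ Submodule.span ℂ {z | ∃ X b, ((X, b) : Idx × ℂ) ∈ Set.univ ∧ z = mono X • pow b})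
    (h : toVerma ω z ∈ supp ω s) :
    z ∈ Submodule.span ℂ {z | ∃ X b, (X, b) ∈ s ∧ z = mono X • pow b} := by
  obtain ⟨f, rfl⟩ : ∃ f : (Idx × ℂ) →₀ ℂ, Finsupp.linearCombination ℂ
      (fun p : Idx × ℂ => mono p.1 • pow p.2) f = z := by
    rw [← LinearMap.mem_range, Finsupp.range_linearCombination]
    refine Submodule.span_mono ?_ hz
    rintro _ ⟨X, b, -, rfl⟩
    exact ⟨(X, b), rfl⟩
  have e : toVerma ω (Finsupp.linearCombination ℂ (fun p : Idx × ℂ => mono p.1 • pow p.2) f)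
      = Finsupp.linearCombination ℂ (vb ω) f := by
    have := Finsupp.apply_linearCombination ℂ (toVermaC ω) (fun p : Idx × ℂ => mono p.1 • pow p.2) f
    refine this.trans ?_
    congr 2
    funext p
    rw [Function.comp_apply, vb_apply]
    exact map_smul (toVerma ω) _ _
  rw [e, mem_supp_iff] at h
  rw [Finsupp.linearCombination_apply]
  refine Submodule.sum_mem _ fun p hp => Submodule.smul_mem _ _ (Submodule.subset_span ⟨p.1, p.2, ?_, rfl⟩)
  refine h p ?_
  rw [(vb ω).repr_linearCombination]
  exact Finsupp.mem_support_iff.1 hp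

theorem toVerma_order {ω : Weight} {b : ℂ} {z : Ops} (hz : z ∈ order pow b) :
    toVerma ω z ∈ order (vec ω) b := by
  have : order pow b ≤ (order (vec ω) b).comap (toVermaC ω) := by
    refine Submodule.span_le.2 ?_
    rintro _ ⟨X, k, rfl⟩
    exact Submodule.subset_span ⟨X, k, map_smul (toVerma ω) _ _⟩
  exact this hz

theorem toVerma_prodTrunc (ω : Weight) (a₂ a₁ : ℂ) (Θ₂ Θ₁ : Series) (N : ℕ) :
    toVerma ω (prodTrunc a₂ Θ₂ a₁ Θ₁ N) = seriesMap ω a₁ Θ₁ N (cutoff sym a₂ Θ₂ N) := by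
  simp only [prodTrunc, cutoff, map_sum, toVerma_smul, seriesMap_smul, map_smul, seriesMap_sym,
    powSeries, mulTrunc, toVerma_pow, Finset.smul_sum, comm_iterate]
  refine Finset.sum_congr rfl fun X _ => Finset.sum_congr rfl fun Y _ =>
    Finset.sum_congr rfl fun i _ => ?_
  rw [smul_comm_U _ (mono X), smul_comm_U _ (mono X), mul_smul, mul_smul, ← add_sub_assoc]

/-! ### The coefficients of the product -/

theorem repr_cutoff (ω : Weight) (a : ℂ) (Θ : Series) (m : ℕ) (X : Idx) :
    (vb ω).repr (cutoff (vec ω) a Θ m) (X, a - (twoGrade X : ℂ) / 2)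
      = if twoGrade X ≤ m then Θ X else 0 := by
  simp only [cutoff, ← vb_apply, map_sum, map_smul, Module.Basis.repr_self, Finsupp.coe_finsetSum,
    Finset.sum_apply, Finsupp.smul_apply, smul_eq_mul]
  split_ifs with h
  · rw [Finset.sum_eq_single X]
    · simp
    · intro Y _ hY
      rw [Finsupp.single_eq_of_ne, mul_zero]
      intro h; exact hY (congrArg Prod.fst h).symm
    · intro h'; exact absurd (mem_idxLE.2 h) h'
  · refine Finset.sum_eq_zero fun Y hY => ?_
    rw [Finsupp.single_eq_of_ne, mul_zero]
    intro h'
    have : X = Y := congrArg Prod.fst h'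
    rw [this] at h
    exact h (mem_idxLE.1 hY)

/-- The index set of the basis vectors of a fixed total grade. -/
def grSet (a : ℂ) : Set (Idx × ℂ) := {p | 2 * p.2 + twoGrade p.1 = 2 * a}

theorem mem_grSet {a : ℂ} {p : Idx × ℂ} : p ∈ grSet a ↔ p.2 = a - (twoGrade p.1 : ℂ) / 2 := by
  rw [grSet, Set.mem_ofPred_eq]
  constructor
  · intro h; linear_combination h / 2
  · intro h; rw [h]; ring

theorem cutoff_mem_grSet (ω : Weight) (a : ℂ) (Θ : Series) (m : ℕ) :
    cutoff (vec ω) a Θ m ∈ supp ω (grSet a) :=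
  Submodule.sum_mem _ fun X _ => Submodule.smul_mem _ _ (mono_vec_mem_supp (mem_grSet.2 rfl))

theorem mono_smul_grSet {ω : Weight} (X : Idx) {a a' : ℂ} {v : Verma ω} (hv : v ∈ supp ω (grSet a))
    (h : a' = a + (twoGrade X : ℂ) / 2) : mono X • v ∈ supp ω (grSet a') := by
  have := supp_gr X.letters hv
  rw [mono_eq_word]
  refine supp_mono (fun p hp => ?_) this
  rw [Set.mem_ofPred_eq] at hp
  rw [grSet, Set.mem_ofPred_eq, hp, h, ← Idx.gr, Idx.gr_eq]
  push_cast; ring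

theorem vec_mem_supp (ω : Weight) {b : ℂ} {s : Set (Idx × ℂ)} (h : (idxOne, b) ∈ s) :
    vec ω b ∈ supp ω s := by
  have := mono_vec_mem_supp (ω := ω) h
  simpa [mono, idxOne] using this

theorem adL_pow_mono_vec_grSet (ω : Weight) (Y : Idx) (i : ℕ) {a b : ℂ}
    (h : a = b + (twoGrade Y : ℂ) / 2 + i) :
    (adL ^ i) (mono Y) • vec ω b ∈ supp ω (grSet a) := by
  refine wspan_smul (fun l hl => ?_) (adL_pow_mono_mem Y i)
  have := supp_gr (t := 2 * b) l (vec_mem_supp ω (b := b) (by simp [twoGrade, idxOne]))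
  refine supp_mono (fun p hp => ?_) this
  rw [Set.mem_ofPred_eq] at hp
  rw [grSet, Set.mem_ofPred_eq, hp, h, hl.2.1]
  push_cast; ring

theorem powSeries_grSet (ω : Weight) (a : ℂ) (Θ : Series) (N : ℕ) (b : ℂ) :
    powSeries ω a Θ N b ∈ supp ω (grSet (b + a)) :=
  Submodule.sum_mem _ fun Y _ => Submodule.smul_mem _ _ (Submodule.sum_mem _ fun i _ =>
    Submodule.smul_mem _ _ (adL_pow_mono_vec_grSet ω Y i (by ring)))

theorem seriesMap_cutoff (ω : Weight) (a₂ a₁ : ℂ) (Θ₂ Θ₁ : Series) (M N : ℕ) :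
    seriesMap ω a₁ Θ₁ N (cutoff sym a₂ Θ₂ M) =
      ∑ X ∈ idxLE M, Θ₂ X • mono X • powSeries ω a₁ Θ₁ N (a₂ - (twoGrade X : ℂ) / 2) := by
  simp only [cutoff, map_sum, seriesMap_smul, map_smul, seriesMap_sym]

/-- The truncated product, applied to the highest weight vector. -/
def prodVec (ω : Weight) (a₂ : ℂ) (Θ₂ : Series) (a₁ : ℂ) (Θ₁ : Series) (N : ℕ) : Verma ω :=
  toVerma ω (prodTrunc a₂ Θ₂ a₁ Θ₁ N)

theorem prodVec_grSet (ω : Weight) (a₂ : ℂ) (Θ₂ : Series) (a₁ : ℂ) (Θ₁ : Series) (N : ℕ) :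
    prodVec ω a₂ Θ₂ a₁ Θ₁ N ∈ supp ω (grSet (a₂ + a₁)) := by
  rw [prodVec, toVerma_prodTrunc, seriesMap_cutoff]
  exact Submodule.sum_mem _ fun X _ => Submodule.smul_mem _ _
    (mono_smul_grSet X (powSeries_grSet ω a₁ Θ₁ N _) (by ring))

theorem powSeries_sub_mem_E (ω : Weight) (a : ℂ) (Θ : Series) {M N : ℕ} (h : M ≤ N) (b : ℂ) :
    powSeries ω a Θ N b - powSeries ω a Θ M b ∈ E ω (b.re + a.re - M / 2 + 1) := by
  have hsplit : powSeries ω a Θ N b - powSeries ω a Θ M b =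
      (∑ Y ∈ idxLE N, Θ Y • ∑ i ∈ Finset.Ico (M + 1) (N + 1),
        binom b i • (adL ^ i) (mono Y) • vec ω (b + a - (twoGrade Y : ℂ) / 2 - i)) +
      ∑ Y ∈ idxLE N \ idxLE M, Θ Y • ∑ i ∈ Finset.range (M + 1),
        binom b i • (adL ^ i) (mono Y) • vec ω (b + a - (twoGrade Y : ℂ) / 2 - i) := by
    rw [powSeries, powSeries, ← Finset.sum_sdiff (idxLE_mono h) (f := fun Y => Θ Y •
      ∑ i ∈ Finset.range (N + 1),
        binom b i • (adL ^ i) (mono Y) • vec ω (b + a - (twoGrade Y : ℂ) / 2 - i)),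
      ← Finset.sum_sdiff (idxLE_mono h) (f := fun Y => Θ Y •
      ∑ i ∈ Finset.Ico (M + 1) (N + 1),
        binom b i • (adL ^ i) (mono Y) • vec ω (b + a - (twoGrade Y : ℂ) / 2 - i))]
    simp only [Finset.sum_Ico_eq_sub _ (Nat.succ_le_succ h), smul_sub, Finset.sum_sub_distrib]
    abel
  have hg : ∀ Y : Idx, (0 : ℝ) ≤ twoGrade Y := fun Y => Nat.cast_nonneg _
  have hM : (0 : ℝ) ≤ M := Nat.cast_nonneg _
  rw [hsplit]
  refine Submodule.add_mem _ (Submodule.sum_mem _ fun Y _ => Submodule.smul_mem _ _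
    (Submodule.sum_mem _ fun i hi => Submodule.smul_mem _ _ (adL_pow_mono_smul_E Y i (vec_mem_E ω ?_))))
    (Submodule.sum_mem _ fun Y hY => Submodule.smul_mem _ _
    (Submodule.sum_mem _ fun i hi => Submodule.smul_mem _ _ (adL_pow_mono_smul_E Y i (vec_mem_E ω ?_))))
  · have h1 : M ≤ i := by have := Finset.mem_Ico.1 hi; omega
    have h2 : (M : ℝ) ≤ i := by exact_mod_cast h1
    have := hg Y
    simp
    linarith
  · rw [Finset.mem_sdiff, mem_idxLE, mem_idxLE, not_le] at hY
    have h2 : (M : ℝ) ≤ twoGrade Y := by exact_mod_cast hY.2.le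
    have h3 : (0 : ℝ) ≤ i := Nat.cast_nonneg _
    simp
    linarith

theorem seriesMap_cutoff_sub_mem_E (ω : Weight) (a₂ a₁ : ℂ) (Θ₂ Θ₁ : Series) {M M' : ℕ}
    (h : M ≤ M') (N : ℕ) :
    seriesMap ω a₁ Θ₁ N (cutoff sym a₂ Θ₂ M') - seriesMap ω a₁ Θ₁ N (cutoff sym a₂ Θ₂ M)
      ∈ E ω (a₂.re + a₁.re - M / 2 + 2) := by
  rw [seriesMap_cutoff, seriesMap_cutoff, ← Finset.sum_sdiff (idxLE_mono h), add_sub_cancel_right]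
  refine Submodule.sum_mem _ fun X hX => Submodule.smul_mem _ _ ?_
  refine E_mono ω ?_ (mono_smul_E X (powSeries_mem_E ω a₁ Θ₁ N _))
  rw [Finset.mem_sdiff, mem_idxLE, mem_idxLE, not_le] at hX
  have h2 : (M : ℝ) ≤ twoGrade X := by exact_mod_cast hX.2.le
  simp
  linarith

theorem prodVec_sub_mem_E (ω : Weight) (a₂ : ℂ) (Θ₂ : Series) (a₁ : ℂ) (Θ₁ : Series) {M N : ℕ}
    (h : M ≤ N) : prodVec ω a₂ Θ₂ a₁ Θ₁ N - prodVec ω a₂ Θ₂ a₁ Θ₁ M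
      ∈ E ω (a₂.re + a₁.re - M / 2 + 2) := by
  rw [prodVec, prodVec, toVerma_prodTrunc, toVerma_prodTrunc]
  have h1 := seriesMap_cutoff_sub_mem_E ω a₂ a₁ Θ₂ Θ₁ h M
  have h2 : seriesMap ω a₁ Θ₁ N (cutoff sym a₂ Θ₂ N) - seriesMap ω a₁ Θ₁ M (cutoff sym a₂ Θ₂ N)
      ∈ E ω (a₂.re + a₁.re - M / 2 + 2) := by
    rw [seriesMap_cutoff, seriesMap_cutoff, ← Finset.sum_sub_distrib]
    refine Submodule.sum_mem _ fun X hX => ?_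
    rw [← smul_sub, ← smul_sub]
    refine Submodule.smul_mem _ _ (E_mono ω ?_ (mono_smul_E X (powSeries_sub_mem_E ω a₁ Θ₁ h _)))
    have : (0 : ℝ) ≤ twoGrade X := Nat.cast_nonneg _
    simp
    linarith
  have := Submodule.add_mem _ h2 h1
  rwa [sub_add_sub_cancel] at this

/-- The coefficients of the product. They are read off from the truncated products in the extended
Verma module of weight zero. -/
def prodSeries (a₂ : ℂ) (Θ₂ : Series) (a₁ : ℂ) (Θ₁ : Series) : Series := fun X =>
  (vb ⟨0, 0, 0⟩).repr (prodVec ⟨0, 0, 0⟩ a₂ Θ₂ a₁ Θ₁ (twoGrade X + 5))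
    (X, a₂ + a₁ - (twoGrade X : ℂ) / 2)

theorem prodTrunc_mem_span (a₂ : ℂ) (Θ₂ : Series) (a₁ : ℂ) (Θ₁ : Series) (N : ℕ) :
    prodTrunc a₂ Θ₂ a₁ Θ₁ N ∈
      Submodule.span ℂ {z | ∃ X b, ((X, b) : Idx × ℂ) ∈ Set.univ ∧ z = mono X • pow b} := by
  refine Submodule.sum_mem _ fun X _ => Submodule.sum_mem _ fun Y _ => Submodule.smul_mem _ _
    (Submodule.sum_mem _ fun i _ => Submodule.smul_mem _ _ ?_)
  rw [comm_iterate]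
  have : mono X * (adL ^ i) (mono Y) ∈ wspan fun l => ∀ x ∈ l, x.Low := by
    have h : wspan (fun l => (∀ x ∈ l, x.Low) ∧ (l.map Gen.gr).sum = twoGrade Y + 2 * i ∧
        (l.map Gen.ch).sum = Y.ch) ≤ (wspan fun l => ∀ x ∈ l, x.Low).comap
          (LinearMap.mulLeft ℂ (mono X)) := by
      refine Submodule.span_le.2 ?_
      rintro _ ⟨l, hl, rfl⟩
      change mono X * word l ∈ wspan fun l => ∀ x ∈ l, x.Low
      rw [mono_eq_word, ← word_append]
      refine word_mem_wspan fun x hx => ?_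
      rcases List.mem_append.1 hx with hx | hx
      exacts [X.low_letters x hx, hl.1 x hx]
    exact h (adL_pow_mono_mem Y i)
  exact wspan_smul (fun l hl => low_word_pow (fun _ _ => Set.mem_univ _) hl _) this

/-- Truncated products beyond `M` differ by exponents at most `a₂ + a₁ - M/2 + 2` in real part. The
offset `5` places the exponent of `X` strictly above this bound, so its coefficient is already
stable. -/
theorem repr_prodVec (a₂ : ℂ) (Θ₂ : Series) (a₁ : ℂ) (Θ₁ : Series) {N : ℕ} {X : Idx}
    (h : twoGrade X + 5 ≤ N) : (vb ⟨0, 0, 0⟩).repr (prodVec ⟨0, 0, 0⟩ a₂ Θ₂ a₁ Θ₁ N)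
      (X, a₂ + a₁ - (twoGrade X : ℂ) / 2) = prodSeries a₂ Θ₂ a₁ Θ₁ X := by
  rw [← sub_eq_zero, prodSeries, ← Finsupp.sub_apply, ← map_sub]
  by_contra hne
  have := mem_supp_iff.1 (prodVec_sub_mem_E ⟨0, 0, 0⟩ a₂ Θ₂ a₁ Θ₁ h) _ hne
  rw [Set.mem_ofPred_eq] at this
  simp at this
  linarith

/-- The product of two series exists and is unique. -/
theorem isCauchyProduct_iff (ξ₂ : Grade) (Θ₂ : Series) (ξ₁ : Grade) (Θ₁ : Series) (P : Series) :
    IsCauchyProduct ξ₂ Θ₂ ξ₁ Θ₁ P ↔ P = prodSeries ξ₂.a Θ₂ ξ₁.a Θ₁ := by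
  constructor
  · intro h
    funext X
    obtain ⟨N₀, hN⟩ := h (twoGrade X + 1)
    have h1 := toVerma_order (ω := ⟨0, 0, 0⟩) (hN _ (le_max_left N₀ (twoGrade X + 5)))
    rw [map_sub, toVerma_cutoff, order_eq_supp] at h1
    rw [← repr_prodVec ξ₂.a Θ₂ ξ₁.a Θ₁ (le_max_right N₀ (twoGrade X + 5))]
    have h2 := repr_cutoff ⟨0, 0, 0⟩ (ξ₂.a + ξ₁.a) P (max N₀ (twoGrade X + 5)) X
    rw [if_pos (by omega)] at h2
    rw [← h2, eq_comm, ← sub_eq_zero, ← Finsupp.sub_apply, ← map_sub]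
    by_contra hne
    obtain ⟨k, hk⟩ := mem_supp_iff.1 h1 _ hne
    have := congrArg Complex.re hk
    simp at this
    have hk : (0 : ℝ) ≤ k := Nat.cast_nonneg _
    have hg : (0 : ℝ) ≤ twoGrade X := Nat.cast_nonneg _
    linarith
  · rintro rfl K
    refine ⟨2 * K + 5, fun N hN => ?_⟩
    have hspan : prodTrunc ξ₂.a Θ₂ ξ₁.a Θ₁ N - cutoff pow (ξ₂.a + ξ₁.a) (prodSeries ξ₂.a Θ₂ ξ₁.a Θ₁) N ∈
        Submodule.span ℂ {z | ∃ X b, ((X, b) : Idx × ℂ) ∈ Set.univ ∧ z = mono X • pow b} :=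
      Submodule.sub_mem _ (prodTrunc_mem_span _ _ _ _ _) (Submodule.sum_mem _ fun X _ =>
        Submodule.smul_mem _ _ (Submodule.subset_span ⟨X, _, Set.mem_univ _, rfl⟩))
    have key := mem_of_toVerma_mem (ω := ⟨0, 0, 0⟩)
      (s := {p | ∃ k : ℕ, p.2 = ξ₂.a + ξ₁.a - K - (k : ℂ) / 2}) hspan ?_
    · refine Submodule.span_mono ?_ key
      rintro _ ⟨X, _, ⟨k, rfl⟩, rfl⟩
      exact ⟨X, k, rfl⟩
    · rw [map_sub, toVerma_cutoff]
      refine mem_supp_iff.2 fun p hp => ?_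
      have hg := mem_grSet.1 (mem_supp_iff.1 (Submodule.sub_mem _
        (prodVec_grSet ⟨0, 0, 0⟩ ξ₂.a Θ₂ ξ₁.a Θ₁ N)
        (cutoff_mem_grSet _ _ (prodSeries ξ₂.a Θ₂ ξ₁.a Θ₁) N)) p hp)
      obtain ⟨X, b⟩ := p
      change b = ξ₂.a + ξ₁.a - (twoGrade X : ℂ) / 2 at hg
      subst hg
      -- Only monomials whose coefficient has not yet stabilised can survive. As `N ≥ 2 * K + 5`,
      -- their grade exceeds `K`, which is the required order.
      have hX : N < twoGrade X + 5 := by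
        by_contra hle
        apply hp
        rw [map_sub, Finsupp.sub_apply, repr_cutoff, if_pos (by omega), sub_eq_zero]
        exact repr_prodVec _ _ _ _ (by omega)
      refine ⟨twoGrade X - 2 * K, ?_⟩
      rw [Nat.cast_sub (by omega)]
      push_cast; ring

/-! ### Eigenvalues of the zero modes -/

theorem L_zero_word_vec (ω : Weight) (l : List Gen) (b : ℂ) : gen (.L 0) • word l • vec ω b
    = (ω.h + b + (((l.map Gen.gr).sum : ℤ) : ℂ) / 2) • word l • vec ω b := by
  induction l with
  | nil =>
    have := vec_L ω b 0
    simp [fall] at this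
    simp [this]
  | cons x l ih =>
    have e : gen (.L 0) * gen x = gen x * gen (.L 0) + ((x.gr : ℂ) / 2) • gen x := by
      rw [gen_exch (.L 0) x]
      cases x <;> simp [sgn, brk, Gen.odd, Gen.gr] <;> intros <;> ring_nf <;> simp
    rw [word_cons, ← mul_smul, ← mul_assoc, e, add_mul, add_smul, mul_assoc, mul_smul,
      mul_smul (gen (.L 0)), ih, smul_comm_U, ← mul_smul, smul_mul_assoc, smul_assoc, ← add_smul]
    congr 1
    simp only [List.map_cons, List.sum_cons]
    push_cast; ring

theorem T_zero_word_vec (ω : Weight) (l : List Gen) (b : ℂ) : gen (.T 0) • word l • vec ω b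
    = (ω.q + (((l.map Gen.ch).sum : ℤ) : ℂ)) • word l • vec ω b := by
  induction l with
  | nil =>
    have := vec_T ω b 0
    simp [fall] at this
    simp [this]
  | cons x l ih =>
    have e : gen (.T 0) * gen x = gen x * gen (.T 0) + (x.ch : ℂ) • gen x := by
      rw [gen_exch (.T 0) x]
      cases x <;> simp [sgn, brk, Gen.odd, Gen.ch]
    rw [word_cons, ← mul_smul, ← mul_assoc, e, add_mul, add_smul, mul_assoc, mul_smul,
      mul_smul (gen (.T 0)), ih, smul_comm_U, ← mul_smul, smul_mul_assoc, smul_assoc, ← add_smul]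
    congr 1
    simp only [List.map_cons, List.sum_cons]
    push_cast; ring

theorem L_zero_cutoff (ω : Weight) (a : ℂ) (Θ : Series) (m : ℕ) :
    gen (.L 0) • cutoff (vec ω) a Θ m = (ω.h + a) • cutoff (vec ω) a Θ m := by
  rw [cutoff, Finset.smul_sum, Finset.smul_sum]
  refine Finset.sum_congr rfl fun X _ => ?_
  rw [smul_comm_U, mono_eq_word, L_zero_word_vec, smul_comm (ω.h + a), ← Idx.gr, Idx.gr_eq]
  congr 2
  push_cast; ring

theorem T_zero_cutoff (ω : Weight) (a : ℂ) (Θ : Series) (m : ℕ) :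
    gen (.T 0) • cutoff (vec ω) a Θ m
      = cutoff (vec ω) a (fun X => (ω.q + X.ch) * Θ X) m := by
  rw [cutoff, cutoff, Finset.smul_sum]
  refine Finset.sum_congr rfl fun X _ => ?_
  rw [smul_comm_U, mono_eq_word, T_zero_word_vec, smul_smul, mul_comm, ← Idx.ch]

theorem cutoff_smul {V : Type*} [AddCommGroup V] [Module U V] [Module ℂ V] (e : ℂ → V) (a c : ℂ)
    (Θ : Series) (m : ℕ) : cutoff e a (c • Θ) m = c • cutoff e a Θ m := by
  simp only [cutoff, Finset.smul_sum, smul_smul, Pi.smul_apply, smul_eq_mul]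

/-- `T_0` is diagonal in the basis, with the charge of the monomial added to `q`, so the eigenvalue
equation fixes the charge of each occurring monomial. -/
theorem IsSingularOp.ch_eq {ω : Weight} {ξ : Grade} {Θ : Series} (h : IsSingularOp ω ξ Θ) {X : Idx}
    (hX : Θ X ≠ 0) : X.ch = ξ.p := by
  have h1 := h.charge (twoGrade X)
  rw [T_zero_cutoff, ← cutoff_smul] at h1
  have h2 := repr_cutoff ω ξ.a (fun X => (ω.q + X.ch) * Θ X) (twoGrade X) X
  rw [h1, repr_cutoff, if_pos le_rfl, if_pos le_rfl, Pi.smul_apply, smul_eq_mul] at h2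
  have h3 := add_left_cancel (mul_right_cancel₀ hX h2)
  exact_mod_cast h3.symm

theorem T_zero_cutoff_of_ch {ω : Weight} {p : ℤ} {a : ℂ} {Θ : Series}
    (h : ∀ X, Θ X ≠ 0 → X.ch = p) (m : ℕ) :
    gen (.T 0) • cutoff (vec ω) a Θ m = (ω.q + p) • cutoff (vec ω) a Θ m := by
  rw [T_zero_cutoff, ← cutoff_smul]
  congr 1
  funext X
  by_cases hX : Θ X = 0
  · simp [hX]
  · simp [h X hX]

theorem IsSingularOp.smul {ω : Weight} {ξ : Grade} {Θ : Series} (h : IsSingularOp ω ξ Θ) (c : ℂ) :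
    IsSingularOp ω ξ (c • Θ) where
  weight m := by rw [cutoff_smul, smul_comm_U, h.weight, smul_comm]
  charge m := by rw [cutoff_smul, smul_comm_U, h.charge, smul_comm]
  raise m hm x hx := by
    rw [cutoff_smul, smul_comm_U]
    exact Submodule.smul_mem _ _ (h.raise m hm x hx)

/-! ### The charge of the product -/

theorem mono_smul_ch {ω : Weight} (X : Idx) {p : ℤ} {v : Verma ω}
    (hv : v ∈ supp ω {q | q.1.ch = p}) : mono X • v ∈ supp ω {q | q.1.ch = X.ch + p} := by
  have := supp_ch X.letters hv
  rw [mono_eq_word, add_comm]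
  exact this

theorem powSeries_ch (ω : Weight) (a : ℂ) {Θ : Series} {p : ℤ} (h : ∀ X, Θ X ≠ 0 → X.ch = p)
    (N : ℕ) (b : ℂ) : powSeries ω a Θ N b ∈ supp ω {q | q.1.ch = p} := by
  refine Submodule.sum_mem _ fun Y _ => ?_
  by_cases hY : Θ Y = 0
  · rw [hY, zero_smul]; exact Submodule.zero_mem _
  refine Submodule.smul_mem _ _ (Submodule.sum_mem _ fun i _ => Submodule.smul_mem _ _ ?_)
  refine wspan_smul (fun l hl => ?_) (adL_pow_mono_mem Y i)
  have := supp_ch (t := 0) l (vec_mem_supp ω (b := b + a - (twoGrade Y : ℂ) / 2 - i)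
    (by simp [Idx.ch_eq, idxOne]))
  rwa [hl.2.2, h Y hY, zero_add] at this

theorem prodSeries_ch {a₂ a₁ : ℂ} {Θ₂ Θ₁ : Series} {p₂ p₁ : ℤ} (h₂ : ∀ X, Θ₂ X ≠ 0 → X.ch = p₂)
    (h₁ : ∀ X, Θ₁ X ≠ 0 → X.ch = p₁) {X : Idx} (hX : prodSeries a₂ Θ₂ a₁ Θ₁ X ≠ 0) :
    X.ch = p₂ + p₁ := by
  have : prodVec ⟨0, 0, 0⟩ a₂ Θ₂ a₁ Θ₁ (twoGrade X + 5) ∈ supp _ {q | q.1.ch = p₂ + p₁} := by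
    rw [prodVec, toVerma_prodTrunc, seriesMap_cutoff]
    refine Submodule.sum_mem _ fun Y _ => ?_
    by_cases hY : Θ₂ Y = 0
    · rw [hY, zero_smul]; exact Submodule.zero_mem _
    · have := mono_smul_ch Y (powSeries_ch ⟨0, 0, 0⟩ a₁ h₁ (twoGrade X + 5) (a₂ - (twoGrade Y : ℂ) / 2))
      rw [h₂ Y hY] at this
      exact Submodule.smul_mem _ _ this
  exact mem_supp_iff.1 this _ hX

/-! ### The product of singular vector operators -/

theorem IsSingularOp.null_rels {ω ω' : Weight} {ξ : Grade} {Θ : Series} (h : IsSingularOp ω ξ Θ)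
    (hω : Related ω ξ ω') {z : ℂ →₀ U} (hz : z ∈ Submodule.span U (vermaRels ω')) :
    Null fun N => seriesMap ω ξ.a Θ N z := by
  induction hz using Submodule.span_induction with
  | mem z hz =>
    obtain ⟨s, hs⟩ := h.vermaRels_mem hω hz
    exact Null.of_bound hs
  | zero => exact fun r => ⟨0, fun N _ => by simp⟩
  | add y z _ _ hy hz => simpa only [map_add] using hy.add hz
  | smul u z _ hz => simpa only [map_smul] using hz.smul u

theorem exists_sym_lift {ω : Weight} {b : ℂ} {v : Verma ω} (hv : v ∈ order (vec ω) b) :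
    ∃ g ∈ order sym b, (Submodule.Quotient.mk g : Verma ω) = v := by
  induction hv using Submodule.span_induction with
  | mem v hv =>
    obtain ⟨X, k, rfl⟩ := hv
    exact ⟨mono X • sym (b - (k : ℂ) / 2), Submodule.subset_span ⟨X, k, rfl⟩, rfl⟩
  | zero => exact ⟨0, Submodule.zero_mem _, rfl⟩
  | add v w _ _ hv hw =>
    obtain ⟨f, hf, rfl⟩ := hv
    obtain ⟨g, hg, rfl⟩ := hw
    exact ⟨f + g, Submodule.add_mem _ hf hg, rfl⟩
  | smul c v _ hv =>
    obtain ⟨f, hf, rfl⟩ := hv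
    exact ⟨c • f, Submodule.smul_mem _ _ hf, rfl⟩

theorem seriesMap_order_mem_E (ω : Weight) (a : ℂ) (Θ : Series) (N : ℕ) {b : ℂ} {g : ℂ →₀ U}
    (hg : g ∈ order sym b) : seriesMap ω a Θ N g ∈ E ω (b.re + a.re + 2) := by
  induction hg using Submodule.span_induction with
  | mem v hv =>
    obtain ⟨X, k, rfl⟩ := hv
    rw [map_smul, seriesMap_sym]
    refine E_mono ω ?_ (mono_smul_E X (powSeries_mem_E ω a Θ N _))
    have : (0 : ℝ) ≤ k := Nat.cast_nonneg _
    simp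
    linarith
  | zero => rw [map_zero]; exact Submodule.zero_mem _
  | add v w _ _ hv hw => rw [map_add]; exact Submodule.add_mem _ hv hw
  | smul c v _ hv => rw [seriesMap_smul]; exact Submodule.smul_mem _ _ hv

theorem mk_cutoff_sym (ω : Weight) (a : ℂ) (Θ : Series) (m : ℕ) :
    (Submodule.Quotient.mk (cutoff sym a Θ m) : Verma ω) = cutoff (vec ω) a Θ m := by
  have : ∀ s : Finset Idx, (Submodule.Quotient.mk (∑ X ∈ s, Θ X •
      (mono X • sym (a - (twoGrade X : ℂ) / 2))) : Verma ω)
        = ∑ X ∈ s, Θ X • (mono X • vec ω (a - (twoGrade X : ℂ) / 2)) := by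
    intro s
    induction s using Finset.induction_on with
    | empty => rfl
    | insert X s hX ih =>
      rw [Finset.sum_insert hX, Finset.sum_insert hX, ← ih]
      rfl
  exact this _

/-- Singularity of `Θ₂` says that `x` applied to a cut-off is of low order modulo the relations of
weight `ω₂`. Under `seriesMap` for `Θ₁` the relations become null and low order stays low, while
replacing the cut-off `M` by `N` costs little. -/
theorem null_raise_prodVec {ω₁ ω₂ : Weight} {ξ₁ ξ₂ : Grade} {Θ₁ Θ₂ : Series}
    (h₁ : IsSingularOp ω₁ ξ₁ Θ₁) (h₂ : IsSingularOp ω₂ ξ₂ Θ₂) (hω : Related ω₁ ξ₁ ω₂) {x : U}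
    (hx : x ∈ raising) : Null fun N => x • prodVec ω₁ ξ₂.a Θ₂ ξ₁.a Θ₁ N := by
  intro r
  obtain ⟨K, hK⟩ := exists_nat_ge (2 * (ξ₂.a.re + ξ₁.a.re + 3 - r))
  obtain ⟨M, hM, hMp⟩ : ∃ M ≥ K, (M : ℤ) ≡ ξ₂.p [ZMOD 2] := by
    rcases Int.emod_two_eq_zero_or_one (K - ξ₂.p) with h | h
    · exact ⟨K, le_rfl, by rw [Int.ModEq]; omega⟩
    · exact ⟨K + 1, by omega, by rw [Int.ModEq]; push_cast; omega⟩
  have hM' : (K : ℝ) ≤ M := by exact_mod_cast hM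
  obtain ⟨g, hg, hgv⟩ := exists_sym_lift (h₂.raise M hMp x hx)
  have hrel : x • cutoff sym ξ₂.a Θ₂ M - g ∈ Submodule.span U (vermaRels ω₂) := by
    rw [← Submodule.Quotient.eq, hgv, ← mk_cutoff_sym]
    rfl
  obtain ⟨N₀, hN₀⟩ := h₁.null_rels hω hrel r
  refine ⟨max N₀ M, fun N hN => ?_⟩
  have i1 := hN₀ N (le_of_max_le_left hN)
  have i2 := E_mono ω₁ (s := r) (by simp; linarith) (seriesMap_order_mem_E ω₁ ξ₁.a Θ₁ N hg)
  have i3 : x • (seriesMap ω₁ ξ₁.a Θ₁ N (cutoff sym ξ₂.a Θ₂ N)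
      - seriesMap ω₁ ξ₁.a Θ₁ N (cutoff sym ξ₂.a Θ₂ M)) ∈ E ω₁ r := by
    obtain ⟨y, rfl⟩ := raising_gen hx
    exact E_mono ω₁ (by linarith) (gen_smul_E_succ y
      (seriesMap_cutoff_sub_mem_E ω₁ ξ₂.a ξ₁.a Θ₂ Θ₁ (le_of_max_le_right hN) N))
  have := Submodule.add_mem _ (Submodule.add_mem _ i1 i2) i3
  beta_reduce at this
  rw [map_sub, sub_add_cancel, map_smul, smul_sub, add_sub_cancel] at this
  rwa [← toVerma_prodTrunc] at this

theorem null_prodVec_sub_cutoff (ω : Weight) (ξ₂ ξ₁ : Grade) (Θ₂ Θ₁ : Series) :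
    Null fun N => prodVec ω ξ₂.a Θ₂ ξ₁.a Θ₁ N
      - cutoff (vec ω) (ξ₂.a + ξ₁.a) (prodSeries ξ₂.a Θ₂ ξ₁.a Θ₁) N := by
  intro r
  obtain ⟨K, hK⟩ := exists_nat_ge (ξ₂.a.re + ξ₁.a.re - r)
  obtain ⟨N₀, hN₀⟩ := (isCauchyProduct_iff ξ₂ Θ₂ ξ₁ Θ₁ _).2 rfl K
  refine ⟨N₀, fun N hN => ?_⟩
  have := toVerma_order (ω := ω) (hN₀ N hN)
  rw [map_sub, toVerma_cutoff] at this
  exact order_le_E ω (by simp; linarith) this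

theorem raising_gr {x : U} (hx : x ∈ raising) : ∃ g : Gen, x = gen g ∧ g.gr ≤ 0 := by
  obtain ⟨n, rfl | rfl | rfl | rfl⟩ := hx <;> refine ⟨_, rfl, ?_⟩ <;> simp only [Gen.gr] <;> omega

/-- A fixed total grade confines the exponents to `a + ½ℤ`, so a bound on real parts turns into a
statement about half-integer steps. -/
theorem mem_order_of_mem_E {ω : Weight} {a : ℂ} {t : ℤ} {m : ℕ} {v : Verma ω}
    (h : v ∈ supp ω {p | 2 * p.2 + twoGrade p.1 = 2 * a + t})
    (h' : v ∈ E ω (a.re - m / 2)) : v ∈ order (vec ω) (a - (m : ℂ) / 2) := by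
  rw [order_eq_supp]
  refine supp_mono (fun p hp => ?_) (supp_inter h h')
  obtain ⟨h1, h2⟩ := hp
  rw [Set.mem_ofPred_eq] at *
  have e : p.2 = a + ((t - twoGrade p.1 : ℤ) : ℂ) / 2 := by
    push_cast
    linear_combination h1 / 2
  have e2 : ((t - twoGrade p.1 : ℤ) : ℝ) ≤ ((-m : ℤ) : ℝ) := by
    have := congrArg Complex.re e
    simp at this
    push_cast
    linarith
  have e3 : t - twoGrade p.1 ≤ -(m : ℤ) := by exact_mod_cast e2
  refine ⟨(-(t - twoGrade p.1) - m).toNat, ?_⟩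
  have e4 : (((-(t - twoGrade p.1) - m).toNat : ℤ) : ℂ) = ((-(t - twoGrade p.1) - m : ℤ) : ℂ) := by
    rw [Int.toNat_of_nonneg (by omega)]
  rw [Int.cast_natCast] at e4
  rw [e4, e]
  push_cast; ring

theorem IsSingularOp.prod {ω₁ ω₂ : Weight} {ξ₁ ξ₂ : Grade} {Θ₁ Θ₂ : Series}
    (h₁ : IsSingularOp ω₁ ξ₁ Θ₁) (h₂ : IsSingularOp ω₂ ξ₂ Θ₂) (hω : Related ω₁ ξ₁ ω₂) :
    IsSingularOp ω₁ (ξ₁.add ξ₂) (prodSeries ξ₂.a Θ₂ ξ₁.a Θ₁) := by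
  have hch : ∀ X, prodSeries ξ₂.a Θ₂ ξ₁.a Θ₁ X ≠ 0 → X.ch = (ξ₁.add ξ₂).p := fun X hX => by
    rw [prodSeries_ch (fun X => h₂.ch_eq) (fun X => h₁.ch_eq) hX, add_comm]; rfl
  have ha : (ξ₁.add ξ₂).a = ξ₂.a + ξ₁.a := add_comm _ _
  refine ⟨L_zero_cutoff _ _ _, T_zero_cutoff_of_ch hch, fun m hm x hx => ?_⟩
  obtain ⟨g, rfl, -⟩ := raising_gr hx
  rw [ha]
  refine mem_order_of_mem_E (t := g.gr) ?_ ?_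
  · have := supp_gr [g] (cutoff_mem_grSet ω₁ (ξ₂.a + ξ₁.a) (prodSeries ξ₂.a Θ₂ ξ₁.a Θ₁) m)
    simpa using this
  set r := (ξ₂.a + ξ₁.a).re - m / 2 with hr
  obtain ⟨N₁, h1⟩ := null_raise_prodVec h₁ h₂ hω hx r
  obtain ⟨N₂, h2⟩ := (null_prodVec_sub_cutoff ω₁ ξ₂ ξ₁ Θ₂ Θ₁).smul (gen g) r
  set N := max (max N₁ N₂) m with hN
  have i1 := h1 N ((le_max_left _ _).trans (le_max_left _ _))
  have i2 := h2 N ((le_max_right _ _).trans (le_max_left _ _))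
  -- By parity the first term beyond the cut-off has doubled grade at least `m + 2`. That extra unit
  -- of exponent pays for the unit lost to `gen g`.
  have i3 : gen g • (cutoff (vec ω₁) (ξ₂.a + ξ₁.a) (prodSeries ξ₂.a Θ₂ ξ₁.a Θ₁) N
      - cutoff (vec ω₁) (ξ₂.a + ξ₁.a) (prodSeries ξ₂.a Θ₂ ξ₁.a Θ₁) m) ∈ E ω₁ r := by
    rw [show r = r - 1 + 1 by ring]
    refine gen_smul_E_succ g ?_
    rw [cutoff_sub _ _ _ (le_max_right _ _)]
    refine Submodule.sum_mem _ fun X hX => ?_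
    by_cases hX0 : prodSeries ξ₂.a Θ₂ ξ₁.a Θ₁ X = 0
    · rw [hX0, zero_smul]; exact Submodule.zero_mem _
    refine Submodule.smul_mem _ _ (mono_vec_mem_E ω₁ X ?_)
    rw [Finset.mem_sdiff, mem_idxLE, mem_idxLE, not_le] at hX
    have h3 := X.gr_modEq_ch
    rw [hch X hX0] at h3
    have h4 : m + 2 ≤ twoGrade X := by
      have := h3.trans hm.symm
      rw [Int.ModEq] at this
      omega
    have : ((m + 2 : ℕ) : ℝ) ≤ twoGrade X := by exact_mod_cast h4
    push_cast at this
    rw [hr]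
    simp
    linarith
  have := Submodule.sub_mem _ (Submodule.sub_mem _ i1 i2) i3
  beta_reduce at this
  rwa [smul_sub, smul_sub, sub_sub_cancel, sub_sub_cancel] at this

/-! ### The leading coefficients of the product -/

theorem wspan_mul {P Q R : List Gen → Prop} (h : ∀ l l', P l → Q l' → R (l ++ l')) {u v : U}
    (hu : u ∈ wspan P) (hv : v ∈ wspan Q) : u * v ∈ wspan R := by
  have := Submodule.mul_mem_mul hu hv
  rw [wspan, wspan, Submodule.span_mul_span] at this
  refine Submodule.span_le.2 ?_ this
  rintro _ ⟨_, ⟨l, hl, rfl⟩, _, ⟨l', hl', rfl⟩, rfl⟩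
  change word l * word l' ∈ wspan R
  rw [← word_append]
  exact word_mem_wspan (h l l' hl hl')

theorem wspan_mono {P Q : List Gen → Prop} (h : ∀ l, P l → Q l) : wspan P ≤ wspan Q :=
  Submodule.span_mono (Set.image_mono h)

/-- Words in lowering letters. -/
def LowW (l : List Gen) : Prop := ∀ x ∈ l, x.Low

/-- Words in lowering letters with a letter other than `L_{-1}` and `G^±_{-1/2}`. -/
def NpW (l : List Gen) : Prop := (∀ x ∈ l, x.Low) ∧ ∃ x ∈ l, x.Np

theorem LowW.append {l l' : List Gen} (h : LowW l) (h' : LowW l') : LowW (l ++ l') := fun x hx => by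
  rcases List.mem_append.1 hx with hx | hx
  exacts [h x hx, h' x hx]

theorem NpW.append {l l' : List Gen} (h : LowW l) (h' : LowW l') (hn : NpW l ∨ NpW l') :
    NpW (l ++ l') := by
  refine ⟨h.append h', ?_⟩
  rcases hn with ⟨-, x, hx, hn⟩ | ⟨-, x, hx, hn⟩
  · exact ⟨x, by simp [hx], hn⟩
  · exact ⟨x, by simp [hx], hn⟩

/-- A bracket of `L_{-1}` with a lowering letter has total mode below `-1`, or vanishes. Commutator
terms therefore never contribute to the leading part. -/
theorem adL_word_mem {l : List Gen} (h : LowW l) : adL (word l) ∈ wspan NpW := by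
  induction l with
  | nil =>
    have : adL (word []) = 0 := by simp [adL_apply, comm]
    rw [this]
    exact Submodule.zero_mem _
  | cons x l ih =>
    have hx : x.Low := h x (by simp)
    have hl : LowW l := fun y hy => h y (by simp [hy])
    rw [word_cons, adL_mul]
    refine Submodule.add_mem _ (wspan_mul (P := NpW) (Q := LowW)
      (fun _ _ h h' => NpW.append h.1 h' (Or.inl h)) ?_ (word_mem_wspan hl))
      (wspan_mul (P := LowW) (Q := NpW) (fun _ _ h h' => NpW.append h h'.1 (Or.inr h')) ?_ (ih hl))
    · rw [adL_apply, comm_L_gen]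
      refine brk_mem _ _ _ _ fun g hg => ?_
      have hn : g.Np := Gen.np_occ (by simp [Gen.Low]) hx (by simp) (by simp) hg
      have := word_mem_wspan (P := NpW) (l := [g]) ⟨by simpa using hn.low, by simpa using hn⟩
      simpa using this
    · have := word_mem_wspan (P := LowW) (l := [x]) (by simpa [LowW] using hx)
      simpa using this

theorem adL_pow_succ_mono_mem (Y : Idx) (i : ℕ) : (adL ^ (i + 1)) (mono Y) ∈ wspan NpW := by
  have key : wspan LowW ≤ (wspan NpW).comap adL :=
    Submodule.span_le.2 (by rintro _ ⟨l, hl, rfl⟩; exact adL_word_mem hl)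
  induction i with
  | zero =>
    rw [zero_add, pow_one, mono_eq_word]
    exact adL_word_mem Y.low_letters
  | succ i ih =>
    rw [pow_succ', Module.End.mul_apply]
    exact key (wspan_mono (fun l hl => hl.1) ih)

/-- The ordered monomials in `G^±_{-1/2}`. -/
def leadIdx : Finset Idx := {idxOne, idxP, idxM, idxPM}

theorem npW_letters {X : Idx} (h : X ∉ leadIdx) : NpW X.letters := by
  refine ⟨X.low_letters, ?_⟩
  by_contra! hn
  apply h
  obtain ⟨I, J, Kp, Km⟩ := X
  have hm : ∀ x, x ∈ (Idx.letters ⟨I, J, Kp, Km⟩) ↔ x ∈ (Idx.lettersM ⟨I, J, Kp, Km⟩) := fun x => by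
    rw [← Idx.coe_letters]; rfl
  simp only [hm] at hn
  have hI : I = 0 := Multiset.eq_zero_of_forall_notMem fun n hn' =>
    hn (.L (-((n : ℤ) + 2))) (by simp [Idx.lettersM, hn']) (by simp only [Gen.Np]; omega)
  have hJ : J = 0 := Multiset.eq_zero_of_forall_notMem fun n hn' =>
    hn (.T (-((n : ℤ) + 1))) (by simp [Idx.lettersM, hn']) (by simp only [Gen.Np]; omega)
  have hP : Kp ⊆ {0} := fun n hn' => by
    rw [Finset.mem_singleton]
    by_contra h0
    exact hn (.Gp (-((n : ℤ) + 1))) (by simp [Idx.lettersM, hn']) (by simp only [Gen.Np]; omega)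
  have hM : Km ⊆ {0} := fun n hn' => by
    rw [Finset.mem_singleton]
    by_contra h0
    exact hn (.Gm (-((n : ℤ) + 1))) (by simp [Idx.lettersM, hn']) (by simp only [Gen.Np]; omega)
  subst hI hJ
  rcases Finset.subset_singleton_iff.1 hP with rfl | rfl <;>
    rcases Finset.subset_singleton_iff.1 hM with rfl | rfl <;>
    simp [leadIdx, idxOne, idxP, idxM, idxPM]

/-- The basis vectors other than those with an ordered monomial in `G^±_{-1/2}`. -/
def NpS (ω : Weight) : Submodule ℂ (Verma ω) := supp ω {p | p.1 ∉ leadIdx}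

theorem not_npW_letters {X : Idx} (h : X ∈ leadIdx) : ¬ NpW X.letters := by
  rintro ⟨-, x, hx, hn⟩
  simp only [leadIdx, Finset.mem_insert, Finset.mem_singleton] at h
  have hx' : x ∈ X.lettersM := by rw [← Idx.coe_letters]; exact hx
  rcases h with rfl | rfl | rfl | rfl <;>
    simp [Idx.lettersM, idxOne, idxP, idxM, idxPM] at hx'
  · subst hx'; simp [Gen.Np] at hn
  · subst hx'; simp [Gen.Np] at hn
  · rcases hx' with rfl | rfl <;> simp [Gen.Np] at hn

theorem npW_smul_vec {ω : Weight} {u : U} (hu : u ∈ wspan NpW) (b : ℂ) : u • vec ω b ∈ NpS ω :=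
  wspan_smul (fun _ hl => tracked_np.mem_verma (b := b)
    (fun X _ h => mono_vec_mem_supp (s := {p | p.1 ∉ leadIdx})
      (show X ∉ leadIdx from fun hX => not_npW_letters hX h)) hl) hu

/-- A letter other than `L_{-1}` and `G^±_{-1/2}` cannot disappear when lowering words are sorted.
Hence all terms vanish modulo `NpS`, except those with both monomials leading and `i = 0`. -/
theorem prodVec_lead (ω : Weight) (a₂ a₁ : ℂ) (Θ₂ Θ₁ : Series) {N : ℕ} (hN : 2 ≤ N) :
    prodVec ω a₂ Θ₂ a₁ Θ₁ N - ∑ X ∈ leadIdx, ∑ Y ∈ leadIdx, (Θ₂ X * Θ₁ Y) • mono X • mono Y •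
      vec ω (a₂ + a₁ - (twoGrade X : ℂ) / 2 - (twoGrade Y : ℂ) / 2) ∈ NpS ω := by
  set G : Idx → Idx → Verma ω := fun X Y => (Θ₂ X * Θ₁ Y) • mono X • mono Y •
      vec ω (a₂ + a₁ - (twoGrade X : ℂ) / 2 - (twoGrade Y : ℂ) / 2) with hG
  set F : Idx → Idx → Verma ω := fun X Y => (Θ₂ X * Θ₁ Y) • ∑ i ∈ Finset.range (N + 1),
    binom (a₂ - (twoGrade X : ℂ) / 2) i • (mono X * (adL ^ i) (mono Y)) •
      vec ω (a₂ - (twoGrade X : ℂ) / 2 + (a₁ - (twoGrade Y : ℂ) / 2) - i) with hF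
  have hlow : ∀ X : Idx, mono X ∈ wspan LowW := fun X => by
    rw [mono_eq_word]; exact word_mem_wspan X.low_letters
  have hnp : ∀ X ∉ leadIdx, mono X ∈ wspan NpW := fun X hX => by
    rw [mono_eq_word]; exact word_mem_wspan (npW_letters hX)
  have h1 : ∀ X Y, F X Y - G X Y ∈ NpS ω := fun X Y => by
    rw [hF, hG]
    beta_reduce
    rw [← smul_sub, Finset.sum_range_succ']
    refine Submodule.smul_mem _ _ ?_
    have e0 : binom (a₂ - (twoGrade X : ℂ) / 2) 0 • (mono X * (adL ^ 0) (mono Y)) •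
      vec ω (a₂ - (twoGrade X : ℂ) / 2 + (a₁ - (twoGrade Y : ℂ) / 2) - (0 : ℕ))
        = mono X • mono Y • vec ω (a₂ + a₁ - (twoGrade X : ℂ) / 2 - (twoGrade Y : ℂ) / 2) := by
      rw [pow_zero, Module.End.one_apply, binom, fall_zero, Nat.factorial_zero, Nat.cast_one, div_one,
        one_smul, mul_smul]
      congr 3
      push_cast; ring
    rw [e0, add_sub_cancel_right]
    exact Submodule.sum_mem _ fun i _ => Submodule.smul_mem _ _ (npW_smul_vec (wspan_mul
      (fun _ _ h h' => NpW.append h h'.1 (Or.inr h')) (hlow X) (adL_pow_succ_mono_mem Y i)) _)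
  have h2 : ∀ X Y, X ∉ leadIdx ∨ Y ∉ leadIdx → G X Y ∈ NpS ω := fun X Y h => by
    rw [hG]
    beta_reduce
    rw [← mul_smul (mono X)]
    refine Submodule.smul_mem _ _ (npW_smul_vec ?_ _)
    rcases h with h | h
    · exact wspan_mul (fun _ _ h h' => NpW.append h.1 h' (Or.inl h)) (hnp X h) (hlow Y)
    · exact wspan_mul (fun _ _ h h' => NpW.append h h'.1 (Or.inr h')) (hlow X) (hnp Y h)
  have hs : leadIdx ⊆ idxLE N := fun X hX => by
    rw [mem_idxLE]
    simp only [leadIdx, Finset.mem_insert, Finset.mem_singleton] at hX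
    rcases hX with rfl | rfl | rfl | rfl <;> simp [twoGrade, idxOne, idxP, idxM, idxPM] <;> omega
  have e : prodVec ω a₂ Θ₂ a₁ Θ₁ N = ∑ p ∈ idxLE N ×ˢ idxLE N, F p.1 p.2 := by
    rw [Finset.sum_product]
    simp only [prodVec, prodTrunc, map_sum, toVerma_smul, mulTrunc, map_smul, toVerma_pow,
      comm_iterate, hF]
  rw [e, ← Finset.sum_product (s := leadIdx) (t := leadIdx) (f := fun p => G p.1 p.2),
    ← Finset.sum_sdiff (Finset.product_subset_product hs hs), add_sub_assoc, ← Finset.sum_sub_distrib]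
  refine Submodule.add_mem _ (Submodule.sum_mem _ fun p hp => ?_) (Submodule.sum_mem _ fun p _ => h1 _ _)
  rw [Finset.mem_sdiff, Finset.mem_product (s := leadIdx), not_and_or] at hp
  have := Submodule.add_mem _ (h1 p.1 p.2) (h2 p.1 p.2 hp.2)
  rwa [sub_add_cancel] at this

theorem prodSeries_lead {a₂ a₁ : ℂ} {Θ₂ Θ₁ : Series} {Z : Idx} (hZ : Z ∈ leadIdx) :
    prodSeries a₂ Θ₂ a₁ Θ₁ Z = (vb ⟨0, 0, 0⟩).repr
      (∑ X ∈ leadIdx, ∑ Y ∈ leadIdx, (Θ₂ X * Θ₁ Y) • mono X • mono Y •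
        vec _ (a₂ + a₁ - (twoGrade X : ℂ) / 2 - (twoGrade Y : ℂ) / 2))
      (Z, a₂ + a₁ - (twoGrade Z : ℂ) / 2) := by
  rw [prodSeries, ← sub_eq_zero, ← Finsupp.sub_apply, ← map_sub]
  by_contra hne
  exact mem_supp_iff.1 (prodVec_lead ⟨0, 0, 0⟩ a₂ a₁ Θ₂ Θ₁ (by omega)) _ hne hZ

theorem sum_leadIdx {M : Type*} [AddCommMonoid M] (f : Idx → M) :
    ∑ X ∈ leadIdx, f X = f idxOne + (f idxP + (f idxM + f idxPM)) := by
  rw [leadIdx, Finset.sum_insert, Finset.sum_insert, Finset.sum_insert, Finset.sum_singleton]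
  all_goals simp [idxOne, idxP, idxM, idxPM]

theorem mono_idxOne : mono idxOne = 1 := by simp [mono, idxOne]

theorem mono_idxP : mono idxP = gen (.Gp (-1)) := by simp [mono, idxP]

theorem mono_idxM : mono idxM = gen (.Gm (-1)) := by simp [mono, idxM]

theorem mono_idxPM : mono idxPM = gen (.Gp (-1)) * gen (.Gm (-1)) := by simp [mono, idxPM]

theorem Gm_mul_Gp : gen (.Gm (-1)) * gen (.Gp (-1))
    = (2 : ℂ) • gen (.L (-1)) - gen (.Gp (-1)) * gen (.Gm (-1)) := by
  rw [gen_exch (.Gm (-1)) (.Gp (-1))]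
  norm_num [sgn, brk, Gen.odd]
  abel

/-- In `G⁺G⁻G⁺G⁻` the middle pair equals `2 L_{-1} - G⁺G⁻`, and the last part vanishes because `G⁺`
squares to zero. -/
theorem idxPM_mul (ω : Weight) (b : ℂ) :
    mono idxPM • mono idxPM • vec ω b = (2 : ℂ) • mono idxPM • vec ω (b + 1) := by
  have e : mono idxPM * mono idxPM = (2 : ℂ) • (mono idxPM * gen (.L (-1))) := by
    have h1 : gen (.Gm (-1)) * gen (.Gm (-1)) = 0 := gen_sq (x := .Gm (-1)) rfl
    have h2 : gen (.Gp (-1)) * gen (.Gp (-1)) = 0 := gen_sq (x := .Gp (-1)) rfl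
    have h3 : gen (.L (-1)) * gen (.Gm (-1)) = gen (.Gm (-1)) * gen (.L (-1)) := by
      have := gen_exch (.L (-1)) (.Gm (-1))
      norm_num [sgn, brk, Gen.odd] at this
      exact this
    rw [mono_idxPM]
    calc _ = gen (.Gp (-1)) * (gen (.Gm (-1)) * gen (.Gp (-1))) * gen (.Gm (-1)) := by noncomm_ring
      _ = _ := by
        rw [Gm_mul_Gp, mul_sub, sub_mul, mul_smul_comm, smul_mul_assoc, mul_assoc _ (gen (.L (-1))), h3,
          ← mul_assoc (gen (.Gp (-1))) (gen (.Gp (-1))), h2]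
        simp [mul_assoc]
  rw [← mul_smul, e, smul_assoc, mul_smul, vec_L_neg]

theorem repr_mono_vec (ω : Weight) (X Y : Idx) (b c : ℂ) :
    (vb ω).repr (mono X • vec ω b) (Y, c) = if X = Y ∧ b = c then 1 else 0 := by
  rw [← vb_apply, Module.Basis.repr_self, Finsupp.single_apply]
  simp [Prod.ext_iff]

theorem repr_vec (ω : Weight) (Y : Idx) (b c : ℂ) :
    (vb ω).repr (vec ω b) (Y, c) = if idxOne = Y ∧ b = c then 1 else 0 := by
  rw [← repr_mono_vec, mono_idxOne, one_smul]

theorem eq_zero_of_ch {Θ : Series} {p : ℤ} (h : ∀ X, Θ X ≠ 0 → X.ch = p) {X : Idx} (hX : X.ch ≠ p) :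
    Θ X = 0 := by
  by_contra h0
  exact hX (h X h0)

theorem Idx.ch_lead : idxOne.ch = 0 ∧ idxP.ch = 1 ∧ idxM.ch = -1 ∧ idxPM.ch = 0 := by
  simp [Idx.ch_eq, idxOne, idxP, idxM, idxPM]

theorem twoGrade_lead : twoGrade idxOne = 0 ∧ twoGrade idxP = 1 ∧ twoGrade idxM = 1 ∧
    twoGrade idxPM = 2 := by
  simp [twoGrade, idxOne, idxP, idxM, idxPM]

theorem prodSeries_lead_neutral {a₂ a₁ : ℂ} {Θ₂ Θ₁ : Series} (h₂ : ∀ X, Θ₂ X ≠ 0 → X.ch = 0)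
    (h₁ : ∀ X, Θ₁ X ≠ 0 → X.ch = 0) :
    prodSeries a₂ Θ₂ a₁ Θ₁ idxOne = Θ₂ idxOne * Θ₁ idxOne ∧
    prodSeries a₂ Θ₂ a₁ Θ₁ idxPM = Θ₂ idxOne * Θ₁ idxPM + Θ₂ idxPM * Θ₁ idxOne
      + 2 * (Θ₂ idxPM * Θ₁ idxPM) := by
  obtain ⟨c1, c2, c3, c4⟩ := Idx.ch_lead
  obtain ⟨g1, g2, g3, g4⟩ := twoGrade_lead
  have hP : ∀ {Θ : Series}, (∀ X, Θ X ≠ 0 → X.ch = 0) → Θ idxP = 0 ∧ Θ idxM = 0 := fun h =>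
    ⟨eq_zero_of_ch h (by rw [c2]; decide), eq_zero_of_ch h (by rw [c3]; decide)⟩
  have hne : idxOne ≠ idxPM := by simp [idxOne, idxPM]
  have e : ∀ x : ℂ, x - 1 - 1 + 1 = x - 1 := fun x => by ring
  rw [prodSeries_lead (by simp [leadIdx]), prodSeries_lead (by simp [leadIdx])]
  simp only [sum_leadIdx, (hP h₂).1, (hP h₂).2, (hP h₁).1, (hP h₁).2, zero_mul, mul_zero, zero_smul,
    zero_add, g1, g4, idxPM_mul]
  simp only [mono_idxOne, one_smul, map_add, map_smul, Finsupp.add_apply, Finsupp.smul_apply]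
  simp only [repr_vec, repr_mono_vec]
  simp [hne, hne.symm, e]
  ring

theorem prodSeries_lead_PM {a₂ a₁ : ℂ} {Θ₂ Θ₁ : Series} (h₂ : ∀ X, Θ₂ X ≠ 0 → X.ch = 1)
    (h₁ : ∀ X, Θ₁ X ≠ 0 → X.ch = -1) (e₂ : Θ₂ idxP = 1) (e₁ : Θ₁ idxM = 1) :
    HasLeading (prodSeries a₂ Θ₂ a₁ Θ₁) 1 0 := by
  obtain ⟨c1, c2, c3, c4⟩ := Idx.ch_lead
  obtain ⟨g1, g2, g3, g4⟩ := twoGrade_lead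
  have hne : idxOne ≠ idxPM := by simp [idxOne, idxPM]
  have e : ∀ x : ℂ, x - 1 / 2 - 1 / 2 = x - 1 := fun x => by ring
  have z1 : Θ₂ idxOne = 0 := eq_zero_of_ch h₂ (by rw [c1]; decide)
  have z2 : Θ₂ idxM = 0 := eq_zero_of_ch h₂ (by rw [c3]; decide)
  have z3 : Θ₂ idxPM = 0 := eq_zero_of_ch h₂ (by rw [c4]; decide)
  have z4 : Θ₁ idxOne = 0 := eq_zero_of_ch h₁ (by rw [c1]; decide)
  have z5 : Θ₁ idxP = 0 := eq_zero_of_ch h₁ (by rw [c2]; decide)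
  have z6 : Θ₁ idxPM = 0 := eq_zero_of_ch h₁ (by rw [c4]; decide)
  rw [HasLeading, prodSeries_lead (by simp [leadIdx]), prodSeries_lead (by simp [leadIdx])]
  simp only [sum_leadIdx, z1, z2, z3, z4, z5, z6, mul_zero, zero_smul,
    zero_add, add_zero, g1, g2, g3, g4, e₁, e₂, mul_one, one_smul]
  have hv : ∀ b, mono idxP • mono idxM • vec ⟨0, 0, 0⟩ b = mono idxPM • vec ⟨0, 0, 0⟩ b := fun b => by
    rw [mono_idxP, mono_idxM, mono_idxPM, mul_smul]
  rw [hv, repr_mono_vec, repr_mono_vec]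
  simp [hne.symm]
  ring

theorem prodSeries_lead_MP {a₂ a₁ : ℂ} {Θ₂ Θ₁ : Series} (h₂ : ∀ X, Θ₂ X ≠ 0 → X.ch = -1)
    (h₁ : ∀ X, Θ₁ X ≠ 0 → X.ch = 1) (e₂ : Θ₂ idxM = 1) (e₁ : Θ₁ idxP = 1) :
    HasLeading (prodSeries a₂ Θ₂ a₁ Θ₁) 0 1 := by
  obtain ⟨c1, c2, c3, c4⟩ := Idx.ch_lead
  obtain ⟨g1, g2, g3, g4⟩ := twoGrade_lead
  have hne : idxOne ≠ idxPM := by simp [idxOne, idxPM]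
  have z1 : Θ₂ idxOne = 0 := eq_zero_of_ch h₂ (by rw [c1]; decide)
  have z2 : Θ₂ idxP = 0 := eq_zero_of_ch h₂ (by rw [c2]; decide)
  have z3 : Θ₂ idxPM = 0 := eq_zero_of_ch h₂ (by rw [c4]; decide)
  have z4 : Θ₁ idxOne = 0 := eq_zero_of_ch h₁ (by rw [c1]; decide)
  have z5 : Θ₁ idxM = 0 := eq_zero_of_ch h₁ (by rw [c3]; decide)
  have z6 : Θ₁ idxPM = 0 := eq_zero_of_ch h₁ (by rw [c4]; decide)
  rw [HasLeading, prodSeries_lead (by simp [leadIdx]), prodSeries_lead (by simp [leadIdx])]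
  simp only [sum_leadIdx, z1, z2, z3, z4, z5, z6, mul_zero, zero_smul,
    zero_add, add_zero, g1, g2, g3, g4, e₁, e₂, mul_one, one_smul]
  have hv : ∀ b, mono idxM • mono idxP • vec ⟨0, 0, 0⟩ b
      = (2 : ℂ) • mono idxOne • vec ⟨0, 0, 0⟩ (b + 1) - mono idxPM • vec ⟨0, 0, 0⟩ b := fun b => by
    rw [mono_idxP, mono_idxM, mono_idxPM, mono_idxOne, ← mul_smul, Gm_mul_Gp, sub_smul, smul_assoc,
      vec_L_neg, one_smul]
  have b1 : a₂ + a₁ - ((1 : ℕ) : ℂ) / 2 - ((1 : ℕ) : ℂ) / 2 + 1 = a₂ + a₁ := by push_cast; ring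
  have b2 : a₂ + a₁ - ((1 : ℕ) : ℂ) / 2 - ((1 : ℕ) : ℂ) / 2 = a₂ + a₁ - 1 := by push_cast; ring
  rw [hv, b1, b2, map_sub, map_smul, Finsupp.sub_apply, Finsupp.sub_apply, Finsupp.smul_apply,
    Finsupp.smul_apply]
  simp only [repr_mono_vec]
  simp [hne, hne.symm]

/-! ### Leading terms with respect to the level -/

/-- The level of a word. -/
def levW (l : List Gen) : ℕ := (l.map Gen.lev).sum

@[simp] theorem levW_nil : levW [] = 0 := rfl

@[simp] theorem levW_cons (x : Gen) (l : List Gen) : levW (x :: l) = x.lev + levW l := by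
  simp [levW]

theorem Lev_mono (ω : Weight) {r s : ℝ} (h : r ≤ s) : Lev ω r ≤ Lev ω s :=
  supp_mono fun _ hp => le_trans hp h

theorem gen_smul_Lev {ω : Weight} (g : Gen) {r s : ℝ} {v : Verma ω} (hv : v ∈ Lev ω r)
    (h : r + g.lev ≤ s) : gen g • v ∈ Lev ω s := by
  have := word_smul_Lev [g] hv
  exact Lev_mono ω (by simpa using h) (by simpa using this)

theorem word_vec_mem_Lev (ω : Weight) (l : List Gen) (b : ℂ) :
    word l • vec ω b ∈ Lev ω (2 * b.re + levW l) :=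
  word_smul_Lev l (vec_mem_Lev ω b)

theorem brk_smul_mem {ω : Weight} {x y : Gen} {v : Verma ω} {S : Submodule ℂ (Verma ω)}
    (h : ∀ g, Occ x y g → gen g • v ∈ S) : brk gen x y • v ∈ S := by
  have e := map_brk ((LinearMap.toSpanSingleton U (Verma ω) v).restrictScalars ℂ) gen x y
  simp only [LinearMap.restrictScalars_apply, LinearMap.toSpanSingleton_apply] at e
  rw [e]
  exact brk_mem S _ x y h

theorem Gen.lev_occ_L_neg {x g : Gen} (h : Occ (.L (-1)) x g) : g.lev ≤ x.lev + 1 := by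
  have h1 := Gen.lev_L_le
  have h2 := Gen.one_le_lev_L
  cases x <;> simp only [Occ] at h
  case L n =>
    rcases h with ⟨rfl, -⟩ | ⟨rfl, -⟩
    · exact (h1 _).trans (Nat.add_le_add_right (h2 n) 1)
    · simp [Gen.lev]
  all_goals (rcases h with ⟨rfl, -⟩; simp [Gen.lev])

/-- Passing `L_{-1}` to the symbol leaves brackets that add at most `1` to the level, against `2`
for the main term. -/
theorem L_neg_word_vec (ω : Weight) (l : List Gen) (b : ℂ) :
    gen (.L (-1)) • word l • vec ω b - word l • vec ω (b + 1) ∈ Lev ω (2 * b.re + levW l + 1) := by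
  induction l with
  | nil => simp [vec_L_neg]
  | cons x l ih =>
    have e : gen (.L (-1)) * gen x = gen x * gen (.L (-1)) + brk gen (.L (-1)) x := by
      rw [gen_exch]; simp [sgn, Gen.odd]
    rw [word_cons, ← mul_smul, ← mul_assoc, e, add_mul, add_smul, mul_assoc, mul_smul, mul_smul,
      mul_smul, mul_smul, add_sub_right_comm, ← smul_sub]
    refine Submodule.add_mem _ (gen_smul_Lev x ih ?_) (brk_smul_mem fun g hg =>
      gen_smul_Lev g (word_vec_mem_Lev ω l b) ?_)
    · rw [levW_cons]; push_cast; linarith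
    · have : (g.lev : ℝ) ≤ x.lev + 1 := by exact_mod_cast Gen.lev_occ_L_neg hg
      rw [levW_cons]; push_cast; linarith

/-- The sum over the occurrences of the letter `x₀` in a word of the words without this letter,
with signs, applied to `L_{-1}^{b+1} |h,q,c⟩`. -/
def leadTerm (ω : Weight) (σ : Gen → ℂ) (x₀ : Gen) (b : ℂ) : List Gen → Verma ω
  | [] => 0
  | x :: l => σ x • gen x • leadTerm ω σ x₀ b l + if x = x₀ then word l • vec ω (b + 1) else 0

/-- Here `Z` acts like a signed derivation that replaces the letter `x₀` by `K L_{-1}` and does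
nothing else up to lower level. The condition `x₀.lev + d = 2` says that this replacement raises the
level by exactly `d`. -/
theorem smul_word_vec_sub_leadTerm {ω : Weight} {Z : U} {σ : Gen → ℂ} {x₀ : Gen} {K : ℂ} {d : ℕ}
    {Q : List Gen → Prop} (hQ : ∀ x l, Q (x :: l) → Q l)
    (hcomm : ∀ x l b, Q (x :: l) → (Z * gen x - σ x • (gen x * Z)
      - (if x = x₀ then K else 0) • gen (.L (-1))) • word l • vec ω b
        ∈ Lev ω (2 * b.re + levW l + x.lev + d - 1))
    (hvec : ∀ b, Z • vec ω b ∈ Lev ω (2 * b.re + d - 1)) (hd : x₀.lev + d = 2) {l : List Gen}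
    (hl : Q l) (b : ℂ) :
    Z • word l • vec ω b - K • leadTerm ω σ x₀ b l ∈ Lev ω (2 * b.re + levW l + d - 1) := by
  induction l with
  | nil => simpa [leadTerm] using hvec b
  | cons x l ih =>
    have i1 := gen_smul_Lev (s := 2 * b.re + levW (x :: l) + d - 1) x (ih (hQ x l hl))
      (by rw [levW_cons]; push_cast; linarith)
    have i1' := Submodule.smul_mem _ (σ x) i1
    have i2 := Lev_mono ω (s := 2 * b.re + levW (x :: l) + d - 1)
      (by rw [levW_cons]; push_cast; linarith) (hcomm x l b hl)
    have i3 : (if x = x₀ then K else 0) • gen (.L (-1)) • word l • vec ω b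
        - K • (if x = x₀ then word l • vec ω (b + 1) else 0) ∈ Lev ω (2 * b.re + levW (x :: l) + d - 1) := by
      split_ifs with hx
      · rw [← smul_sub]
        have : (x.lev : ℝ) + d = 2 := by rw [hx]; exact_mod_cast hd
        refine Submodule.smul_mem _ _ (Lev_mono ω ?_ (L_neg_word_vec ω l b))
        rw [levW_cons]; push_cast; linarith
      · simp
    have := Submodule.add_mem _ (Submodule.add_mem _ i1' i2) i3
    convert this using 1
    rw [word_cons, leadTerm]
    simp only [sub_smul, smul_sub, mul_smul, smul_assoc, smul_add, smul_comm_U]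
    rw [smul_comm (σ x) K]
    abel

theorem Good.erase {l : List Gen} (h : Good l) (x : Gen) : Good (l.erase x) :=
  ⟨h.1.sublist List.erase_sublist, fun y hy => h.2 y (List.mem_of_mem_erase hy)⟩

/-- In a good word, equal letters are adjacent, so all deletions of an even letter give the same
word and add up without signs. An odd letter occurs at most once and only contributes a sign. -/
theorem leadTerm_eq {ω : Weight} {σ : Gen → ℂ} {x₀ : Gen} {b : ℂ} (h0 : ∀ x, σ x ≠ 0)
    (h1 : x₀.odd = false → ∀ x, σ x = 1) {l : List Gen} (hl : Good l) :
    ∃ κ : ℂ, κ ≠ 0 ∧ (x₀.odd = false → κ = 1) ∧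
      leadTerm ω σ x₀ b l = (κ * l.count x₀) • word (l.erase x₀) • vec ω (b + 1) := by
  induction l with
  | nil => exact ⟨1, one_ne_zero, fun _ => rfl, by simp [leadTerm]⟩
  | cons x l ih =>
    obtain ⟨κ, hκ, hκ', e⟩ := ih hl.of_cons
    rw [leadTerm, e]
    by_cases hx : x = x₀
    · subst hx
      rw [if_pos rfl, List.erase_cons_head, List.count_cons_self]
      by_cases hm : x ∈ l
      · have hx := (List.pairwise_cons.1 hl.1).1
        have hodd : x.odd = false := (hx x hm).2 rfl
        obtain ⟨y, l', rfl⟩ : ∃ y l', l = y :: l' := List.exists_cons_of_ne_nil (List.ne_nil_of_mem hm)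
        have hy : y = x := by
          refine le_antisymm ?_ (hx y (by simp)).1
          rcases List.mem_cons.1 hm with h | h
          · exact h.ge
          · exact ((List.pairwise_cons.1 hl.of_cons.1).1 x h).1
        subst hy
        refine ⟨1, one_ne_zero, fun _ => rfl, ?_⟩
        rw [h1 hodd, hκ' hodd, List.erase_cons_head, one_smul, smul_comm_U, word_cons, one_mul,
          one_mul]
        simp only [mul_smul, Nat.cast_add, Nat.cast_one, add_smul, one_smul]
      · refine ⟨1, one_ne_zero, fun _ => rfl, ?_⟩
        rw [List.count_eq_zero_of_not_mem hm]
        simp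
    · refine ⟨σ x * κ, mul_ne_zero (h0 x) hκ, fun h => by rw [h1 h, hκ' h, mul_one], ?_⟩
      rw [if_neg hx, add_zero, List.count_cons_of_ne hx, List.erase_cons_tail (by simpa using hx),
        word_cons]
      simp only [mul_smul, smul_comm_U]

/-- Reading off coefficients from the leading terms. -/
theorem coeff_eq_zero_of_leadTerm {ω : Weight} {F : Finset Idx} {Θ : Series} {a : ℂ} {r : ℝ}
    (hF : ∀ X ∈ F, 2 * (a - (twoGrade X : ℂ) / 2).re + levW X.letters = r) {Z : U} {σ : Gen → ℂ}
    {x₀ : Gen} {K : ℂ} {d : ℕ} (h0 : ∀ x, σ x ≠ 0) (h1 : x₀.odd = false → ∀ x, σ x = 1) (hK : K ≠ 0)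
    (hd : x₀.lev + d = 2)
    (hZ : Z • ∑ X ∈ F, Θ X • mono X • vec ω (a - (twoGrade X : ℂ) / 2) ∈ Lev ω (r + d - 1))
    (hlead : ∀ X ∈ F, ∀ b, Z • word X.letters • vec ω b - K • leadTerm ω σ x₀ b X.letters
      ∈ Lev ω (2 * b.re + levW X.letters + d - 1)) {X : Idx} (hX : X ∈ F) (hx : x₀ ∈ X.letters) :
    Θ X = 0 := by
  -- Deleting a letter from an ordered monomial leaves an ordered monomial, so the leading terms are
  -- multiples of basis vectors.
  choose Y hY using fun X : Idx => (X.good_letters.erase x₀).exists_letters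
  choose κ hκ0 hκ1 hκ using fun X : Idx => leadTerm_eq (ω := ω)
    (b := a - (twoGrade X : ℂ) / 2) h0 h1 X.good_letters
  have key : ∑ X ∈ F, (Θ X * (K * (κ X * X.letters.count x₀))) •
      vb ω (Y X, a - (twoGrade X : ℂ) / 2 + 1) ∈ Lev ω (r + d - 1) := by
    have := Submodule.sub_mem _ hZ (Submodule.sum_mem (t := F) (f := fun X => Θ X •
      (Z • word X.letters • vec ω (a - (twoGrade X : ℂ) / 2)
        - K • leadTerm ω σ x₀ (a - (twoGrade X : ℂ) / 2) X.letters)) _ fun X hX =>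
      Submodule.smul_mem _ _ (by have := hlead X hX (a - (twoGrade X : ℂ) / 2); rwa [hF X hX] at this))
    rw [Finset.smul_sum, ← Finset.sum_sub_distrib] at this
    convert this using 1
    refine Finset.sum_congr rfl fun X _ => ?_
    rw [smul_comm_U, ← smul_sub, mono_eq_word, sub_sub_cancel, hκ, vb_apply, mono_eq_word, hY,
      smul_smul, smul_smul, mul_assoc]
  by_contra hne
  have hcount : (X.letters.count x₀ : ℂ) ≠ 0 := Nat.cast_ne_zero.2 (List.count_pos_iff.2 hx).ne'
  have hlev : levW X.letters = x₀.lev + levW (Y X).letters := by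
    rw [hY, ← levW_cons]
    exact (((List.perm_cons_erase hx).map Gen.lev).sum_eq)
  -- The basis vector obtained from `X` has level exactly `r + d`, above the allowed bound. Its
  -- coefficient cannot cancel, since a monomial containing `x₀` is recovered from its deletion.
  have hmem := mem_supp_iff.1 key (Y X, a - (twoGrade X : ℂ) / 2 + 1) ?_
  · rw [Set.mem_ofPred_eq] at hmem
    have h2 := hF X hX
    rw [hlev] at h2
    have h3 : (x₀.lev : ℝ) + d = 2 := by exact_mod_cast hd
    have h4 : (Y X).lev = levW (Y X).letters := rfl
    rw [h4] at hmem
    push_cast at h2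
    simp only [Complex.add_re, Complex.one_re] at hmem
    linarith
  · rw [map_sum, Finsupp.coe_finsetSum, Finset.sum_apply, Finset.sum_eq_single X]
    · rw [map_smul, Module.Basis.repr_self]
      simpa using ⟨hne, hK, hκ0 X, List.count_pos_iff.2 hx |>.ne'⟩
    · intro X' _ hX'
      rw [map_smul, Module.Basis.repr_self, Finsupp.smul_apply]
      by_cases hx' : x₀ ∈ X'.letters
      · rw [Finsupp.single_eq_of_ne, smul_zero]
        intro h
        have h' : Y X = Y X' := congrArg Prod.fst h
        apply hX'
        apply Idx.lettersM_injective
        rw [← Idx.coe_letters, ← Idx.coe_letters]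
        refine Multiset.coe_eq_coe.2 ((List.perm_cons_erase hx').trans ?_)
        rw [← hY, ← h', hY]
        exact (List.perm_cons_erase hx).symm
      · rw [List.count_eq_zero_of_not_mem hx']
        simp
    · exact fun h => absurd hX h

/-! ### A bilinear correction of the modes `T_m` -/

theorem Gen.gr_pos {x : Gen} (h : ¬ x.Tail) : 0 < x.gr := by
  cases x <;> simp only [Gen.Tail, Gen.gr, not_le, not_true] at * <;> omega

theorem gr_sum_nonneg {l : List Gen} (h : ∀ x ∈ l, ¬ x.Tail) : 0 ≤ (l.map Gen.gr).sum := by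
  refine List.sum_nonneg fun y hy => ?_
  obtain ⟨x, hx, rfl⟩ := List.mem_map.1 hy
  exact (Gen.gr_pos (h x hx)).le

theorem Gen.lev_L_of_ne {n : ℤ} (h : n ≠ -1) : (Gen.L n).lev = 1 := if_neg h

@[simp] theorem Gen.lev_L_neg : (Gen.L (-1)).lev = 2 := rfl

@[simp] theorem Gen.lev_T (n : ℤ) : (Gen.T n).lev = 0 := rfl

@[simp] theorem Gen.lev_Gp (n : ℤ) : (Gen.Gp n).lev = 1 := rfl

@[simp] theorem Gen.lev_Gm (n : ℤ) : (Gen.Gm n).lev = 1 := rfl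

@[simp] theorem Gen.lev_C : Gen.C.lev = 0 := rfl

/-- Odd generators of high mode number do not raise the level of a word of small grade. -/
theorem odd_smul_word_vec {ω : Weight} {l : List Gen} (hl : ∀ x ∈ l, ¬ x.Tail) {n : ℤ}
    (hn : (l.map Gen.gr).sum ≤ 2 * n) {z : Gen} (hz : z = .Gp n ∨ z = .Gm n) (b : ℂ) :
    gen z • word l • vec ω b ∈ Lev ω (2 * b.re + levW l) := by
  induction l generalizing n z with
  | nil =>
    obtain ⟨k, rfl⟩ := Int.eq_ofNat_of_zero_le (show 0 ≤ n by simpa using hn)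
    have hk : (0 : ℝ) ≤ k := Nat.cast_nonneg _
    have hs : ∀ g : Gen, g.lev = 1 → fall b (k + 1) • gen g • vec ω (b - (k + 1)) ∈ Lev ω (2 * b.re) :=
      fun g hg => Submodule.smul_mem _ _ (gen_smul_Lev g (vec_mem_Lev ω _) (by
        rw [hg]; simp; linarith))
    rw [word_nil, one_smul, levW_nil, Nat.cast_zero, add_zero]
    rcases hz with rfl | rfl
    · rw [vec_Gp]; exact hs _ rfl
    · rw [vec_Gm]; exact hs _ rfl
  | cons x l ih =>
    have hl' : ∀ y ∈ l, ¬ y.Tail := fun y hy => hl y (by simp [hy])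
    have hx := hl x (by simp)
    have hg := gr_sum_nonneg hl'
    have ih' := @ih hl'
    simp only [List.map_cons, List.sum_cons] at hn
    have hxp := Gen.gr_pos hx
    have hs : ∀ g : Gen, g.lev ≤ x.lev → gen g • word l • vec ω b ∈ Lev ω (2 * b.re + levW (x :: l)) :=
      fun g hg => gen_smul_Lev g (word_vec_mem_Lev ω l b) (by
        have : (g.lev : ℝ) ≤ x.lev := by exact_mod_cast hg
        rw [levW_cons]; push_cast; linarith)
    have hm : Lev ω (2 * b.re + levW l) ≤ Lev ω (2 * b.re + levW (x :: l)) :=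
      Lev_mono ω (by rw [levW_cons]; push_cast; linarith [(Nat.cast_nonneg x.lev : (0 : ℝ) ≤ x.lev)])
    rw [word_cons, ← mul_smul, ← mul_assoc, gen_exch z x, add_mul, add_smul, smul_mul_assoc, smul_assoc,
      mul_assoc, mul_smul, mul_smul, mul_smul]
    refine Submodule.add_mem _ (Submodule.smul_mem _ _ (gen_smul_Lev x (ih' (by omega) hz) ?_))
      (brk_smul_mem fun g hgo => ?_)
    · rw [levW_cons]; push_cast; linarith
    · rcases hz with rfl | rfl
      · cases x <;> simp only [Occ, Gen.gr, Gen.Tail] at hgo hn hx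
        case L k => rcases hgo with ⟨rfl, -⟩; exact hs _ (Gen.one_le_lev_L _)
        case T k => subst hgo; exact hm (ih' (n := n + k) (by omega) (Or.inl rfl))
        case Gm k =>
          rcases hgo with rfl | ⟨rfl, -⟩ | ⟨rfl, -⟩
          · exact hs _ (by rw [Gen.lev_L_of_ne (by omega)]; rfl)
          · exact hs _ (by simp [Gen.lev])
          · exact hs _ (by simp [Gen.lev])
      · cases x <;> simp only [Occ, Gen.gr, Gen.Tail] at hgo hn hx
        case L k => rcases hgo with ⟨rfl, -⟩; exact hs _ (Gen.one_le_lev_L _)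
        case T k => subst hgo; exact hm (ih' (n := n + k) (by omega) (Or.inr rfl))
        case Gp k =>
          rcases hgo with rfl | ⟨rfl, -⟩ | ⟨rfl, -⟩
          · exact hs _ (by rw [Gen.lev_L_of_ne (by omega)]; rfl)
          · exact hs _ (by simp [Gen.lev])
          · exact hs _ (by simp [Gen.lev])

/-- The bilinear expression `∑ G⁺_r G⁻_s` over `r + s = p`, in a finite range. -/
def bilin (p N : ℕ) : U := ∑ t ∈ Finset.range (p + 2 * N),
  gen (.Gp (p - 1 - (t - N))) * gen (.Gm (t - N))

/-- The combination of `L_{-1} T_{p+1}` and a bilinear expression in the odd generators that commutes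
with the odd generators up to terms of lower level. -/
def corrT (p N : ℕ) : U := gen (.L (-1)) * gen (.T (p + 1)) - (1 / 2 : ℂ) • bilin p N

theorem mul_exchange {A : Type*} [Ring A] [Algebra ℂ A] {P Q x R₁ R₂ : A} {s₁ s₂ : ℂ}
    (h₁ : Q * x = s₁ • (x * Q) + R₁) (h₂ : P * x = s₂ • (x * P) + R₂) :
    P * Q * x - (s₁ * s₂) • (x * (P * Q)) = s₁ • (R₂ * Q) + P * R₁ := by
  rw [mul_assoc, h₁, mul_add, mul_smul_comm, ← mul_assoc, h₂, add_mul, smul_mul_assoc, smul_add,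
    smul_smul, mul_assoc]
  abel

theorem corrT_exchange (p N : ℕ) (x : Gen) : corrT p N * gen x - gen x * corrT p N =
    brk gen (.L (-1)) x * gen (.T (p + 1)) + gen (.L (-1)) * brk gen (.T (p + 1)) x
      - (1 / 2 : ℂ) • ∑ t ∈ Finset.range (p + 2 * N),
        (sgn (.Gm (t - N)) x • (brk gen (.Gp (p - 1 - (t - N))) x * gen (.Gm (t - N)))
          + gen (.Gp (p - 1 - (t - N))) * brk gen (.Gm (t - N)) x) := by
  have h1 := mul_exchange (gen_exch (.T (p + 1)) x) (gen_exch (.L (-1)) x)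
  have s1 : sgn (.T (p + 1)) x = 1 := by simp [sgn, Gen.odd]
  have s2 : sgn (.L (-1)) x = 1 := by simp [sgn, Gen.odd]
  rw [s1, s2, mul_one, one_smul, one_smul] at h1
  have h2 : ∀ i j : ℤ, gen (.Gp i) * gen (.Gm j) * gen x - gen x * (gen (.Gp i) * gen (.Gm j)) =
      sgn (.Gm j) x • (brk gen (.Gp i) x * gen (.Gm j)) + gen (.Gp i) * brk gen (.Gm j) x := fun i j => by
    have := mul_exchange (gen_exch (.Gm j) x) (gen_exch (.Gp i) x)
    have e : sgn (.Gm j) x * sgn (.Gp i) x = 1 := by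
      cases x <;> simp [sgn, Gen.odd]
    rwa [e, one_smul] at this
  simp only [← h2]
  rw [corrT, sub_mul, mul_sub, smul_mul_assoc, mul_smul_comm, bilin, Finset.sum_mul, Finset.mul_sum,
    sub_sub_sub_comm, h1, ← smul_sub, ← Finset.sum_sub_distrib]

/-- In each bilinear term one factor is raising. If it is the left one, the exchange costs only a
bracket of mode `p ≥ 0`, whose level is at most `1`. So `corrT` loses one unit of level on vectors
for which the raising operators do. -/
theorem corrT_smul_mem {ω : Weight} {p N : ℕ} {r : ℝ} {v : Verma ω} (hv : v ∈ Lev ω r)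
    (hT : gen (.T (p + 1)) • v ∈ Lev ω (r - 1)) (hP : ∀ n : ℕ, gen (.Gp n) • v ∈ Lev ω r)
    (hM : ∀ n : ℕ, gen (.Gm n) • v ∈ Lev ω r) : corrT p N • v ∈ Lev ω (r + 1) := by
  have l2 : ((Gen.L (-1)).lev : ℝ) = 2 := by simp [Gen.lev]
  have lP : ∀ n, ((Gen.Gp n).lev : ℝ) = 1 := fun n => by simp [Gen.lev]
  have lM : ∀ n, ((Gen.Gm n).lev : ℝ) = 1 := fun n => by simp [Gen.lev]
  rw [corrT, sub_smul, smul_assoc, bilin, Finset.sum_smul, mul_smul]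
  refine Submodule.sub_mem _ (gen_smul_Lev _ hT (by rw [l2]; linarith)) (Submodule.smul_mem _ _
    (Submodule.sum_mem _ fun t _ => ?_))
  rcases le_or_gt 0 ((t : ℤ) - N) with h | h
  · obtain ⟨n, hn⟩ := Int.eq_ofNat_of_zero_le h
    rw [hn, mul_smul]
    exact gen_smul_Lev _ (hM n) (by rw [lP])
  · obtain ⟨n, hn⟩ := Int.eq_ofNat_of_zero_le (show 0 ≤ (p : ℤ) - 1 - (t - N) by omega)
    rw [gen_exch, add_smul, smul_assoc, mul_smul]
    refine Submodule.add_mem _ (Submodule.smul_mem _ _ ?_) (brk_smul_mem fun g hg => ?_)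
    · rw [hn]
      exact gen_smul_Lev _ (hP n) (by rw [lM])
    · refine gen_smul_Lev g hv ?_
      have : g.lev ≤ 1 := by
        simp only [Occ] at hg
        rcases hg with rfl | ⟨rfl, -⟩ | ⟨rfl, -⟩
        · rw [Gen.lev_L_of_ne (by omega)]
        · simp [Gen.lev]
        · simp [Gen.lev]
      have : (g.lev : ℝ) ≤ 1 := by exact_mod_cast this
      linarith

theorem corrT_vec (ω : Weight) (p N : ℕ) (b : ℂ) : corrT p N • vec ω b ∈ Lev ω (2 * b.re + 1) := by
  refine corrT_smul_mem (vec_mem_Lev ω b) ?_ (fun n => ?_) fun n => ?_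
  · have := vec_T ω b (p + 1)
    push_cast at this
    rw [this]
    refine Submodule.smul_mem _ _ (Lev_mono ω ?_ (vec_mem_Lev ω _))
    have : (0 : ℝ) ≤ p := Nat.cast_nonneg _
    simp
    linarith
  · simpa using odd_smul_word_vec (ω := ω) (l := []) (n := n) (by simp) (by simp) (Or.inl rfl) b
  · simpa using odd_smul_word_vec (ω := ω) (l := []) (n := n) (by simp) (by simp) (Or.inr rfl) b

section

variable {ω : Weight} {p N : ℕ} {s : ℝ} {v : Verma ω}

theorem two_smul_Lev (hv : v ∈ Lev ω s) (g g' : Gen) {r : ℝ} (h : s + g'.lev + g.lev ≤ r) :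
    (gen g * gen g') • v ∈ Lev ω r := by
  rw [mul_smul]
  exact gen_smul_Lev g (gen_smul_Lev g' hv le_rfl) h

theorem brk_L_neg_mul_mem (hv : v ∈ Lev ω s) (x : Gen) :
    (brk gen (.L (-1)) x * gen (.T (p + 1))) • v ∈ Lev ω (s + x.lev + 1) := by
  rw [mul_smul]
  refine brk_smul_mem fun g hg => gen_smul_Lev g (gen_smul_Lev _ hv le_rfl) ?_
  have : (g.lev : ℝ) ≤ x.lev + 1 := by exact_mod_cast Gen.lev_occ_L_neg hg
  simp only [Gen.lev] at *
  push_cast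
  linarith

theorem corrT_L (hv : v ∈ Lev ω s) (k : ℤ) :
    (corrT p N * gen (.L k) - gen (.L k) * corrT p N) • v ∈ Lev ω (s + (Gen.L k).lev + 1) := by
  have h1 : (1 : ℝ) ≤ (Gen.L k).lev := by exact_mod_cast Gen.one_le_lev_L k
  rw [corrT_exchange, sub_smul, add_smul]
  refine Submodule.sub_mem _ (Submodule.add_mem _ (brk_L_neg_mul_mem hv _) ?_) ?_
  · rw [brk, mul_smul_comm, smul_assoc]
    refine Submodule.smul_mem _ _ (two_smul_Lev hv _ _ ?_)
    rw [Gen.lev_T, Gen.lev_L_neg]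
    push_cast
    linarith
  · rw [smul_assoc, Finset.sum_smul]
    refine Submodule.smul_mem _ _ (Submodule.sum_mem _ fun t _ => ?_)
    rw [brk, brk, add_smul, smul_mul_assoc, mul_smul_comm, smul_assoc, smul_assoc, smul_assoc]
    refine Submodule.add_mem _ (Submodule.smul_mem _ _ (Submodule.smul_mem _ _ (two_smul_Lev hv _ _ ?_)))
      (Submodule.smul_mem _ _ (two_smul_Lev hv _ _ ?_))
    all_goals
      rw [Gen.lev_Gp, Gen.lev_Gm]
      push_cast
      linarith

/-- The commutator of `T_{p+1}` contributes `L_{-1} G⁺_r`, and exactly one term of the bilinear sum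
contributes `2 G⁺_r L_{-1}`, for the same mode `r`; the factor `½` in `corrT` makes them cancel. The
bound on `N` ensures that this term lies in the range. -/
theorem corrT_Gp (hv : v ∈ Lev ω s) {k : ℤ} (hk : k ≤ -1) (hN : -k ≤ N) :
    (corrT p N * gen (.Gp k) - gen (.Gp k) * corrT p N) • v ∈ Lev ω (s + (Gen.Gp k).lev + 1) := by
  obtain ⟨r, hr⟩ : ∃ r, s + ((Gen.Gp k).lev : ℝ) + 1 = r := ⟨_, rfl⟩
  have hr' : s + 1 + 1 = r := by rw [← hr, Gen.lev_Gp]; norm_num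
  rw [hr]
  have key : ∑ t ∈ Finset.range (p + 2 * N),
      ((sgn (.Gm (t - N)) (.Gp k) • (brk gen (.Gp (p - 1 - (t - N))) (.Gp k) * gen (.Gm (t - N)))
          + gen (.Gp (p - 1 - (t - N))) * brk gen (.Gm (t - N)) (.Gp k)) • v
        - if t = (N - k - 2).toNat then (2 : ℂ) • (gen (.Gp (p + 1 + k)) * gen (.L (-1))) • v else 0)
        ∈ Lev ω r := by
    refine Submodule.sum_mem _ fun t _ => ?_
    have e : brk gen (.Gp (p - 1 - (t - N))) (.Gp k) = 0 := rfl
    rw [e, zero_mul, smul_zero, zero_add, brk, mul_add, mul_add, add_smul, add_smul, mul_smul_comm,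
      mul_smul_comm, mul_smul_comm, smul_assoc, smul_assoc, smul_assoc]
    have iT := two_smul_Lev hv (.Gp (p - 1 - (t - N))) (.T (t - N + k + 1)) (r := r)
      (by rw [← hr']; simp)
    have iC := two_smul_Lev hv (.Gp (p - 1 - (t - N))) .C (r := r)
      (by rw [← hr']; simp)
    rw [add_assoc, add_sub_right_comm]
    refine Submodule.add_mem _ ?_ (Submodule.add_mem _ (Submodule.smul_mem _ _ iT)
      (Submodule.smul_mem _ _ iC))
    by_cases ht : t = (N - k - 2).toNat
    · rw [if_pos ht]
      have e1 : (p : ℤ) - 1 - (t - N) = p + 1 + k := by omega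
      have e2 : (t : ℤ) - N + k + 1 = -1 := by omega
      rw [e1, e2, sub_self]
      exact Submodule.zero_mem _
    · rw [if_neg ht, sub_zero]
      refine Submodule.smul_mem _ _ (two_smul_Lev hv _ _ ?_)
      rw [Gen.lev_L_of_ne (by omega), Gen.lev_Gp, ← hr']
      push_cast; linarith
  rw [Finset.sum_sub_distrib, Finset.sum_ite_eq', if_pos (by rw [Finset.mem_range]; omega)] at key
  have hb : (brk gen (.L (-1)) (.Gp (p + 1 + k))) • v ∈ Lev ω r :=
    brk_smul_mem fun g hg => gen_smul_Lev g hv (by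
      simp only [Occ] at hg
      rw [hg.1, Gen.lev_Gp, ← hr']; push_cast; linarith)
  have e0 : gen (.L (-1)) * gen (.Gp (p + 1 + k)) = gen (.Gp (p + 1 + k)) * gen (.L (-1))
      + brk gen (.L (-1)) (.Gp (p + 1 + k)) := by
    rw [gen_exch]; simp [sgn, Gen.odd]
  have := Submodule.sub_mem _ (Submodule.add_mem _ (hr ▸ brk_L_neg_mul_mem (p := p) hv (.Gp k)) hb)
    (Submodule.smul_mem _ (1 / 2 : ℂ) key)
  rw [corrT_exchange, sub_smul, add_smul, smul_assoc, Finset.sum_smul]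
  have eT : brk gen (.T (p + 1)) (.Gp k) = gen (.Gp (p + 1 + k)) := rfl
  rw [eT, e0, add_smul]
  convert this using 1
  rw [smul_sub, smul_smul]
  norm_num
  abel

/-- The same cancellation with opposite signs; `L_{-1}` already stands on the left here, so no
reordering is needed. -/
theorem corrT_Gm (hv : v ∈ Lev ω s) {k : ℤ} (hk : k ≤ -1) (hN : -k ≤ N) :
    (corrT p N * gen (.Gm k) - gen (.Gm k) * corrT p N) • v ∈ Lev ω (s + (Gen.Gm k).lev + 1) := by
  obtain ⟨r, hr⟩ : ∃ r, s + ((Gen.Gm k).lev : ℝ) + 1 = r := ⟨_, rfl⟩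
  have hr' : s + 1 + 1 = r := by rw [← hr, Gen.lev_Gm]; norm_num
  rw [hr]
  have key : ∑ t ∈ Finset.range (p + 2 * N),
      ((sgn (.Gm (t - N)) (.Gm k) • (brk gen (.Gp (p - 1 - (t - N))) (.Gm k) * gen (.Gm (t - N)))
          + gen (.Gp (p - 1 - (t - N))) * brk gen (.Gm (t - N)) (.Gm k)) • v
        + if t = (N + p + 1 + k).toNat then (2 : ℂ) • (gen (.L (-1)) * gen (.Gm (p + 1 + k))) • v else 0)
        ∈ Lev ω r := by
    refine Submodule.sum_mem _ fun t _ => ?_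
    have e : brk gen (.Gm (t - N)) (.Gm k) = 0 := rfl
    have es : sgn (.Gm (t - N)) (.Gm k) = -1 := by simp [sgn, Gen.odd]
    rw [e, es, mul_zero, add_zero, brk, add_mul, add_mul, smul_assoc, add_smul, add_smul, smul_mul_assoc,
      smul_mul_assoc, smul_mul_assoc, smul_assoc, smul_assoc, smul_assoc]
    have iT := two_smul_Lev hv (.T (p - 1 - (t - N) + k + 1)) (.Gm (t - N)) (r := r)
      (by rw [← hr']; simp)
    have iC := two_smul_Lev hv .C (.Gm (t - N)) (r := r)
      (by rw [← hr']; simp)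
    rw [add_assoc, smul_add, add_right_comm]
    refine Submodule.add_mem _ ?_ (Submodule.smul_mem _ _ (Submodule.add_mem _ (Submodule.smul_mem _ _ iT)
      (Submodule.smul_mem _ _ iC)))
    by_cases ht : t = (N + p + 1 + k).toNat
    · rw [if_pos ht]
      have e1 : (p : ℤ) - 1 - (t - N) + k + 1 = -1 := by omega
      have e2 : (t : ℤ) - N = p + 1 + k := by omega
      rw [e1, e2, neg_one_smul, neg_add_cancel]
      exact Submodule.zero_mem _
    · rw [if_neg ht, add_zero]
      refine Submodule.smul_mem _ _ (Submodule.smul_mem _ _ (two_smul_Lev hv _ _ ?_))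
      rw [Gen.lev_L_of_ne (by omega), Gen.lev_Gm, ← hr']
      push_cast; linarith
  rw [Finset.sum_add_distrib, Finset.sum_ite_eq', if_pos (by rw [Finset.mem_range]; omega)] at key
  have := Submodule.sub_mem _ (hr ▸ brk_L_neg_mul_mem (p := p) hv (.Gm k))
    (Submodule.smul_mem _ (1 / 2 : ℂ) key)
  rw [corrT_exchange, sub_smul, add_smul, smul_assoc, Finset.sum_smul]
  have eT : brk gen (.T (p + 1)) (.Gm k) = -gen (.Gm (p + 1 + k)) := rfl
  rw [eT, mul_neg, neg_smul]
  convert this using 1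
  rw [smul_add, smul_smul]
  norm_num
  abel

theorem sum_range_shift {A : Type*} [AddCommGroup A] (f : ℤ → A) (M n : ℕ) :
    ∑ t ∈ Finset.range M, (f (t - n) - f t) = ∑ i ∈ Finset.range n, (f (-1 - i) - f (M - 1 - i)) := by
  induction n with
  | zero => simp
  | succ n ih =>
    rw [Finset.sum_range_succ, ← ih]
    have := Finset.sum_range_sub' (fun t : ℕ => f (t - (n + 1))) M
    have e : f (-1 - n) - f (M - 1 - n) = f ((0 : ℕ) - (n + 1)) - f (M - (n + 1)) := by
      congr 2 <;> push_cast <;> ring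
    rw [e, ← this, ← Finset.sum_add_distrib]
    refine Finset.sum_congr rfl fun t _ => ?_
    have e2 : ((t + 1 : ℕ) : ℤ) - (n + 1) = t - n := by push_cast; ring
    rw [e2]
    push_cast
    abel

/-- The bilinear sum commutes with `T_{-n}` up to two groups of `n` boundary terms, by telescoping.
At one end the raising factor is already on the right; at the other, reordering gives `2 L_{p-n}`
each time. For `n = p + 1` the half-sum is `(p+1) L_{-1}`, to be subtracted from the central term
`(p+1) c/3 · L_{-1}`. -/
theorem corrT_T (hv : v ∈ Lev ω s) {n : ℕ} (hn : n ≤ N)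
    (hP : ∀ j : ℤ, (N : ℤ) - n ≤ j → gen (.Gp j) • v ∈ Lev ω s)
    (hM : ∀ j : ℤ, (N : ℤ) - n ≤ j → gen (.Gm j) • v ∈ Lev ω s) :
    (corrT p N * gen (.T (-n)) - gen (.T (-n)) * corrT p N
      - (if p + 1 = n then (ω.c / 3 - 1) * (p + 1) else 0) • gen (.L (-1))) • v ∈ Lev ω (s + 1) := by
  set h : ℤ → U := fun j => gen (.Gp (p - 1 - n - (j - N))) * gen (.Gm (j - N)) with hh
  have hsum : ∑ t ∈ Finset.range (p + 2 * N),
        (sgn (.Gm (t - N)) (.T (-n)) • (brk gen (.Gp (p - 1 - (t - N))) (.T (-n)) * gen (.Gm (t - N)))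
          + gen (.Gp (p - 1 - (t - N))) * brk gen (.Gm (t - N)) (.T (-n)))
      = ∑ i ∈ Finset.range n, (h (-1 - i) - h ((p + 2 * N : ℕ) - 1 - i)) := by
    rw [← sum_range_shift]
    refine Finset.sum_congr rfl fun t _ => ?_
    have es : sgn (.Gm (t - N)) (.T (-n)) = 1 := by simp [sgn, Gen.odd]
    have e1 : (p : ℤ) - 1 - n - (t - n - N) = p - 1 - (t - N) := by ring
    have e2 : (t : ℤ) - n - N = t - N + -n := by ring
    have e3 : (p : ℤ) - 1 - n - (t - N) = p - 1 - (t - N) + -n := by ring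
    rw [es, one_smul, brk, brk, hh]
    beta_reduce
    rw [e1, e2, e3, neg_mul]
    abel
  have i1 : ∑ i ∈ Finset.range n, (h (-1 - i) • v
      - if p + 1 = n then (2 : ℂ) • gen (.L (-1)) • v else 0) ∈ Lev ω (s + 1) := by
    refine Submodule.sum_mem _ fun i hi => ?_
    rw [hh]
    beta_reduce
    rw [gen_exch, add_smul, smul_assoc, mul_smul, brk, add_smul, add_smul, smul_assoc, smul_assoc,
      smul_assoc]
    have e : (p : ℤ) - 1 - n - (-1 - i - N) + (-1 - i - N) + 1 = p - n := by ring
    rw [e]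
    have iP : gen (.Gm (-1 - i - N)) • gen (.Gp (p - 1 - n - (-1 - i - N))) • v ∈ Lev ω (s + 1) :=
      gen_smul_Lev _ (hP _ (by omega)) (by simp)
    have iT : gen (.T (p - n)) • v ∈ Lev ω (s + 1) := gen_smul_Lev _ hv (by simp)
    have iC : gen .C • v ∈ Lev ω (s + 1) := gen_smul_Lev _ hv (by simp)
    rw [add_sub_assoc, add_assoc ((2 : ℂ) • _), add_sub_right_comm ((2 : ℂ) • _)]
    refine Submodule.add_mem _ (Submodule.smul_mem _ _ iP) (Submodule.add_mem _ ?_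
      (Submodule.add_mem _ (Submodule.smul_mem _ _ iT) (Submodule.smul_mem _ _ iC)))
    split_ifs with hpn
    · have e' : (p : ℤ) - n = -1 := by omega
      rw [e', sub_self]
      exact Submodule.zero_mem _
    · rw [sub_zero]
      refine Submodule.smul_mem _ _ (gen_smul_Lev _ hv ?_)
      rw [Gen.lev_L_of_ne (by omega)]
      simp
  have i2 : ∑ i ∈ Finset.range n, h ((p + 2 * N : ℕ) - 1 - i) • v ∈ Lev ω (s + 1) := by
    refine Submodule.sum_mem _ fun i hi => ?_
    rw [Finset.mem_range] at hi
    rw [hh]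
    beta_reduce
    rw [mul_smul]
    exact gen_smul_Lev _ (hM _ (by push_cast; omega)) (by simp)
  have i3 := brk_L_neg_mul_mem (p := p) hv (.T (-n))
  rw [Gen.lev_T, Nat.cast_zero, add_zero] at i3
  have := Submodule.sub_mem _ i3 (Submodule.smul_mem _ (1 / 2 : ℂ) (Submodule.sub_mem _ i1 i2))
  rw [corrT_exchange, sub_smul, sub_smul, add_smul, smul_assoc, hsum, Finset.sum_smul]
  convert this using 1
  rw [brk.eq_def gen (.T (p + 1)), mul_smul_comm, smul_assoc, mul_smul (gen (.L (-1))) (gen .C),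
    C_smul]
  simp only [sub_smul, Finset.sum_sub_distrib]
  rw [Finset.sum_const, Finset.card_range]
  by_cases hpn : p + 1 = n
  · rw [if_pos hpn, if_pos hpn, if_pos (by omega), ← hpn]
    push_cast
    rw [smul_comm_U, smul_assoc]
    generalize gen (.L (-1)) • v = w
    rw [← Nat.cast_smul_eq_nsmul ℂ]
    generalize ∑ i ∈ Finset.range (p + 1), h (-1 - i) • v = w₂
    generalize ∑ i ∈ Finset.range (p + 1), h (p + 2 * N - 1 - i) • v = w₃
    push_cast
    generalize (brk gen (.L (-1)) (.T (-((p : ℤ) + 1))) * gen (.T ((p : ℤ) + 1))) • v = w₁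
    module
  · rw [if_neg hpn, if_neg hpn, if_neg (by omega)]
    simp

end

/-! ### Uniqueness of singular vector operators -/

/-- Twice the grade of an ordered monomial, less its level. -/
def Idx.defect (X : Idx) : ℕ := (X.I.map fun n => 2 * n + 3).sum + (X.J.map fun n => 2 * (n + 1)).sum
  + (∑ n ∈ X.Kp, 2 * n) + ∑ n ∈ X.Km, 2 * n

theorem Idx.twoGrade_eq (X : Idx) : twoGrade X = X.defect + X.lev := by
  have hI : ∀ s : Multiset ℕ, (s.map fun n => 2 * (n + 2)).sum
      = (s.map fun n => 2 * n + 3).sum + Multiset.card s := fun s => by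
    induction s using Multiset.induction_on with
    | empty => simp
    | cons a s ih => simp only [Multiset.map_cons, Multiset.sum_cons, Multiset.card_cons, ih]; ring
  rw [X.lev_eq, twoGrade, Idx.defect, hI, Finset.sum_add_distrib, Finset.sum_add_distrib]
  simp only [Finset.sum_const, smul_eq_mul, mul_one]
  ring

/-- Every letter but `G^±_{-1/2}` has doubled grade at most `3/2` times its defect. The exceptions
have defect `0` but occur at most once each, which accounts for the `4`. Bounded defect therefore
means finitely many monomials. -/
theorem Idx.two_mul_twoGrade_le (X : Idx) : 2 * twoGrade X ≤ 3 * X.defect + 4 := by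
  have hI : ∀ s : Multiset ℕ, 2 * (s.map fun n => 2 * (n + 2)).sum
      ≤ 3 * (s.map fun n => 2 * n + 3).sum := fun s => by
    induction s using Multiset.induction_on with
    | empty => simp
    | cons a s ih => simp only [Multiset.map_cons, Multiset.sum_cons]; omega
  have hK : ∀ s : Finset ℕ, 2 * ∑ n ∈ s, (2 * n + 1) ≤ 3 * (∑ n ∈ s, 2 * n) + 2 := fun s => by
    have h1 : 2 * ∑ n ∈ s, (2 * n + 1)
        ≤ ∑ n ∈ s, 3 * (2 * n) + ∑ n ∈ s, (if n = 0 then 2 else 0) := by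
      rw [← Finset.sum_add_distrib, Finset.mul_sum]
      refine Finset.sum_le_sum fun n _ => ?_
      split_ifs <;> omega
    have h2 : ∑ n ∈ s, (if n = 0 then 2 else 0) ≤ 2 := by
      rw [Finset.sum_ite_eq']
      split_ifs <;> simp
    rw [← Finset.mul_sum] at h1
    omega
  have h1 := hI X.I
  have h2 := hK X.Kp
  have h3 := hK X.Km
  rw [twoGrade, Idx.defect]
  omega

theorem cutoff_add {V : Type*} [AddCommGroup V] [Module U V] [Module ℂ V] (e : ℂ → V) (a : ℂ)
    (Θ Θ' : Series) (m : ℕ) : cutoff e a (Θ + Θ') m = cutoff e a Θ m + cutoff e a Θ' m := by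
  simp only [cutoff, Pi.add_apply, add_smul, Finset.sum_add_distrib]

theorem IsSingularOp.add {ω : Weight} {ξ : Grade} {Θ Θ' : Series} (h : IsSingularOp ω ξ Θ)
    (h' : IsSingularOp ω ξ Θ') : IsSingularOp ω ξ (Θ + Θ') where
  weight m := by rw [cutoff_add, smul_add, h.weight, h'.weight, smul_add]
  charge m := by rw [cutoff_add, smul_add, h.charge, h'.charge, smul_add]
  raise m hm x hx := by
    rw [cutoff_add, smul_add]
    exact Submodule.add_mem _ (h.raise m hm x hx) (h'.raise m hm x hx)

/-! ### Raising operators on words to leading level, and the vanishing theorem. -/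

/-- Letters other than those acting on the highest weight symbols. -/
def LetW (l : List Gen) : Prop := ∀ x ∈ l, ¬ x.Tail

theorem LetW.of_cons {x : Gen} {l : List Gen} (h : LetW (x :: l)) : LetW l :=
  fun y hy => h y (List.mem_cons_of_mem _ hy)

section

variable {ω : Weight}

/-- The bracket of `L_{n+1}` with `L_{-n-2}` is `(2n+3) L_{-1}`; with any other letter it does not
exceed the level of that letter. -/
theorem L_smul_leadTerm (n : ℕ) {l : List Gen} (hl : LetW l) (b : ℂ) :
    gen (.L (n + 1)) • word l • vec ω b
      - (2 * n + 3 : ℂ) • leadTerm ω (fun _ => 1) (.L (-(n + 2))) b l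
      ∈ Lev ω (2 * b.re + levW l + (1 : ℕ) - 1) := by
  refine smul_word_vec_sub_leadTerm (Q := LetW) (fun _ _ => LetW.of_cons) (fun x l b hxl => ?_)
    (fun b => ?_) (by rw [Gen.lev_L_of_ne (by omega)]) hl b
  · have hx := hxl x (by simp)
    have hv := word_vec_mem_Lev ω l b
    have e : gen (.L (n + 1)) * gen x - (1 : ℂ) • (gen x * gen (.L (n + 1))) = brk gen (.L (n + 1)) x := by
      rw [gen_exch]
      have : sgn (.L (n + 1)) x = 1 := by simp [sgn, Gen.odd]
      rw [this]; abel
    have hs : ∀ g : Gen, g.lev ≤ x.lev →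
        gen g • word l • vec ω b ∈ Lev ω (2 * b.re + levW l + x.lev + (1 : ℕ) - 1) := fun g hg =>
      gen_smul_Lev g hv (by
        have : (g.lev : ℝ) ≤ x.lev := by exact_mod_cast hg
        push_cast; linarith)
    rw [e, sub_smul, smul_assoc]
    by_cases hx0 : x = .L (-(n + 2))
    · rw [if_pos hx0, hx0, brk, if_neg (by omega), zero_smul, add_zero, smul_assoc,
        show (n : ℤ) + 1 + -(n + 2) = -1 by ring, ← sub_smul]
      push_cast
      rw [show (n : ℂ) + 1 - -(n + 2) - (2 * n + 3) = 0 by ring, zero_smul]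
      exact Submodule.zero_mem _
    · rw [if_neg hx0, zero_smul, sub_zero]
      refine brk_smul_mem fun g hg => hs g ?_
      cases x <;> simp only [Occ, Gen.Tail] at hg hx
      case L k =>
        rcases hg with ⟨rfl, -⟩ | ⟨rfl, -⟩
        · have : (n : ℤ) + 1 + k ≠ -1 := fun h => hx0 (by congr 1; omega)
          rw [Gen.lev_L_of_ne this]
          exact Gen.one_le_lev_L k
        · simp
      all_goals rcases hg with ⟨rfl, -⟩; simp
  · have := vec_L ω b (n + 1)
    push_cast at this
    rw [this]
    refine Submodule.smul_mem _ _ (Lev_mono ω ?_ (vec_mem_Lev ω _))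
    have : (0 : ℝ) ≤ n := Nat.cast_nonneg _
    simp
    linarith

/-- The grade bound ensures that the odd boundary modes in `corrT_T` are too high to raise the level
of the rest of the word. -/
theorem corrT_smul_leadTerm (p N : ℕ) {l : List Gen} (hl : LetW l) (hN : (l.map Gen.gr).sum ≤ N) (b : ℂ) :
    corrT p N • word l • vec ω b
      - ((ω.c / 3 - 1) * (p + 1)) • leadTerm ω (fun _ => 1) (.T (-((p + 1 : ℕ) : ℤ))) b l
      ∈ Lev ω (2 * b.re + levW l + (2 : ℕ) - 1) := by
  refine smul_word_vec_sub_leadTerm (Q := fun l => LetW l ∧ (l.map Gen.gr).sum ≤ N) (fun x l h => ?_)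
    (fun x l b hxl => ?_) (fun b => ?_) rfl ⟨hl, hN⟩ b
  · have := Gen.gr_pos (h.1 x (by simp))
    have h2 := h.2
    rw [List.map_cons, List.sum_cons] at h2
    exact ⟨h.1.of_cons, by omega⟩
  · have hx := hxl.1 x (by simp)
    have hv := word_vec_mem_Lev ω l b
    have hg := hxl.2
    have hg0 := gr_sum_nonneg hxl.1.of_cons
    rw [List.map_cons, List.sum_cons] at hg
    have er : 2 * b.re + levW l + x.lev + (2 : ℕ) - 1 = 2 * b.re + levW l + x.lev + 1 := by
      push_cast; ring
    rw [one_smul, er]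
    cases x <;> simp only [Gen.Tail, not_true, Gen.gr] at hx hg
    case L k =>
      rw [if_neg (by simp), zero_smul, sub_zero]
      exact corrT_L hv k
    case Gp k =>
      rw [if_neg (by simp), zero_smul, sub_zero]
      exact corrT_Gp hv (by omega) (by omega)
    case Gm k =>
      rw [if_neg (by simp), zero_smul, sub_zero]
      exact corrT_Gm hv (by omega) (by omega)
    case T k =>
      obtain ⟨n, rfl⟩ : ∃ n : ℕ, k = -n := ⟨(-k).toNat, by omega⟩
      have hc : ((Gen.T (-(n : ℤ))) = .T (-((p + 1 : ℕ) : ℤ))) ↔ p + 1 = n := by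
        rw [Gen.T.injEq]; omega
      simp only [hc]
      rw [Gen.lev_T, Nat.cast_zero, add_zero]
      exact corrT_T hv (by omega)
        (fun j hj => odd_smul_word_vec hxl.1.of_cons (by omega) (Or.inl rfl) b)
        (fun j hj => odd_smul_word_vec hxl.1.of_cons (by omega) (Or.inr rfl) b)
  · exact Lev_mono ω (by push_cast; linarith) (corrT_vec ω p N b)

/-- Letters `T_k` must be absent: their bracket with an odd generator is odd, of level `1` instead
of `0`, and would disturb the leading term. -/
theorem odd_smul_leadTerm (n : ℕ) {z x₀ : Gen}
    (hz : z = .Gp n ∧ x₀ = .Gm (-(n + 2)) ∨ z = .Gm n ∧ x₀ = .Gp (-(n + 2))) {l : List Gen}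
    (hl : LetW l) (hT : ∀ k, .T k ∉ l) (b : ℂ) :
    gen z • word l • vec ω b - (2 : ℂ) • leadTerm ω (sgn z) x₀ b l
      ∈ Lev ω (2 * b.re + levW l + (1 : ℕ) - 1) := by
  refine smul_word_vec_sub_leadTerm (Q := fun l => LetW l ∧ ∀ k, .T k ∉ l) (fun x l h => ?_)
    (fun x l b hxl => ?_) (fun b => ?_) (by rcases hz with ⟨-, rfl⟩ | ⟨-, rfl⟩ <;> rfl) ⟨hl, hT⟩ b
  · exact ⟨h.1.of_cons, fun k hk => h.2 k (List.mem_cons_of_mem _ hk)⟩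
  · have hx := hxl.1 x (by simp)
    have hxT : ∀ k, x ≠ .T k := fun k hk => hxl.2 k (by simp [hk])
    have hv := word_vec_mem_Lev ω l b
    have e : gen z * gen x - sgn z x • (gen x * gen z) = brk gen z x := by
      rw [gen_exch]; abel
    have hs : ∀ g : Gen, g.lev ≤ x.lev →
        gen g • word l • vec ω b ∈ Lev ω (2 * b.re + levW l + x.lev + (1 : ℕ) - 1) := fun g hg =>
      gen_smul_Lev g hv (by
        have : (g.lev : ℝ) ≤ x.lev := by exact_mod_cast hg
        push_cast; linarith)
    rw [e, sub_smul, smul_assoc]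
    by_cases hx0 : x = x₀
    · have key : ∃ c c' : ℂ, brk gen z x = (2 : ℂ) • gen (.L (-1)) + c • gen (.T (-1)) + c' • gen .C := by
        rcases hz with ⟨rfl, rfl⟩ | ⟨rfl, rfl⟩
        · rw [hx0, brk, show (n : ℤ) + -(n + 2) + 1 = -1 by ring]
          exact ⟨_, _, rfl⟩
        · rw [hx0, brk, show (n : ℤ) + -(n + 2) + 1 = -1 by ring]
          exact ⟨_, _, rfl⟩
      obtain ⟨c, c', hcc⟩ := key
      rw [if_pos hx0, hcc, add_smul, add_smul, smul_assoc, smul_assoc, smul_assoc,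
        add_assoc (_ • gen (.L (-1)) • _), add_sub_cancel_left]
      exact Submodule.add_mem _ (Submodule.smul_mem _ _ (hs _ (by simp)))
        (Submodule.smul_mem _ _ (hs _ (by simp)))
    · rw [if_neg hx0, zero_smul, sub_zero]
      refine brk_smul_mem fun g hg => hs g ?_
      rcases hz with ⟨rfl, rfl⟩ | ⟨rfl, rfl⟩
      · cases x <;> simp only [Occ] at hg
        case L k => rcases hg with ⟨rfl, -⟩; exact Gen.one_le_lev_L k
        case T k => exact absurd rfl (hxT k)
        case Gm k =>
          rcases hg with rfl | ⟨rfl, -⟩ | ⟨rfl, -⟩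
          · have : (n : ℤ) + k + 1 ≠ -1 := fun h => hx0 (by congr 1; omega)
            rw [Gen.lev_L_of_ne this, Gen.lev_Gm]
          · simp
          · simp
      · cases x <;> simp only [Occ] at hg
        case L k => rcases hg with ⟨rfl, -⟩; exact Gen.one_le_lev_L k
        case T k => exact absurd rfl (hxT k)
        case Gp k =>
          rcases hg with rfl | ⟨rfl, -⟩ | ⟨rfl, -⟩
          · have : (n : ℤ) + k + 1 ≠ -1 := fun h => hx0 (by congr 1; omega)
            rw [Gen.lev_L_of_ne this, Gen.lev_Gp]
          · simp
          · simp
  · have := odd_smul_word_vec (ω := ω) (l := []) (n := n) (z := z) (by simp) (by simp)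
      (by rcases hz with ⟨rfl, -⟩ | ⟨rfl, -⟩ <;> simp) b
    simpa using this

end

/-- At a fixed total grade, low exponents force monomials of large grade, hence of large defect by
`Idx.two_mul_twoGrade_le`, and large defect means low level. -/
theorem twoGrade_of_mem_order {ω : Weight} {a : ℂ} {t : ℤ} {M : ℕ} {v : Verma ω}
    (h : v ∈ supp ω {p | 2 * p.2 + twoGrade p.1 = 2 * a + t})
    (h' : v ∈ order (vec ω) (a - (M : ℂ) / 2)) {d : ℕ} (ht : t ≤ 0) (hM : 3 * d + 7 - 2 * t ≤ 2 * M) :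
    v ∈ Lev ω (2 * a.re - d - 1) := by
  rw [order_eq_supp] at h'
  refine supp_mono (fun p hp => ?_) (supp_inter h h')
  obtain ⟨h1, k, h2⟩ := hp
  rw [Set.mem_ofPred_eq] at *
  rw [h2] at h1
  have e : ((twoGrade p.1 : ℤ) : ℂ) = ((t + M + k : ℤ) : ℂ) := by
    push_cast
    linear_combination h1
  have e1 : (twoGrade p.1 : ℤ) = t + M + k := by exact_mod_cast e
  have e2 := p.1.two_mul_twoGrade_le
  have e3 := p.1.twoGrade_eq
  have e4 : (d : ℤ) + 1 + t ≤ p.1.defect + t - t := by omega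
  have e5 : (t : ℝ) + M + k = p.1.defect + p.1.lev := by
    have : t + M + k = ((p.1.defect + p.1.lev : ℕ) : ℤ) := by omega
    exact_mod_cast this
  have e6 : (d : ℝ) + 1 ≤ p.1.defect := by
    have : d + 1 ≤ p.1.defect := by omega
    exact_mod_cast this
  have e7 : (t : ℝ) ≤ 0 := by exact_mod_cast ht
  rw [h2]
  simp
  linarith

/-- A neutral singular vector operator without leading part vanishes. -/
theorem IsSingularOp.eq_zero {ω : Weight} {a : ℂ} {Θ : Series} (h : IsSingularOp ω ⟨a, 0⟩ Θ)
    (hc : ω.c ≠ 3) (h1 : Θ idxOne = 0) (h2 : Θ idxPM = 0) : Θ = 0 := by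
  by_contra hne
  have hex : ∃ d, ∃ X, Θ X ≠ 0 ∧ X.defect = d := by
    by_contra! hall
    exact hne (funext fun X => by
      by_contra hX
      exact hall _ X hX rfl)
  -- At a fixed total grade, minimal defect means maximal level; `f` below collects the terms of
  -- maximal level.
  classical
  obtain ⟨X₀, hX₀, hd₀⟩ := Nat.find_spec hex
  set d := Nat.find hex with hd
  have hmin : ∀ X, Θ X ≠ 0 → d ≤ X.defect := fun X hX => Nat.find_min' hex ⟨X, hX, rfl⟩
  set F : Finset Idx := (idxLE (3 * d + 4)).filter fun X => Θ X ≠ 0 ∧ X.defect = d with hF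
  have memF : ∀ X, X ∈ F ↔ Θ X ≠ 0 ∧ X.defect = d := fun X => by
    rw [hF, Finset.mem_filter, mem_idxLE, and_iff_right_iff_imp]
    rintro ⟨-, hX⟩
    have := X.two_mul_twoGrade_le
    omega
  set f : Verma ω := ∑ X ∈ F, Θ X • mono X • vec ω (a - (twoGrade X : ℂ) / 2) with hf
  have hlev : ∀ X ∈ F, 2 * (a - (twoGrade X : ℂ) / 2).re + levW X.letters = 2 * a.re - d := fun X hX => by
    have e : twoGrade X = d + levW X.letters := by
      rw [← ((memF X).1 hX).2]; exact X.twoGrade_eq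
    rw [e]
    simp
    ring
  have hsub : ∀ M ≥ 3 * d + 4, cutoff (vec ω) a Θ M - f ∈ Lev ω (2 * a.re - d - 1) := fun M hM => by
    have hFM : F ⊆ idxLE M := (Finset.filter_subset _ _).trans (idxLE_mono hM)
    rw [cutoff, ← Finset.sum_sdiff hFM, add_sub_cancel_right]
    refine Submodule.sum_mem _ fun X hX => ?_
    by_cases hX0 : Θ X = 0
    · rw [hX0, zero_smul]; exact Submodule.zero_mem _
    refine Submodule.smul_mem _ _ (mono_vec_mem_supp ?_)
    have hXF := (Finset.mem_sdiff.1 hX).2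
    rw [memF] at hXF
    have h3 : d + 1 ≤ X.defect := lt_of_le_of_ne (hmin X hX0) fun he => hXF ⟨hX0, he.symm⟩
    have h4 : (d : ℝ) + 1 ≤ X.defect := by exact_mod_cast h3
    rw [Set.mem_ofPred_eq, X.twoGrade_eq]
    simp
    linarith
  have hraise : ∀ g : Gen, gen g ∈ raising → g.gr ≤ 0 →
      gen g • f ∈ Lev ω (2 * a.re - d + g.lev - 1) := fun g hg ht => by
    -- An even cut-off, as the charge is `0`, and large enough for `twoGrade_of_mem_order`.
    set M := 2 * (3 * d + 7 + g.gr.natAbs) with hM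
    have i1 := twoGrade_of_mem_order (d := d) (by
      simpa using supp_gr [g] (cutoff_mem_grSet ω a Θ M))
      (h.raise M (by rw [hM]; simp [Int.ModEq]) _ hg) ht (by omega)
    have i2 := gen_smul_Lev g (s := 2 * a.re - d + g.lev - 1) (hsub M (by omega)) (by linarith)
    have := Submodule.sub_mem _ (Lev_mono ω (s := 2 * a.re - d + g.lev - 1) (by
      have : (0 : ℝ) ≤ g.lev := Nat.cast_nonneg _
      linarith) i1) i2
    rwa [← smul_sub, sub_sub_cancel] at this
  have letW : ∀ X : Idx, LetW X.letters := fun X => X.good_letters.2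
  have zero_of : ∀ X ∈ F, Θ X = 0 → False := fun X hX h0 => ((memF X).1 hX).1 h0
  -- The letters `T_k` have to be excluded before the odd ones, because `odd_smul_leadTerm` needs
  -- their absence.
  have hL : ∀ X ∈ F, ∀ n : ℕ, .L (-(n + 2)) ∉ X.letters := fun X hX n hn => by
    refine zero_of X hX (coeff_eq_zero_of_leadTerm (ω := ω) hlev (Z := gen (.L (n + 1))) (σ := fun _ => 1)
      (K := 2 * n + 3) (d := 1) (fun _ => one_ne_zero) (fun _ _ => rfl) ?_
      (by rw [Gen.lev_L_of_ne (by omega)]) ?_ (fun X _ b => L_smul_leadTerm n (letW X) b) hX hn)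
    · have : (2 * n + 3 : ℂ) = ((2 * n + 3 : ℕ) : ℂ) := by push_cast; rfl
      rw [this, Nat.cast_ne_zero]
      omega
    · have := hraise (.L (n + 1)) ⟨n, Or.inl rfl⟩ (by simp only [Gen.gr]; omega)
      rwa [Gen.lev_L_of_ne (by omega)] at this
  have hT : ∀ X ∈ F, ∀ k, .T k ∉ X.letters := fun X hX k hk => by
    obtain ⟨p, rfl⟩ : ∃ p : ℕ, k = -((p + 1 : ℕ) : ℤ) := by
      have : ¬ (Gen.T k).Tail := X.good_letters.2 _ hk
      simp only [Gen.Tail, not_le] at this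
      exact ⟨(-k - 1).toNat, by omega⟩
    refine zero_of X hX (coeff_eq_zero_of_leadTerm (ω := ω) hlev (Z := corrT p (3 * d + 4)) (σ := fun _ => 1)
      (K := (ω.c / 3 - 1) * (p + 1)) (d := 2) (fun _ => one_ne_zero) (fun _ _ => rfl) ?_ rfl ?_
      (fun X hX b => corrT_smul_leadTerm p _ (letW X) ?_ b) hX hk)
    · refine mul_ne_zero (fun h => hc ?_) (by exact_mod_cast Nat.succ_ne_zero p)
      linear_combination 3 * h
    · have := corrT_smul_mem (ω := ω) (p := p) (N := 3 * d + 4) (r := 2 * a.re - d) (v := f) ?_ ?_ ?_ ?_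
      · convert this using 2
        push_cast; ring
      · exact Submodule.sum_mem _ fun X hX => Submodule.smul_mem _ _ (by
          rw [mono_eq_word, ← hlev X hX]; exact word_vec_mem_Lev ω _ _)
      · have := hraise (.T (p + 1)) ⟨p, Or.inr (Or.inl rfl)⟩ (by simp only [Gen.gr]; omega)
        simpa using this
      · intro n
        have := hraise (.Gp n) ⟨n, Or.inr (Or.inr (Or.inl rfl))⟩ (by simp only [Gen.gr]; omega)
        simpa using this
      · intro n
        have := hraise (.Gm n) ⟨n, Or.inr (Or.inr (Or.inr rfl))⟩ (by simp only [Gen.gr]; omega)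
        simpa using this
    · have h3 := (Finset.mem_filter.1 (hF ▸ hX)).1
      rw [mem_idxLE] at h3
      have h4 := X.gr_eq
      rw [Idx.gr] at h4
      rw [h4]
      exact_mod_cast h3
  have hG : ∀ X ∈ F, ∀ (n : ℕ) (z x₀ : Gen), (z = .Gp n ∧ x₀ = .Gm (-(n + 2)) ∨
      z = .Gm n ∧ x₀ = .Gp (-(n + 2))) → x₀ ∉ X.letters := fun X hX n z x₀ hz hn => by
    refine zero_of X hX (coeff_eq_zero_of_leadTerm (ω := ω) hlev (Z := gen z) (σ := sgn z)
      (K := 2) (d := 1) (fun x => ?_) (fun h => ?_) two_ne_zero ?_ ?_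
      (fun X hX b => odd_smul_leadTerm n hz (letW X) (hT X hX) b) hX hn)
    · rw [sgn]; split_ifs <;> simp
    · rcases hz with ⟨-, rfl⟩ | ⟨-, rfl⟩ <;> simp [Gen.odd] at h
    · rcases hz with ⟨-, rfl⟩ | ⟨-, rfl⟩ <;> rfl
    · rcases hz with ⟨rfl, -⟩ | ⟨rfl, -⟩
      · exact hraise (.Gp n) ⟨n, Or.inr (Or.inr (Or.inl rfl))⟩ (by simp only [Gen.gr]; omega)
      · exact hraise (.Gm n) ⟨n, Or.inr (Or.inr (Or.inr rfl))⟩ (by simp only [Gen.gr]; omega)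
  have hX₀F := (memF X₀).2 ⟨hX₀, hd₀⟩
  have hlead : X₀ ∈ leadIdx := by
    by_contra hX
    obtain ⟨-, x, hx, hn⟩ := npW_letters hX
    cases x <;> simp only [Gen.Np] at hn
    case L k =>
      obtain ⟨n, rfl⟩ : ∃ n : ℕ, k = -(n + 2) := ⟨(-k - 2).toNat, by omega⟩
      exact hL X₀ hX₀F n hx
    case T k => exact hT X₀ hX₀F k hx
    case Gp k =>
      obtain ⟨n, rfl⟩ : ∃ n : ℕ, k = -(n + 2) := ⟨(-k - 2).toNat, by omega⟩
      exact hG X₀ hX₀F n _ _ (Or.inr ⟨rfl, rfl⟩) hx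
    case Gm k =>
      obtain ⟨n, rfl⟩ : ∃ n : ℕ, k = -(n + 2) := ⟨(-k - 2).toNat, by omega⟩
      exact hG X₀ hX₀F n _ _ (Or.inl ⟨rfl, rfl⟩) hx
  have hch := h.ch_eq hX₀
  obtain ⟨c1, c2, c3, c4⟩ := Idx.ch_lead
  simp only [leadIdx, Finset.mem_insert, Finset.mem_singleton] at hlead
  rcases hlead with rfl | rfl | rfl | rfl
  · exact hX₀ h1
  · rw [c2] at hch; simp at hch
  · rw [c3] at hch; simp at hch
  · exact hX₀ h2

theorem IsTheta.unique {ω : Weight} {ξ : Grade} {α β : ℂ} {Θ Θ' : Series} (hc : ω.c ≠ 3)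
    (h : IsTheta ω ξ α β Θ) (h' : IsTheta ω ξ α β Θ') : Θ' = Θ := by
  obtain ⟨a, p⟩ := ξ
  obtain ⟨rfl, h1, h2, h3⟩ := h
  obtain ⟨-, h1', h2', h3'⟩ := h'
  have := (h1'.add (h1.smul (-1))).eq_zero hc (by simp [h2, h2']) (by simp [h3, h3'])
  rw [neg_one_smul, ← sub_eq_add_neg, sub_eq_zero] at this
  exact this

/-- With `2β` and `α - β` as coefficients, the leading product formula gives twice the corresponding
expressions in `α₁ α₂` and `β₁ β₂`; the scalar `1/2` compensates. -/
theorem HasLeading.prod_neutral {a₂ a₁ α₁ β₁ α₂ β₂ : ℂ} {Θ₁ Θ₂ : Series} (h₂ : HasLeading Θ₂ α₂ β₂)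
    (h₁ : HasLeading Θ₁ α₁ β₁) (c₂ : ∀ X, Θ₂ X ≠ 0 → X.ch = 0) (c₁ : ∀ X, Θ₁ X ≠ 0 → X.ch = 0) :
    HasLeading ((1 / 2 : ℂ) • prodSeries a₂ Θ₂ a₁ Θ₁) (α₁ * α₂) (β₁ * β₂) := by
  obtain ⟨e1, e2⟩ := prodSeries_lead_neutral (a₂ := a₂) (a₁ := a₁) c₂ c₁
  constructor
  · rw [Pi.smul_apply, e1, h₂.1, h₁.1, smul_eq_mul]; ring
  · rw [Pi.smul_apply, e2, h₂.1, h₁.1, h₂.2, h₁.2, smul_eq_mul]; ring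

end N2

end

/-! ### The product theorem. -/

theorem mainTheorem6 :
    -- neutral operators
    (∀ (ω₁ ω₂ : N2.Weight) (ξ₁ ξ₂ : N2.Grade) (α₁ β₁ α₂ β₂ : ℂ) (Θ₁ Θ₂ : N2.Series),
      ω₁.c ≠ 3 →
      N2.IsTheta ω₁ ξ₁ α₁ β₁ Θ₁ → N2.IsTheta ω₂ ξ₂ α₂ β₂ Θ₂ →
      N2.Related ω₁ ξ₁ ω₂ →
      ∃ θ : N2.Series,
        (∀ θ', N2.IsTheta ω₁ (ξ₁.add ξ₂) (α₁ * α₂) (β₁ * β₂) θ' ↔ θ' = θ) ∧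
        (∀ P, N2.IsCauchyProduct ξ₂ Θ₂ ξ₁ Θ₁ P ↔ P = (2 : ℂ) • θ)) ∧
    -- charged operators, first `Θ⁺`, then `Θ⁻`
    (∀ (ωp ωm : N2.Weight) (ξp ξm : N2.Grade) (Θp Θm : N2.Series),
      ωp.c ≠ 3 →
      N2.IsThetaPlus ωp ξp Θp → N2.IsThetaMinus ωm ξm Θm →
      N2.Related ωp ξp ωm →
      ∃ θ : N2.Series,
        (∀ θ', N2.IsTheta ωp (ξp.add ξm) 0 1 θ' ↔ θ' = θ) ∧
        (∀ P, N2.IsCauchyProduct ξm Θm ξp Θp P ↔ P = θ)) ∧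
    -- charged operators, first `Θ⁻`, then `Θ⁺`
    (∀ (ωp ωm : N2.Weight) (ξp ξm : N2.Grade) (Θp Θm : N2.Series),
      ωm.c ≠ 3 →
      N2.IsThetaPlus ωp ξp Θp → N2.IsThetaMinus ωm ξm Θm →
      N2.Related ωm ξm ωp →
      ∃ θ : N2.Series,
        (∀ θ', N2.IsTheta ωm (ξm.add ξp) 1 0 θ' ↔ θ' = θ) ∧
        (∀ P, N2.IsCauchyProduct ξp Θp ξm Θm P ↔ P = θ)) := by
  refine ⟨fun ω₁ ω₂ ξ₁ ξ₂ α₁ β₁ α₂ β₂ Θ₁ Θ₂ hc h₁ h₂ hω => ?_,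
    fun ωp ωm ξp ξm Θp Θm hc hp hm hω => ?_, fun ωp ωm ξp ξm Θp Θm hc hp hm hω => ?_⟩
  · obtain ⟨p1, s1, l1⟩ := h₁
    obtain ⟨p2, s2, l2⟩ := h₂
    have hθ : N2.IsTheta ω₁ (ξ₁.add ξ₂) (α₁ * α₂) (β₁ * β₂)
        ((1 / 2 : ℂ) • N2.prodSeries ξ₂.a Θ₂ ξ₁.a Θ₁) :=
      ⟨by simp [N2.Grade.add, p1, p2], (s1.prod s2 hω).smul _,
        l2.prod_neutral l1 (fun X hX => p2 ▸ s2.ch_eq hX) (fun X hX => p1 ▸ s1.ch_eq hX)⟩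
    refine ⟨_, fun θ' => ⟨fun h => hθ.unique hc h, fun h => h ▸ hθ⟩, fun P => ?_⟩
    rw [N2.isCauchyProduct_iff, smul_smul]
    norm_num
  · obtain ⟨p1, s1, l1⟩ := hp
    obtain ⟨p2, s2, l2⟩ := hm
    have hθ : N2.IsTheta ωp (ξp.add ξm) 0 1 (N2.prodSeries ξm.a Θm ξp.a Θp) :=
      ⟨by simp [N2.Grade.add, p1, p2], s1.prod s2 hω,
        N2.prodSeries_lead_MP (fun X hX => p2 ▸ s2.ch_eq hX) (fun X hX => p1 ▸ s1.ch_eq hX) l2 l1⟩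
    exact ⟨_, fun θ' => ⟨fun h => hθ.unique hc h, fun h => h ▸ hθ⟩, N2.isCauchyProduct_iff _ _ _ _⟩
  · obtain ⟨p1, s1, l1⟩ := hp
    obtain ⟨p2, s2, l2⟩ := hm
    have hθ : N2.IsTheta ωm (ξm.add ξp) 1 0 (N2.prodSeries ξp.a Θp ξm.a Θm) :=
      ⟨by simp [N2.Grade.add, p1, p2], s2.prod s1 hω,
        N2.prodSeries_lead_PM (fun X hX => p1 ▸ s1.ch_eq hX) (fun X hX => p2 ▸ s2.ch_eq hX) l1 l2⟩
    exact ⟨_, fun θ' => ⟨fun h => hθ.unique hc h, fun h => h ▸ hθ⟩, N2.isCauchyProduct_iff _ _ _ _⟩
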